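/- **Setting.** Let $\mathbf c=(c_{ij})_{i,j\in I}$ be a Cartan matrix of finite type, $t=\max\{1,-c_{ij}\;(i\neq j)\}$ its lacing number, $(d_i)$ a symmetrizer by positive integers dividing $t$, $b_{ij}=d_ic_{ij}=b_{ji}$, $t_i=t/d_i$. Fix an orientation $\mathrm O\subset I\times I$ of $\mathbf c$ (for each $i,j$, $c_{ij}<0$ if and only if one of $(i,j),(j,i)$ lies in $\mathrm O$, and then only one does). Let $o_{ij}=1$ if $(i,j)\in \mathrm O$, $o_{ij}=-1$ if $(j,i)\in\mathrm O$, and $o_{ij}=0$ otherwise. Put $I^\bullet=I\times\mathbb Z$. *Quiver variety.* Fix a finite family $(i_1,k_1),\dots,(i_s,k_s)$ in $I^\bullet$ and an $I^\bullet$-graded complex vector space $W=\bigoplus_{r=1}^s S_{i_r,k_r}$, where $S_{i,k}$ is one dimensional of degree $(i,k)$; every finite dimensional $I^\bullet$-graded $W$ is of this form. For $v\in\mathbb N I^\bullet$ (finitely supported) let $V=\mathbb C^v$, and let $\widehat{\mathrm X}^\bullet(v,W)$ be the space of tuples $x=(\alpha,\varepsilon,a)$ of linear maps $$\alpha_{ij}:V_{j,k}\to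 V_{i,k+b_{ij}}\ (c_{ij}<0),\qquad \varepsilon_i:V_{i,k}\to V_{i,k+2d_i},\qquad a_i:V_{i,k}\to W_{i,k-d_i}\qquad(k\in\mathbb Z).$$ The tuple $x$ is stable if $0$ is the only graded subspace of $V$ which is stable under all $\alpha_{ij},\varepsilon_i$ and killed by all $a_i$. Let $G^0_v=\prod_{(i,k)}\mathrm{GL}(V_{i,k})$, $\widehat{\mathfrak M}^\bullet(v,W)=\widehat{\mathrm X}^\bullet(v,W)_s/G^0_v$ (the quotient of the stable locus) and $\widehat{\mathfrak M}^\bullet(W)=\bigsqcup_v\widehat{\mathfrak M}^\bullet(v,W)$. Let $\widehat{\mathfrak L}^\bullet(W)=\bigsqcup_v\widehat{\mathfrak L}^\bullet(v,W)$ be the $0$-fiber, i.e. $\widehat{\mathfrak L}^\bullet(v,W)$ is the fiber over the image of $0$ of the map from $\widehat{\mathfrak M}^\bullet(v,W)$ to the categorical quotient $\operatorname{Spec}\mathbb C[\widehat{\mathrm X}^\bullet(v,W)]^{G^0_v}$. Let $\hat f_2^\bullet:\widehat{\mathfrak M}^\bullet(W)\to\mathbb C$ be the function induced by the trace over $V$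 of the potential $\sum_{i,j\in I}o_{ij}\,\varepsilon_i^{-c_{ij}}\alpha_{ij}\alpha_{ji}$. *Quiver Grassmannian.* Let $\widetilde\Pi$ be the quotient of the path algebra of the quiver with vertex set $I$ and arrows $\alpha_{ij}:j\to i$ ($c_{ij}<0$), $\varepsilon_i:i\to i$ by the relations $$\varepsilon_i^{-c_{ij}}\alpha_{ij}=\alpha_{ij}\varepsilon_j^{-c_{ji}},\qquad \sum_{j}\sum_{k=0}^{-c_{ij}-1}o_{ij}\,\varepsilon_i^{k}\alpha_{ij}\alpha_{ji}\varepsilon_i^{-c_{ij}-1-k}=0 ,$$ for all $i,j$ with $c_{ij}<0$, resp. for all $i$ with the outer sum over the $j$ with $c_{ij}<0$. It is graded by $\deg\alpha_{ij}=b_{ij}$, $\deg\varepsilon_i=2d_i$. Let $e_i\in\widetilde\Pi$ be the idempotent of the vertex $i$, and $\omega=\sum_i\varepsilon_i^{t_i}$. For a graded $\widetilde\Pi$-module $M$ let $M^\vee$ be its graded dual, $(M^\vee)_k=(M_{-k})^*$, with the transposed action twisted by the anti-involution fixing $e_i,\varepsilon_i$ and exchanging $\alpha_{ij}$ and $\alpha_{ji}$,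 and let $(M[n])_k=M_{n+k}$. Set $$I_i=\bigcup_{l>0}\big((\widetilde\Pi/\widetilde\Pi\omega^l)e_i\big)^\vee,\qquad I_W=\bigoplus_{r=1}^s I_{i_r}[-k_r-d_{i_r}],$$ so that the cogenerator of the $r$-th summand (the linear form dual to $e_{i_r}$) has degree $(i_r,k_r+d_{i_r})$. Let $\underline a:I_W\to W$, homogeneous of degree $-d_i$ at the vertex $i$, be the sum of the evaluations at the elements $e_{i_r}$. Let $\widetilde{\mathrm{Gr}}{}^\bullet(I_W)=\bigsqcup_{v\in\mathbb N I^\bullet}\widetilde{\mathrm{Gr}}{}^\bullet_v(I_W)$, where $\widetilde{\mathrm{Gr}}{}^\bullet_v(I_W)$ is the Grassmannian of graded $\widetilde\Pi$-submodules of $I_W$ of graded dimension $v$. **Proposition.** There is a homeomorphism $$\operatorname{crit}(\hat f_2^\bullet)\;\simeq\;\widetilde{\mathrm{Gr}}{}^\bullet(I_W),$$ both for the Zariski topology (on closed points) and for the classical topology. It is compatible with the decompositions over $v$, and the point corresponding to a submodule $U\subset I_W$ is the class of $U$ with the restricted actions of the $\alpha_{ij},\varepsilon_i$ and the restriction $\underline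 a|_U:U\to W$. Moreover $$\operatorname{crit}(\hat f_2^\bullet)\subset\widehat{\mathfrak L}^\bullet(W).$$ -/

import Mathlib

open scoped DirectSum

noncomputable section

namespace GradedTriple

universe u w

/-! ### Cartan matrices, orientations -/

/-- The lacing number of a Cartan matrix: the maximum of `1` and of all the `-c i j`
(the diagonal entries, equal to `2`, do not contribute). -/
def lacing {I : Type u} [Fintype I] (c : Matrix I I ℤ) : ℕ :=
  max 1 (Finset.univ.sup fun p : I × I => (-(c p.1 p.2)).toNat)

/-- A Cartan matrix of finite type, with its symmetrizer `d` (positive integers dividing the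
lacing number) and an orientation `O`. -/
structure CartanDatum (I : Type u) [Fintype I] [DecidableEq I] where
  c : Matrix I I ℤ
  d : I → ℕ
  O : Finset (I × I)
  diag : ∀ i, c i i = 2
  nonpos : ∀ i j, i ≠ j → c i j ≤ 0
  d_pos : ∀ i, 0 < d i
  symmetrizes : ∀ i j, (d i : ℤ) * c i j = (d j : ℤ) * c j i
  finiteType : (Matrix.of fun i j => ((d i : ℝ) * (c i j : ℝ))).PosDef
  d_dvd : ∀ i, d i ∣ lacing c
  orient : ∀ i j, ((i, j) ∈ O ∨ (j, i) ∈ O) ↔ c i j < 0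
  orient_asymm : ∀ i j, (i, j) ∈ O → (j, i) ∉ O

variable {I : Type u} [Fintype I] [DecidableEq I] (D : CartanDatum I)

namespace CartanDatum

/-- `b_{ij} = d_i c_{ij}`. -/
def b (i j : I) : ℤ := (D.d i : ℤ) * D.c i j

/-- The sign `o_{ij}` of the orientation. -/
def o (i j : I) : ℤ := if (i, j) ∈ D.O then 1 else if (j, i) ∈ D.O then -1 else 0

/-- The natural number `-c_{ij}` (used for `c_{ij} ≤ 0`). -/
def m (i j : I) : ℕ := (-(D.c i j)).toNat

/-- The exponent `t_i = t / d_i`, with `t` the lacing number. -/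
def texp (i : I) : ℕ := lacing D.c / D.d i

theorem b_symm (i j : I) : D.b i j = D.b j i := D.symmetrizes i j

end CartanDatum

/-! ### The graded triple quiver and its representations

The vertices of the graded quiver are the pairs `s = (i, k)` in `I × ℤ`. Between two given vertices
there is at most one arrow of each kind, so an arrow is recorded by a proposition on its source and
its target. -/

/-- There is an arrow `α_{ij} : (j, k) → (i, k + b_{ij})` for `c_{ij} < 0`
(here `s = (j, k)` is the source and `t` is the target). -/
abbrev AlphaArrow (s t : I × ℤ) : Prop := D.c t.1 s.1 < 0 ∧ t.2 = s.2 + D.b t.1 s.1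

/-- The arrow `ε_i : (i, k) → (i, k + 2 d_i)`. -/
abbrev EpsArrow (s t : I × ℤ) : Prop := t.1 = s.1 ∧ t.2 = s.2 + 2 * (D.d s.1 : ℤ)

/-- The framing arrow `a_i : (i, k) → (i', k - d_i)`. -/
abbrev FrameArrow (s t : I × ℤ) : Prop := t.1 = s.1 ∧ t.2 = s.2 - (D.d s.1 : ℤ)

/-- Representations `(α, ε)` of the graded triple quiver in the graded vector space `V`. -/
abbrev TripleRep (V : I × ℤ → Type w) [∀ s, AddCommGroup (V s)] [∀ s, Module ℂ (V s)] : Type _ :=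
  (∀ p : {p : (I × ℤ) × (I × ℤ) // AlphaArrow D p.1 p.2}, V p.1.1 →ₗ[ℂ] V p.1.2) ×
    (∀ p : {p : (I × ℤ) × (I × ℤ) // EpsArrow D p.1 p.2}, V p.1.1 →ₗ[ℂ] V p.1.2)

/-- Representations `((α, ε), a)` of the graded triple quiver with simple framing in the pair of
graded vector spaces `V`, `W`. -/
abbrev FramedRep (V : I × ℤ → Type*) [∀ s, AddCommGroup (V s)] [∀ s, Module ℂ (V s)]
    (W : I × ℤ → Type*) [∀ s, AddCommGroup (W s)] [∀ s, Module ℂ (W s)] : Type _ :=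
  TripleRep D V ×
    (∀ p : {p : (I × ℤ) × (I × ℤ) // FrameArrow D p.1 p.2}, V p.1.1 →ₗ[ℂ] W p.1.2)

section Reps

variable {D}
variable {V : I × ℤ → Type*} [∀ s, AddCommGroup (V s)] [∀ s, Module ℂ (V s)]
variable {W : I × ℤ → Type*} [∀ s, AddCommGroup (W s)] [∀ s, Module ℂ (W s)]

/-- A graded subspace which is stable under all the arrows `α`, `ε`. -/
def IsSubrep (x : TripleRep D V) (U : ∀ s, Submodule ℂ (V s)) : Prop :=
  (∀ p, U p.1.1 ≤ (U p.1.2).comap (x.1 p)) ∧ (∀ p, U p.1.1 ≤ (U p.1.2).comap (x.2 p))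

/-- Stability: no non-zero subrepresentation is supported on `V`. -/
def Stable (x : FramedRep D V W) : Prop :=
  ∀ U : ∀ s, Submodule ℂ (V s), IsSubrep x.1 U →
    (∀ p, U p.1.1 ≤ LinearMap.ker (x.2 p)) → ∀ s, U s = ⊥

/-- The action of the group `∏ GL(V_{i,k})` of graded automorphisms of `V`. -/
def act (g : ∀ s, V s ≃ₗ[ℂ] V s) (x : FramedRep D V W) : FramedRep D V W :=
  ((fun p => (g p.1.2).toLinearMap ∘ₗ x.1.1 p ∘ₗ (g p.1.1).symm.toLinearMap,
    fun p => (g p.1.2).toLinearMap ∘ₗ x.1.2 p ∘ₗ (g p.1.1).symm.toLinearMap),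
    fun p => x.2 p ∘ₗ (g p.1.1).symm.toLinearMap)

/-- The arrow `α_{ij}`, in all degrees, as an endomorphism of the total space `⨁ V_{i,k}`. -/
def alphaTot (x : TripleRep D V) (i j : I) : Module.End ℂ (⨁ s, V s) :=
  DirectSum.toModule ℂ (I × ℤ) (⨁ s, V s) fun s =>
    if h : s.1 = j ∧ D.c i j < 0 then
      DirectSum.lof ℂ (I × ℤ) V (i, s.2 + D.b i j) ∘ₗ
        x.1 ⟨(s, (i, s.2 + D.b i j)), by obtain ⟨rfl, h⟩ := h; exact ⟨h, rfl⟩⟩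
    else 0

/-- The arrow `ε_i`, in all degrees, as an endomorphism of the total space `⨁ V_{i,k}`. -/
def epsTot (x : TripleRep D V) (i : I) : Module.End ℂ (⨁ s, V s) :=
  DirectSum.toModule ℂ (I × ℤ) (⨁ s, V s) fun s =>
    if s.1 = i then
      DirectSum.lof ℂ (I × ℤ) V (s.1, s.2 + 2 * (D.d s.1 : ℤ)) ∘ₗ
        x.2 ⟨(s, (s.1, s.2 + 2 * (D.d s.1 : ℤ))), rfl, rfl⟩
    else 0

/-- The function `f₂`: the trace of the potential
`w₂ = ∑_{i,j} o_{ij} ε_i^{-c_{ij}} α_{ij} α_{ji}`. -/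
def potential (x : FramedRep D V W) : ℂ :=
  ∑ i : I, ∑ j : I, (D.o i j : ℂ) *
    LinearMap.trace ℂ (⨁ s, V s)
      (epsTot x.1 i ^ D.m i j * alphaTot x.1 i j * alphaTot x.1 j i)

/-- `x` is a critical point of `f₂` on the space of representations: the differential of the
polynomial function `f₂` vanishes at `x`, i.e. all its directional derivatives do. -/
def IsCritical (x : FramedRep D V W) : Prop :=
  ∀ y : FramedRep D V W, lineDeriv ℂ (potential (D := D) (V := V) (W := W)) x y = 0

theorem act_act (g h : ∀ s, V s ≃ₗ[ℂ] V s) (x : FramedRep D V W) :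
    act (fun s => (h s).trans (g s)) x = act g (act h x) := rfl

theorem act_symm_act (g : ∀ s, V s ≃ₗ[ℂ] V s) (x : FramedRep D V W) :
    act (fun s => (g s).symm) (act g x) = x := by
  refine Prod.ext (Prod.ext ?_ ?_) ?_ <;> funext p <;> ext v <;> simp [act]

/-- The automorphism of the total space given by a graded automorphism. -/
def totAut (g : ∀ s, V s ≃ₗ[ℂ] V s) : (⨁ s, V s) ≃ₗ[ℂ] (⨁ s, V s) :=
  DFinsupp.mapRange.linearEquiv g

theorem totAut_lof (g : ∀ s, V s ≃ₗ[ℂ] V s) (s : I × ℤ) (v : V s) :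
    totAut g (DirectSum.lof ℂ (I × ℤ) V s v) = DirectSum.lof ℂ (I × ℤ) V s (g s v) :=
  DFinsupp.mapRange_single (hf := fun s => map_zero (g s))

theorem alphaTot_act (g : ∀ s, V s ≃ₗ[ℂ] V s) (x : FramedRep D V W) (i j : I) :
    alphaTot (act g x).1 i j = (totAut g).conj (alphaTot x.1 i j) := by
  have h : totAut g ∘ₗ alphaTot x.1 i j = alphaTot (act g x).1 i j ∘ₗ (totAut g).toLinearMap := by
    refine DirectSum.linearMap_ext ℂ fun s => LinearMap.ext fun v => ?_
    simp only [LinearMap.comp_apply, LinearEquiv.coe_coe, totAut_lof, alphaTot, DirectSum.toModule_lof]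
    split_ifs with h
    · simp only [LinearMap.comp_apply, totAut_lof, act, LinearEquiv.coe_coe,
        LinearEquiv.symm_apply_apply]
    · simp
  rw [LinearEquiv.conj_apply, LinearMap.comp_assoc, ← LinearMap.comp_assoc, h,
    LinearMap.comp_assoc]
  simp

theorem epsTot_act (g : ∀ s, V s ≃ₗ[ℂ] V s) (x : FramedRep D V W) (i : I) :
    epsTot (act g x).1 i = (totAut g).conj (epsTot x.1 i) := by
  have h : totAut g ∘ₗ epsTot x.1 i = epsTot (act g x).1 i ∘ₗ (totAut g).toLinearMap := by
    refine DirectSum.linearMap_ext ℂ fun s => LinearMap.ext fun v => ?_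
    simp only [LinearMap.comp_apply, LinearEquiv.coe_coe, totAut_lof, epsTot, DirectSum.toModule_lof]
    split_ifs with h
    · simp only [LinearMap.comp_apply, totAut_lof, act, LinearEquiv.coe_coe,
        LinearEquiv.symm_apply_apply]
    · simp
  rw [LinearEquiv.conj_apply, LinearMap.comp_assoc, ← LinearMap.comp_assoc, h,
    LinearMap.comp_assoc]
  simp

/-- The function `f₂` is invariant, hence it descends to the quiver variety. -/
theorem potential_act (g : ∀ s, V s ≃ₗ[ℂ] V s) (x : FramedRep D V W) :
    potential (act g x) = potential x := by
  unfold potential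
  refine Finset.sum_congr rfl fun i _ => Finset.sum_congr rfl fun j _ => ?_
  have h : ∀ A : Module.End ℂ (⨁ s, V s), (totAut g).conj A = (totAut g).conjAlgEquiv ℂ A :=
    fun _ => rfl
  rw [alphaTot_act, alphaTot_act, epsTot_act, h, h, h, ← map_pow, ← map_mul, ← map_mul, ← h,
    LinearMap.trace_conj']

theorem act_add_smul (g : ∀ s, V s ≃ₗ[ℂ] V s) (x y : FramedRep D V W) (a : ℂ) :
    act g (x + a • y) = act g x + a • act g y := by
  refine Prod.ext (Prod.ext ?_ ?_) ?_ <;> funext p <;> ext v <;> simp [act]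

/-- Being critical only depends on the orbit. -/
theorem isCritical_act (g : ∀ s, V s ≃ₗ[ℂ] V s) {x : FramedRep D V W} (hx : IsCritical x) :
    IsCritical (act g x) := by
  intro y
  have h : y = act g (act (fun s => (g s).symm) y) :=
    (act_symm_act (fun s => (g s).symm) y).symm
  rw [← hx (act (fun s => (g s).symm) y), h]
  simp only [lineDeriv, ← act_add_smul, potential_act, act_symm_act]

end Reps

/-! ### Zariski and classical topologies on vector spaces -/

/-- The algebra of polynomial functions on a complex vector space. -/
def polyFun (E : Type*) [AddCommGroup E] [Module ℂ E] : Subalgebra ℂ (E → ℂ) :=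
  Algebra.adjoin ℂ (Set.range fun φ : Module.Dual ℂ E => (φ : E → ℂ))

/-- The two topologies of complex varieties. -/
inductive TopKind
  | zariski
  | classical

/-- The Zariski topology, with the sets `{p ≠ 0}` for `p` a polynomial function as a basis,
and the classical topology, the coarsest one for which all linear forms are
continuous (for a finite dimensional space this is its usual topology). -/
abbrev vecTop (τ : TopKind) (E : Type*) [AddCommGroup E] [Module ℂ E] : TopologicalSpace E :=
  match τ with
  | .zariski => TopologicalSpace.generateFrom {U | ∃ p ∈ polyFun E, U = {x | p x ≠ 0}}
  | .classical => ⨅ φ : Module.Dual ℂ E, TopologicalSpace.induced φ inferInstance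

/-! ### The graded simply framed triple quiver variety -/

/-- Dimension vectors in `ℕ I^•`. -/
abbrev DimVec (I : Type u) : Type u := I × ℤ →₀ ℕ

/-- The graded vector space `ℂ^v`. -/
abbrev Std (v : DimVec I) (s : I × ℤ) : Type := Fin (v s) → ℂ

section Variety

variable (W : I × ℤ → Type w) [∀ s, AddCommGroup (W s)] [∀ s, Module ℂ (W s)]

/-- Stable framed representations in `ℂ^v`, `W`. -/
abbrev StableRep (v : DimVec I) : Type _ := {x : FramedRep D (Std v) W // Stable x}

/-- Two stable representations are equivalent if they are in the same orbit. -/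
def orbitSetoid (v : DimVec I) : Setoid (StableRep D W v) where
  r x y := ∃ g : ∀ s, Std v s ≃ₗ[ℂ] Std v s, act g x.1 = y.1
  iseqv :=
    { refl := fun x => ⟨fun s => LinearEquiv.refl ℂ _, rfl⟩
      symm := by
        rintro x y ⟨g, hg⟩
        exact ⟨fun s => (g s).symm, by rw [← hg, act_symm_act]⟩
      trans := by
        rintro x y z ⟨g, hg⟩ ⟨h, hh⟩
        exact ⟨fun s => (g s).trans (h s), by rw [act_act, hg, hh]⟩ }

/-- The quotient of the set of stable representations of dimension `v` by the group action. -/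
def QuiverVarietyAt (v : DimVec I) : Type _ := Quotient (orbitSetoid D W v)

/-- The graded simply framed triple quiver variety, the disjoint union of its components. -/
abbrev QuiverVariety : Type _ := Σ v : DimVec I, QuiverVarietyAt D W v

variable {D W} in
/-- The point of the quiver variety given by a stable representation. -/
def orbit {v : DimVec I} (x : StableRep D W v) : QuiverVariety D W :=
  ⟨v, Quotient.mk (orbitSetoid D W v) x⟩

/-- The quotient topology, and on the disjoint union the topology of a disjoint union. -/
abbrev quiverVarietyTop (τ : TopKind) : TopologicalSpace (QuiverVariety D W) :=
  @instTopologicalSpaceSigma (DimVec I) (QuiverVarietyAt D W) fun v =>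
    TopologicalSpace.coinduced (Quotient.mk (orbitSetoid D W v))
      (TopologicalSpace.induced Subtype.val (vecTop τ (FramedRep D (Std v) W)))

/-- The function on the quiver variety induced by `f₂`. -/
def fHat (z : QuiverVariety D W) : ℂ :=
  Quotient.lift (fun x : StableRep D W z.1 => potential x.1)
    (by rintro x y ⟨g, hg⟩; rw [← hg, potential_act]) z.2

theorem fHat_orbit {v : DimVec I} (x : StableRep D W v) :
    fHat D W (orbit x) = potential x.1 := rfl

/-- The critical locus of the function `fHat` on the quiver variety. The quotient map is a principal
bundle over the quiver variety, so a point is critical for `fHat` if and only if the points of the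
orbit above it are critical for the pullback of `fHat` to the open set of stable representations,
which is the restriction of the polynomial function `f₂`. -/
def critLocus : Set (QuiverVariety D W) :=
  {z | ∃ (v : DimVec I) (x : StableRep D W v), orbit x = z ∧ IsCritical x.1}

/-- The zero fiber of the map from the quiver variety to the affine categorical quotient (the
spectrum of the algebra of invariant polynomial functions): the orbits of the stable
representations on which every invariant polynomial function takes its value at `0`. -/
def zeroFiber : Set (QuiverVariety D W) :=
  {z | ∃ (v : DimVec I) (x : StableRep D W v), orbit x = z ∧
    ∀ p ∈ polyFun (FramedRep D (Std v) W), (∀ g y, p (act g y) = p y) → p x.1 = p 0}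

end Variety

/-! ### The generalized preprojective algebra -/

/-- Generators: the idempotents `e_i`, the arrows `α_{ij} : j → i`, the loops `ε_i`. -/
inductive Gen (I : Type u) : Type u
  | e (i : I)
  | al (i j : I)
  | ep (i : I)

/-- The degrees of the generators. -/
def Gen.deg : Gen I → ℤ
  | .e _ => 0
  | .al i j => D.b i j
  | .ep i => 2 * (D.d i : ℤ)

/-- The generators in the free algebra. -/
def gen (g : Gen I) : FreeAlgebra ℂ (Gen I) := FreeAlgebra.ι ℂ g

/-- The relations. The first six present the path algebra of the triple quiver (products are
composed from right to left, and `α_{ij}` is an arrow only if `c_{ij} < 0`), the last two are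
the cyclic derivatives of the potential. -/
inductive Rel : FreeAlgebra ℂ (Gen I) → FreeAlgebra ℂ (Gen I) → Prop
  | idem (i : I) : Rel (gen (.e i) * gen (.e i)) (gen (.e i))
  | orth (i j : I) (h : i ≠ j) : Rel (gen (.e i) * gen (.e j)) 0
  | one : Rel (∑ i : I, gen (.e i)) 1
  | al_ends (i j : I) : Rel (gen (.e i) * gen (.al i j) * gen (.e j)) (gen (.al i j))
  | al_zero (i j : I) (h : ¬ D.c i j < 0) : Rel (gen (.al i j)) 0
  | ep_ends (i : I) : Rel (gen (.e i) * gen (.ep i) * gen (.e i)) (gen (.ep i))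
  | deriv_al (i j : I) (h : D.c i j < 0) :
      Rel (gen (.ep i) ^ D.m i j * gen (.al i j)) (gen (.al i j) * gen (.ep j) ^ D.m j i)
  | deriv_ep (i : I) :
      Rel (∑ j : I, ∑ k ∈ Finset.range (D.m i j), (D.o i j : ℂ) •
        (gen (.ep i) ^ k * gen (.al i j) * gen (.al j i) * gen (.ep i) ^ (D.m i j - 1 - k))) 0

/-- The generalized preprojective algebra. -/
abbrev PreprojAlg : Type u := RingQuot (Rel D)

/-- The images of the generators in the generalized preprojective algebra. -/
def pgen (g : Gen I) : PreprojAlg D := RingQuot.mkAlgHom ℂ (Rel D) (gen g)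

/-- The element `ω = ∑ ε_i^{t_i}`. -/
def omega : PreprojAlg D := ∑ i : I, pgen D (.ep i) ^ D.texp i

/-- The homogeneous part of degree `n`, spanned by the words of degree `n`. -/
def grade (n : ℤ) : Submodule ℂ (PreprojAlg D) :=
  Submodule.span ℂ {x | ∃ L : List (Gen I), (L.map (Gen.deg D)).sum = n ∧
    x = (L.map (pgen D)).prod}

/-- The homogeneous part of degree `n` of `e_j Π e_i`. -/
def piece (j i : I) (n : ℤ) : Submodule ℂ (PreprojAlg D) :=
  grade D n ⊓
    LinearMap.ker (LinearMap.mulLeft ℂ (pgen D (.e j)) - LinearMap.id) ⊓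
    LinearMap.ker (LinearMap.mulRight ℂ (pgen D (.e i)) - LinearMap.id)

variable {D} in
theorem mem_piece {j i : I} {n : ℤ} {x : PreprojAlg D} :
    x ∈ piece D j i n ↔ x ∈ grade D n ∧ pgen D (.e j) * x = x ∧ x * pgen D (.e i) = x := by
  simp [piece, sub_eq_zero, and_assoc]

theorem e_mul_e (i : I) : pgen D (.e i) * pgen D (.e i) = pgen D (.e i) := by
  simpa [pgen] using RingQuot.mkAlgHom_rel ℂ (Rel.idem (D := D) i)

theorem e_mul_al (i j : I) : pgen D (.e i) * pgen D (.al i j) = pgen D (.al i j) := by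
  have h : pgen D (.e i) * pgen D (.al i j) * pgen D (.e j) = pgen D (.al i j) := by
    simpa [pgen] using RingQuot.mkAlgHom_rel ℂ (Rel.al_ends (D := D) i j)
  rw [← h, ← mul_assoc, ← mul_assoc, e_mul_e]

theorem e_mul_ep (i : I) : pgen D (.e i) * pgen D (.ep i) = pgen D (.ep i) := by
  have h : pgen D (.e i) * pgen D (.ep i) * pgen D (.e i) = pgen D (.ep i) := by
    simpa [pgen] using RingQuot.mkAlgHom_rel ℂ (Rel.ep_ends (D := D) i)
  rw [← h, ← mul_assoc, ← mul_assoc, e_mul_e]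

theorem gen_mul_mem_grade (g : Gen I) {n : ℤ} {x : PreprojAlg D} (hx : x ∈ grade D n) :
    pgen D g * x ∈ grade D (g.deg D + n) := by
  have : grade D n ≤ (grade D (g.deg D + n)).comap (LinearMap.mulLeft ℂ (pgen D g)) := by
    refine Submodule.span_le.2 ?_
    rintro _ ⟨L, hL, rfl⟩
    exact Submodule.subset_span ⟨g :: L, by simp [hL], by simp⟩
  exact this hx

theorem e_mem_piece (i : I) : pgen D (.e i) ∈ piece D i i 0 :=
  mem_piece.2 ⟨Submodule.subset_span ⟨[.e i], by simp [Gen.deg], by simp⟩, e_mul_e D i,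
    e_mul_e D i⟩

theorem al_mul_mem_piece {i : I} {κ : ℤ} {s t : I × ℤ} (h : AlphaArrow D s t)
    {x : PreprojAlg D} (hx : x ∈ piece D t.1 i (κ - t.2)) :
    pgen D (.al s.1 t.1) * x ∈ piece D s.1 i (κ - s.2) := by
  obtain ⟨h1, -, h3⟩ := mem_piece.1 hx
  refine mem_piece.2 ⟨?_, by rw [← mul_assoc, e_mul_al], by rw [mul_assoc, h3]⟩
  have h4 := gen_mul_mem_grade D (.al s.1 t.1) h1
  have h5 : (Gen.al s.1 t.1).deg D + (κ - t.2) = κ - s.2 := by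
    rw [h.2, Gen.deg, D.b_symm]; ring
  rwa [h5] at h4

theorem ep_mul_mem_piece {i : I} {κ : ℤ} {s t : I × ℤ} (h : EpsArrow D s t)
    {x : PreprojAlg D} (hx : x ∈ piece D t.1 i (κ - t.2)) :
    pgen D (.ep s.1) * x ∈ piece D s.1 i (κ - s.2) := by
  obtain ⟨h1, -, h3⟩ := mem_piece.1 hx
  refine mem_piece.2 ⟨?_, by rw [← mul_assoc, e_mul_ep], by rw [mul_assoc, h3]⟩
  have h4 := gen_mul_mem_grade D (.ep s.1) h1
  have h5 : (Gen.ep s.1).deg D + (κ - t.2) = κ - s.2 := by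
    rw [h.2, Gen.deg]; ring
  rwa [h5] at h4

/-! ### The injective type modules -/

/-- The component at the vertex `s = (j, k)` of the graded module
`I_{i,κ} = ⋃_l ((Π / Π ω^l) e_i)^∨ [-κ]`: the linear forms on the homogeneous part of degree
`κ - k` of `e_j Π e_i` which vanish on `Π ω^l` for some `l > 0`. -/
def injComp (i : I) (κ : ℤ) (s : I × ℤ) :
    Submodule ℂ (Module.Dual ℂ (piece D s.1 i (κ - s.2))) where
  carrier := {φ | ∃ l : ℕ, 0 < l ∧ ∀ x : piece D s.1 i (κ - s.2),
    (∃ y : PreprojAlg D, x.1 = y * omega D ^ l) → φ x = 0}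
  zero_mem' := ⟨1, one_pos, fun _ _ => rfl⟩
  add_mem' := by
    rintro φ ψ ⟨l, hl, hφ⟩ ⟨n, -, hψ⟩
    refine ⟨l + n, by omega, fun x hx => ?_⟩
    obtain ⟨y, hy⟩ := hx
    have h1 := hφ x ⟨y * omega D ^ n, by rw [hy, mul_assoc, ← pow_add, add_comm]⟩
    have h2 := hψ x ⟨y * omega D ^ l, by rw [hy, mul_assoc, ← pow_add]⟩
    simp [h1, h2]
  smul_mem' := by
    rintro a φ ⟨l, hl, hφ⟩
    exact ⟨l, hl, fun x hx => by simp [hφ x hx]⟩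

/-- Left multiplication by `α_{s t}`, the image of `α_{t s}` under the anti-involution of the
algebra which fixes the `e_i`, `ε_i` and exchanges `α_{ij}` and `α_{ji}`. -/
def pieceAlpha (i : I) (κ : ℤ) (s t : I × ℤ) (h : AlphaArrow D s t) :
    piece D t.1 i (κ - t.2) →ₗ[ℂ] piece D s.1 i (κ - s.2) :=
  ((LinearMap.mulLeft ℂ (pgen D (.al s.1 t.1))).comp (Submodule.subtype _)).codRestrict _
    fun x => al_mul_mem_piece D h x.2

/-- Left multiplication by `ε_i`. -/
def pieceEps (i : I) (κ : ℤ) (s t : I × ℤ) (h : EpsArrow D s t) :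
    piece D t.1 i (κ - t.2) →ₗ[ℂ] piece D s.1 i (κ - s.2) :=
  ((LinearMap.mulLeft ℂ (pgen D (.ep s.1))).comp (Submodule.subtype _)).codRestrict _
    fun x => ep_mul_mem_piece D h x.2

theorem coe_pieceAlpha (i : I) (κ : ℤ) (s t : I × ℤ) (h : AlphaArrow D s t)
    (x : piece D t.1 i (κ - t.2)) :
    (pieceAlpha D i κ s t h x).1 = pgen D (.al s.1 t.1) * x.1 := rfl

theorem coe_pieceEps (i : I) (κ : ℤ) (s t : I × ℤ) (h : EpsArrow D s t)
    (x : piece D t.1 i (κ - t.2)) :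
    (pieceEps D i κ s t h x).1 = pgen D (.ep s.1) * x.1 := rfl

/-- The action of `α` on `I_{i,κ}`, the transpose of the multiplication twisted by the
anti-involution. -/
def injAlpha (i : I) (κ : ℤ) (s t : I × ℤ) (h : AlphaArrow D s t) :
    injComp D i κ s →ₗ[ℂ] injComp D i κ t :=
  (Module.Dual.transpose (pieceAlpha D i κ s t h)).restrict <| by
    rintro φ ⟨l, hl, hφ⟩
    refine ⟨l, hl, fun x hx => hφ _ ?_⟩
    obtain ⟨y, hy⟩ := hx
    exact ⟨pgen D (.al s.1 t.1) * y, by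
      rw [coe_pieceAlpha, hy, mul_assoc]⟩

/-- The action of `ε` on `I_{i,κ}`, the transpose of the multiplication. -/
def injEps (i : I) (κ : ℤ) (s t : I × ℤ) (h : EpsArrow D s t) :
    injComp D i κ s →ₗ[ℂ] injComp D i κ t :=
  (Module.Dual.transpose (pieceEps D i κ s t h)).restrict <| by
    rintro φ ⟨l, hl, hφ⟩
    refine ⟨l, hl, fun x hx => hφ _ ?_⟩
    obtain ⟨y, hy⟩ := hx
    exact ⟨pgen D (.ep s.1) * y, by
      rw [coe_pieceEps, hy, mul_assoc]⟩

section InjW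

variable {ι : Type*} (q : ι → I × ℤ)

/-- The components of `I_W = ⨁_r I_{i_r}[-k_r - d_{i_r}]`, for a finite family
`q r = (i_r, k_r)` of vertices. -/
abbrev InjW (s : I × ℤ) : Type _ := ∀ r : ι, injComp D (q r).1 ((q r).2 + D.d (q r).1) s

/-- The graded module structure of `I_W`, as a representation of the graded triple quiver. -/
def injW : TripleRep D (InjW D q) :=
  (fun p => LinearMap.piMap fun r => injAlpha D (q r).1 _ p.1.1 p.1.2 p.2,
    fun p => LinearMap.piMap fun r => injEps D (q r).1 _ p.1.1 p.1.2 p.2)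

theorem e_mem_piece_of_frameArrow {s t : I × ℤ} (h : FrameArrow D s t) {r : ι} (hr : q r = t) :
    pgen D (.e (q r).1) ∈ piece D s.1 (q r).1 ((q r).2 + D.d (q r).1 - s.2) := by
  have h1 : s.1 = (q r).1 := by rw [hr, h.1]
  have h2 : (q r).2 + (D.d (q r).1 : ℤ) - s.2 = 0 := by
    rw [← h1, hr, h.2]; ring
  rw [h2, h1]
  exact e_mem_piece D _

/-- The evaluation at `e_{i_r}` of the component in `I_{i_r}[-k_r - d_{i_r}]` of an element of
`I_W`. It is of degree `-d_{i_r}`. -/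
def evalAt {s t : I × ℤ} (h : FrameArrow D s t) {r : ι} (hr : q r = t) (φ : InjW D q s) : ℂ :=
  (φ r).1 ⟨pgen D (.e (q r).1), e_mem_piece_of_frameArrow D q h hr⟩

end InjW

/-! ### Quiver Grassmannians -/

section Grassmannian

variable {D}
variable {M : I × ℤ → Type*} [∀ s, AddCommGroup (M s)] [∀ s, Module ℂ (M s)] (X : TripleRep D M)

/-- Graded submodules of graded dimension `v` of a graded module. -/
structure GrassAt (v : DimVec I) where
  U : ∀ s, Submodule ℂ (M s)
  isSubrep : IsSubrep X U
  finite : ∀ s, Module.Finite ℂ (U s)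
  finrank_eq : ∀ s, Module.finrank ℂ (U s) = v s

/-- Injective graded linear maps from `ℂ^v` whose image is a submodule. -/
abbrev GrassFrame (v : DimVec I) : Type _ :=
  {f : ∀ s, Std v s →ₗ[ℂ] M s //
    (∀ s, Function.Injective (f s)) ∧ IsSubrep X fun s => LinearMap.range (f s)}

/-- The image of an injective map. -/
def frameImage (v : DimVec I) (f : GrassFrame X v) : GrassAt X v where
  U s := LinearMap.range (f.1 s)
  isSubrep := f.2.2
  finite s := inferInstance
  finrank_eq s := by rw [LinearMap.finrank_range_of_inj (f.2.1 s)]; simp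

/-- The graded quiver Grassmannian, the disjoint union over all dimension vectors. -/
abbrev Grass : Type _ := Σ v : DimVec I, GrassAt X v

/-- The Grassmannian of dimension `v` is the quotient by `GL_v` of the variety of injective maps. -/
abbrev grassTop (τ : TopKind) : TopologicalSpace (Grass X) :=
  @instTopologicalSpaceSigma (DimVec I) (GrassAt X) fun v =>
    TopologicalSpace.coinduced (frameImage X v)
      (TopologicalSpace.induced Subtype.val (vecTop τ (∀ s, Std v s →ₗ[ℂ] M s)))

end Grassmannian

/-- The framed representation `x` is isomorphic to the graded submodule `U` of `I_W` equipped with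
the restriction of the evaluation map `I_W → W` (for a basis `β` of `W` adapted to the
decomposition of `W` into one dimensional spaces of degrees `q r`). -/
def IsRestriction {ι : Type*} (q : ι → I × ℤ)
    {W : I × ℤ → Type*} [∀ s, AddCommGroup (W s)] [∀ s, Module ℂ (W s)]
    (β : ∀ s, Module.Basis {r : ι // q r = s} ℂ (W s))
    {v : DimVec I} (x : FramedRep D (Std v) W) (U : ∀ s, Submodule ℂ (InjW D q s)) : Prop :=
  ∃ f : ∀ s, Std v s →ₗ[ℂ] InjW D q s,
    (∀ s, Function.Injective (f s)) ∧ (∀ s, LinearMap.range (f s) = U s) ∧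
    (∀ p m, f p.1.2 (x.1.1 p m) = (injW D q).1 p (f p.1.1 m)) ∧
    (∀ p m, f p.1.2 (x.1.2 p m) = (injW D q).2 p (f p.1.1 m)) ∧
    (∀ p m (r : ι) (hr : q r = p.1.2),
      (β p.1.2).repr (x.2 p m) ⟨r, hr⟩ = evalAt D q p.2 hr (f p.1.1 m))

end GradedTriple

end

/-!
# Critical points of the potential and the quiver Grassmannian of `I_W`

The partial derivatives of the trace of a potential are its cyclic derivatives, which are the last
two families of relations of the generalized preprojective algebra `Π`. Hence a framed
representation is critical if and only if its triple quiver part is a graded `Π`-module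
(`isCritical_iff`; the grading and the idempotents let each block of a cyclic derivative be tested
by varying a single arrow).

A finite dimensional graded `Π`-module is nilpotent (`piRep_list_prod`). For degree reasons the
`ε_i` are nilpotent, so it suffices that every arrow vanishes on a simple module with nilpotent
`ε_i`. Otherwise no vector at the vertex `i` is killed by all the `α_{ji} ε_i^l` and the images of
the `ε_i^l α_{ij}` span the space at `i`, and the relation at `i` yields `2 n_i ≤ ∑_j m_{ij} n_j` for
the dimension vector `n`, where `m_{ij} = -c_{ij}` for `i ≠ j`; this contradicts the positivity of
the Cartan form (`CartanDatum.eq_zero_of_sum_le`). Three things follow.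

* The matrix coefficients `y ↦ a_r (y^* m)` of a critical point, `a_r` being the coordinates of the
  framing, vanish on `Π ω^l` for large `l`. They define a morphism `critFrame` to `I_W` compatible
  with the framings. Such a morphism is unique (`IsFramedMor.unique`), its kernel is a
  subrepresentation killed by the framing, and conversely a submodule of `I_W` with the restricted
  evaluation is a stable critical point. So stable critical points in `ℂ^v` are the same as injective
  maps from `ℂ^v` to `I_W` with image a submodule, equivariantly for the group of graded
  automorphisms.
* A matrix coefficient is determined by its values on the words of bounded length, so `critFrame` is
  polynomial in the critical point (`mapIn_critFrame`). In the other direction the restricted action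
  is given by Cramer's rule, so it is locally a quotient of polynomials (`mapIn_frameRep`). Both maps
  are therefore continuous for the Zariski and for the classical topology, and this descends to the
  quotients since the quotient map from the stable representations is open.
* The filtration of a critical point by the words in the arrows is contracted by a one-parameter
  subgroup, so the closure of its orbit contains `0` and the invariant polynomials cannot distinguish
  it from `0` (`apply_eq_apply_zero_of_nilpotent`).
-/

noncomputable section

set_option linter.unusedSectionVars false

namespace GradedTriple

universe u

/-! ### Regular maps between vector spaces -/

section RegularMaps

variable {X : Type*} {E E' E₁ E₂ E₃ : Type*}
  [AddCommGroup E] [Module ℂ E] [AddCommGroup E'] [Module ℂ E']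
  [AddCommGroup E₁] [Module ℂ E₁] [AddCommGroup E₂] [Module ℂ E₂]
  [AddCommGroup E₃] [Module ℂ E₃]

/-- A map `Θ` to a vector space has coefficients in an algebra `𝒜` of functions if its composition
with every linear form belongs to `𝒜`. -/
def MapIn (𝒜 : Subalgebra ℂ (X → ℂ)) (Θ : X → E) : Prop :=
  ∀ φ : Module.Dual ℂ E, (fun a => φ (Θ a)) ∈ 𝒜

variable {𝒜 : Subalgebra ℂ (X → ℂ)}

theorem MapIn.const (e : E) : MapIn 𝒜 fun _ : X => e :=
  fun φ => 𝒜.algebraMap_mem (φ e)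

theorem MapIn.comp_linear {Θ : X → E} (h : MapIn 𝒜 Θ) (l : E →ₗ[ℂ] E') :
    MapIn 𝒜 fun a => l (Θ a) :=
  fun φ => h (φ ∘ₗ l)

theorem MapIn.sum {ι : Type*} (S : Finset ι) {Θ : ι → X → E} (h : ∀ i ∈ S, MapIn 𝒜 (Θ i)) :
    MapIn 𝒜 fun a => ∑ i ∈ S, Θ i a := by
  intro φ
  have : (fun a => φ (∑ i ∈ S, Θ i a)) = ∑ i ∈ S, fun a => φ (Θ i a) := by
    ext a; simp [Finset.sum_apply]
  rw [this]
  exact sum_mem fun i hi => h i hi φ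

theorem MapIn.add {Θ Θ' : X → E} (h : MapIn 𝒜 Θ) (h' : MapIn 𝒜 Θ') :
    MapIn 𝒜 fun a => Θ a + Θ' a := by
  intro φ
  have : (fun a => φ (Θ a + Θ' a)) = (fun a => φ (Θ a)) + fun a => φ (Θ' a) := by ext a; simp
  rw [this]
  exact add_mem (h φ) (h' φ)

theorem MapIn.smul {h : X → ℂ} (hh : h ∈ 𝒜) {Θ : X → E} (hΘ : MapIn 𝒜 Θ) :
    MapIn 𝒜 fun a => h a • Θ a := by
  intro φ
  have : (fun a => φ (h a • Θ a)) = h * fun a => φ (Θ a) := by ext a; simp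
  rw [this]
  exact mul_mem hh (hΘ φ)

/-- Bilinear operations preserve maps with coefficients in `𝒜`, if one factor is finite
dimensional. -/
theorem MapIn.bilin [Module.Finite ℂ E₁] (B : E₁ →ₗ[ℂ] E₂ →ₗ[ℂ] E₃) {Θ₁ : X → E₁} {Θ₂ : X → E₂}
    (h₁ : MapIn 𝒜 Θ₁) (h₂ : MapIn 𝒜 Θ₂) : MapIn 𝒜 fun a => B (Θ₁ a) (Θ₂ a) := by
  let b := Module.finBasis ℂ E₁
  have : (fun a => B (Θ₁ a) (Θ₂ a)) = fun a => ∑ i, b.coord i (Θ₁ a) • B (b i) (Θ₂ a) := by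
    ext a
    have h := congrArg (fun e => B e (Θ₂ a)) (b.sum_repr (Θ₁ a)).symm
    simpa only [Module.Basis.coord_apply, map_sum, map_smul, LinearMap.sum_apply, LinearMap.smul_apply] using h
  rw [this]
  exact MapIn.sum _ fun i _ => MapIn.smul (h₁ _) (h₂.comp_linear (B (b i)))

/-- A map to a product with only finitely many non-zero factors is checked on the factors. -/
theorem MapIn.pi {P : Type*} {N : P → Type*} [∀ p, AddCommGroup (N p)] [∀ p, Module ℂ (N p)]
    {S : Set P} (hS : S.Finite) (hN : ∀ p ∉ S, Subsingleton (N p)) {Θ : X → ∀ p, N p}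
    (h : ∀ p, MapIn 𝒜 fun a => Θ a p) : MapIn 𝒜 Θ := by
  classical
  have : Θ = fun a => ∑ p ∈ hS.toFinset, LinearMap.single ℂ N p (Θ a p) := by
    ext a p
    rw [Finset.sum_apply]
    by_cases hp : p ∈ S
    · rw [Finset.sum_eq_single p]
      · simp
      · intro p' _ hne
        simp [Pi.single_eq_of_ne hne.symm]
      · intro hp'; exact absurd (hS.mem_toFinset.2 hp) hp'
    · have := hN p hp
      exact Subsingleton.elim _ _
  rw [this]
  exact MapIn.sum _ fun p _ => (h p).comp_linear _

/-- A map to `Hom(ℂⁿ, E)` is checked on the standard basis. -/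
theorem MapIn.hom {n : ℕ} {Θ : X → ((Fin n → ℂ) →ₗ[ℂ] E)}
    (h : ∀ k, MapIn 𝒜 fun a => Θ a (Pi.single k 1)) : MapIn 𝒜 Θ := by
  have : Θ = fun a => ∑ k, LinearMap.smulRightₗ (LinearMap.proj k) (Θ a (Pi.single k 1)) := by
    ext a k
    simp [Pi.single_apply]
  rw [this]
  exact MapIn.sum _ fun k _ => (h k).comp_linear _

theorem MapIn.polyFun_comp {Θ : X → E} (h : MapIn 𝒜 Θ) {p : E → ℂ} (hp : p ∈ polyFun E) :
    (fun a => p (Θ a)) ∈ 𝒜 := by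
  induction hp using Algebra.adjoin_induction with
  | mem x hx => obtain ⟨φ, rfl⟩ := hx; exact h φ
  | algebraMap r => exact 𝒜.algebraMap_mem r
  | add p q _ _ hp hq => exact add_mem hp hq
  | mul p q _ _ hp hq => exact mul_mem hp hq

theorem mapIn_id : MapIn (polyFun E) fun x : E => x :=
  fun φ => Algebra.subset_adjoin ⟨φ, rfl⟩

/-- The determinant of a matrix with coefficients in `𝒜`. -/
theorem det_mem {n : Type*} [Fintype n] [DecidableEq n] {A : X → Matrix n n ℂ}
    (h : ∀ k l, (fun a => A a k l) ∈ 𝒜) : (fun a => (A a).det) ∈ 𝒜 := by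
  have : (fun a => (A a).det) = ∑ σ : Equiv.Perm n,
      algebraMap ℂ (X → ℂ) ((Equiv.Perm.sign σ : ℤ) : ℂ) * ∏ k, fun a => A a (σ k) k := by
    ext a
    simp [Matrix.det_apply', Finset.sum_apply, Finset.prod_apply]
  rw [this]
  exact sum_mem fun σ _ => mul_mem (𝒜.algebraMap_mem _) (prod_mem fun k _ => h _ _)

theorem adjugate_mem {n : Type*} [Fintype n] [DecidableEq n] {A : X → Matrix n n ℂ}
    (h : ∀ k l, (fun a => A a k l) ∈ 𝒜) (k l : n) : (fun a => (A a).adjugate k l) ∈ 𝒜 := by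
  simp only [Matrix.adjugate_apply]
  refine det_mem fun i j => ?_
  by_cases hi : i = l
  · subst hi
    simp only [Matrix.updateRow_self]
    exact 𝒜.algebraMap_mem ((Pi.single k 1 : n → ℂ) j)
  · simp only [Matrix.updateRow_ne hi]
    exact h i j

/-! ### Locally regular functions and continuity -/

/-- The functions which are locally quotients of polynomial functions, on a set `X` lying over the
vector space `E`. -/
def locReg (j : X → E) : Subalgebra ℂ (X → ℂ) where
  carrier := {h | ∀ a, ∃ P ∈ polyFun E, ∃ Q ∈ polyFun E, Q (j a) ≠ 0 ∧
    ∀ b, Q (j b) ≠ 0 → h b * Q (j b) = P (j b)}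
  mul_mem' := by
    intro h h' H H' a
    obtain ⟨P, hP, Q, hQ, ha, hb⟩ := H a
    obtain ⟨P', hP', Q', hQ', ha', hb'⟩ := H' a
    refine ⟨P * P', mul_mem hP hP', Q * Q', mul_mem hQ hQ', mul_ne_zero ha ha', fun b hne => ?_⟩
    have h1 := hb b (left_ne_zero_of_mul hne)
    have h2 := hb' b (right_ne_zero_of_mul hne)
    simp only [Pi.mul_apply]
    rw [← h1, ← h2]; ring
  add_mem' := by
    intro h h' H H' a
    obtain ⟨P, hP, Q, hQ, ha, hb⟩ := H a
    obtain ⟨P', hP', Q', hQ', ha', hb'⟩ := H' a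
    refine ⟨P * Q' + P' * Q, add_mem (mul_mem hP hQ') (mul_mem hP' hQ), Q * Q', mul_mem hQ hQ',
      mul_ne_zero ha ha', fun b hne => ?_⟩
    have h1 := hb b (left_ne_zero_of_mul hne)
    have h2 := hb' b (right_ne_zero_of_mul hne)
    simp only [Pi.mul_apply, Pi.add_apply]
    rw [← h1, ← h2]; ring
  algebraMap_mem' := fun r _ => ⟨algebraMap ℂ _ r, Subalgebra.algebraMap_mem _ _, 1, one_mem _,
    by simp, fun b _ => by simp⟩

theorem polyFun_comp_mem_locReg (j : X → E) {p : E → ℂ} (hp : p ∈ polyFun E) :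
    (fun a => p (j a)) ∈ locReg j :=
  fun _ => ⟨p, hp, 1, one_mem _, by simp, fun b _ => by simp⟩

theorem MapIn.locReg (j : X → E) {Θ : E → E'} (h : MapIn (polyFun E) Θ) :
    MapIn (locReg j) fun a => Θ (j a) :=
  fun φ => polyFun_comp_mem_locReg j (h φ)

theorem continuous_polyFun {p : E → ℂ} (hp : p ∈ polyFun E) :
    @Continuous E ℂ (vecTop .classical E) _ p := by
  let _ : TopologicalSpace E := vecTop .classical E
  induction hp using Algebra.adjoin_induction with
  | mem x hx =>
    obtain ⟨φ, rfl⟩ := hx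
    exact continuous_iff_le_induced.2 (iInf_le _ φ)
  | algebraMap r => exact continuous_const
  | add p q _ _ hp hq => exact hp.add hq
  | mul p q _ _ hp hq => exact hp.mul hq

theorem isOpen_polyFun_ne (τ : TopKind) {p : E → ℂ} (hp : p ∈ polyFun E) :
    @IsOpen E (vecTop τ E) {x | p x ≠ 0} := by
  cases τ with
  | zariski => exact TopologicalSpace.isOpen_generateFrom_of_mem ⟨p, hp, rfl⟩
  | classical =>
    let _ : TopologicalSpace E := vecTop .classical E
    exact isOpen_ne_fun (continuous_polyFun hp) continuous_const

/-- A map whose coordinates are locally regular is continuous, for both topologies. -/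
theorem continuous_of_mapIn_locReg (τ : TopKind) (j : X → E) {Θ : X → E'}
    (h : MapIn (GradedTriple.locReg j) Θ) :
    @Continuous X E' (TopologicalSpace.induced j (vecTop τ E)) (vecTop τ E') Θ := by
  let _ : TopologicalSpace E := vecTop τ E
  let _ : TopologicalSpace X := TopologicalSpace.induced j (vecTop τ E)
  have hj : Continuous j := continuous_induced_dom
  cases τ with
  | zariski =>
    refine continuous_generateFrom_iff.2 ?_
    rintro _ ⟨p, hp, rfl⟩
    refine isOpen_iff_forall_mem_open.2 fun a ha => ?_
    obtain ⟨P, hP, Q, hQ, hQa, hPQ⟩ := h.polyFun_comp hp a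
    refine ⟨j ⁻¹' {x | (P * Q) x ≠ 0}, fun b hb => ?_,
      (isOpen_polyFun_ne .zariski (mul_mem hP hQ)).preimage hj, ?_⟩
    · have h1 := hPQ b (right_ne_zero_of_mul hb)
      have h2 : P (j b) ≠ 0 := left_ne_zero_of_mul hb
      rw [← h1] at h2
      exact left_ne_zero_of_mul h2
    · exact mul_ne_zero (by rw [← hPQ a hQa]; exact mul_ne_zero ha hQa) hQa
  | classical =>
    refine continuous_iInf_rng.2 fun φ => continuous_induced_rng.2 ?_
    refine continuous_iff_continuousAt.2 fun a => ?_
    obtain ⟨P, hP, Q, hQ, hQa, hPQ⟩ := h φ a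
    have h1 : ContinuousAt (fun b => P (j b) / Q (j b)) a :=
      ((continuous_polyFun hP).comp hj).continuousAt.div
        ((continuous_polyFun hQ).comp hj).continuousAt hQa
    refine h1.congr ?_
    have h2 : IsOpen (j ⁻¹' {x | Q x ≠ 0}) := (isOpen_polyFun_ne .classical hQ).preimage hj
    filter_upwards [h2.mem_nhds hQa] with b hb
    rw [div_eq_iff hb, ← hPQ b hb]
    rfl

theorem continuous_vecTop_of_linear (τ : TopKind) (l : E →ₗ[ℂ] E') :
    @Continuous E E' (vecTop τ E) (vecTop τ E') l := by
  have h := continuous_of_mapIn_locReg τ (id : E → E)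
    (MapIn.locReg id (mapIn_id.comp_linear l))
  rwa [@induced_id E (vecTop τ E)] at h

/-- A linear form on a subspace of linear forms on a space spanned by a finite family `b` modulo
the common kernel is a combination of the evaluations at the `b k`. -/
theorem exists_eval_combination {P K : Type*} [AddCommGroup P] [Module ℂ P] [Fintype K] (b : K → P)
    (Y : Submodule ℂ (Module.Dual ℂ P)) (hY : ∀ φ ∈ Y, (∀ k, φ (b k) = 0) → φ = 0)
    (l : Y →ₗ[ℂ] ℂ) : ∃ c : K → ℂ, ∀ φ : Y, l φ = ∑ k, c k * φ.1 (b k) := by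
  classical
  let ev : Y →ₗ[ℂ] (K → ℂ) := LinearMap.pi fun k => (LinearMap.applyₗ (b k)) ∘ₗ Y.subtype
  have hev : LinearMap.ker ev = ⊥ := by
    refine LinearMap.ker_eq_bot'.2 fun φ hφ => Subtype.ext (hY φ.1 φ.2 fun k => congrFun hφ k)
  obtain ⟨g, hg⟩ := ev.exists_leftInverse_of_injective hev
  refine ⟨fun k => l (g (Pi.single k 1)), fun φ => ?_⟩
  have h1 : φ = g (ev φ) := (LinearMap.congr_fun hg φ).symm
  have h2 : ev φ = ∑ k, φ.1 (b k) • Pi.single k (1 : ℂ) := by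
    ext k
    simp [ev, Finset.sum_apply, Pi.single_apply]
  conv_lhs => rw [h1, h2]
  simp [mul_comm]

end RegularMaps

variable {I : Type u} [Fintype I] [DecidableEq I] {D : CartanDatum I}

/-! ### The generators acting on the total space -/

section Total

variable {V : I × ℤ → Type*} [∀ s, AddCommGroup (V s)] [∀ s, Module ℂ (V s)]

theorem alphaTot_lof (x : TripleRep D V) {s t : I × ℤ} (h : AlphaArrow D s t) (v : V s) :
    alphaTot x t.1 s.1 (DirectSum.lof ℂ (I × ℤ) V s v) =
      DirectSum.lof ℂ (I × ℤ) V t (x.1 ⟨(s, t), h⟩ v) := by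
  obtain ⟨i, k⟩ := t
  have hk : k = s.2 + D.b i s.1 := h.2
  subst hk
  rw [alphaTot, DirectSum.toModule_lof, dif_pos ⟨rfl, h.1⟩]
  rfl

theorem alphaTot_lof_of_ne (x : TripleRep D V) {i j : I} {s : I × ℤ} (h : s.1 ≠ j) (v : V s) :
    alphaTot x i j (DirectSum.lof ℂ (I × ℤ) V s v) = 0 := by
  rw [alphaTot, DirectSum.toModule_lof, dif_neg (fun h' => h h'.1), LinearMap.zero_apply]

theorem alphaTot_eq_zero (x : TripleRep D V) {i j : I} (h : ¬ D.c i j < 0) :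
    alphaTot x i j = 0 := by
  refine DirectSum.linearMap_ext ℂ fun s => LinearMap.ext fun v => ?_
  rw [LinearMap.comp_apply, alphaTot, DirectSum.toModule_lof, dif_neg (fun h' => h h'.2)]
  simp

theorem epsTot_lof (x : TripleRep D V) {s t : I × ℤ} (h : EpsArrow D s t) (v : V s) :
    epsTot x s.1 (DirectSum.lof ℂ (I × ℤ) V s v) =
      DirectSum.lof ℂ (I × ℤ) V t (x.2 ⟨(s, t), h⟩ v) := by
  obtain ⟨i, k⟩ := t
  have hi : i = s.1 := h.1
  subst hi
  have hk : k = s.2 + 2 * (D.d s.1 : ℤ) := h.2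
  subst hk
  rw [epsTot, DirectSum.toModule_lof, if_pos rfl]
  rfl

theorem epsTot_lof_of_ne (x : TripleRep D V) {i : I} {s : I × ℤ} (h : s.1 ≠ i) (v : V s) :
    epsTot x i (DirectSum.lof ℂ (I × ℤ) V s v) = 0 := by
  rw [epsTot, DirectSum.toModule_lof, if_neg h, LinearMap.zero_apply]

variable (V) in
/-- The projection of the total space to its part at the vertex `i`. -/
def vertexTot (i : I) : Module.End ℂ (⨁ s, V s) :=
  DirectSum.toModule ℂ (I × ℤ) (⨁ s, V s) fun s =>
    if s.1 = i then DirectSum.lof ℂ (I × ℤ) V s else 0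

theorem vertexTot_lof (i : I) (s : I × ℤ) (v : V s) :
    vertexTot V i (DirectSum.lof ℂ (I × ℤ) V s v) =
      if s.1 = i then DirectSum.lof ℂ (I × ℤ) V s v else 0 := by
  rw [vertexTot, DirectSum.toModule_lof]
  split_ifs <;> rfl

/-- The action of the generators on the total space of a representation of the triple quiver. -/
def genTot (x : TripleRep D V) : Gen I → Module.End ℂ (⨁ s, V s)
  | .e i => vertexTot V i
  | .al i j => alphaTot x i j
  | .ep i => epsTot x i

/-- The action of the free algebra on the total space of a representation of the triple quiver. -/
def freeRep (x : TripleRep D V) : FreeAlgebra ℂ (Gen I) →ₐ[ℂ] Module.End ℂ (⨁ s, V s) :=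
  FreeAlgebra.lift ℂ (genTot x)

@[simp]
theorem freeRep_gen (x : TripleRep D V) (g : Gen I) : freeRep x (gen g) = genTot x g :=
  FreeAlgebra.lift_ι_apply _ _

theorem vertexTot_mul (i j : I) :
    vertexTot V i * vertexTot V j = if i = j then vertexTot V i else 0 := by
  refine DirectSum.linearMap_ext ℂ fun s => LinearMap.ext fun v => ?_
  simp only [LinearMap.comp_apply, Module.End.mul_apply, vertexTot_lof]
  by_cases hj : s.1 = j
  · by_cases hi : s.1 = i
    · subst hi; subst hj
      simp [vertexTot_lof]
    · have : i ≠ j := fun h => hi (hj.trans h.symm)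
      simp [vertexTot_lof, hj, this, this.symm]
  · by_cases hij : i = j
    · subst hij; simp [vertexTot_lof, hj]
    · simp [hij, hj]

theorem sum_vertexTot : ∑ i : I, vertexTot V i = 1 := by
  refine DirectSum.linearMap_ext ℂ fun s => LinearMap.ext fun v => ?_
  simp [vertexTot_lof]

theorem vertexTot_mul_alphaTot (x : TripleRep D V) (i j : I) :
    vertexTot V i * alphaTot x i j = alphaTot x i j := by
  by_cases hc : D.c i j < 0
  · refine DirectSum.linearMap_ext ℂ fun s => LinearMap.ext fun v => ?_
    simp only [LinearMap.comp_apply, Module.End.mul_apply]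
    by_cases h : s.1 = j
    · subst h
      rw [alphaTot_lof x (t := (i, s.2 + D.b i s.1)) ⟨hc, rfl⟩ v, vertexTot_lof, if_pos rfl]
    · rw [alphaTot_lof_of_ne x h, map_zero]
  · rw [alphaTot_eq_zero x hc, mul_zero]

theorem alphaTot_mul_vertexTot (x : TripleRep D V) (i j : I) :
    alphaTot x i j * vertexTot V j = alphaTot x i j := by
  refine DirectSum.linearMap_ext ℂ fun s => LinearMap.ext fun v => ?_
  simp only [LinearMap.comp_apply, Module.End.mul_apply, vertexTot_lof]
  split_ifs with h
  · rfl
  · rw [alphaTot_lof_of_ne x h, map_zero]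

theorem vertexTot_mul_epsTot (x : TripleRep D V) (i : I) :
    vertexTot V i * epsTot x i = epsTot x i := by
  refine DirectSum.linearMap_ext ℂ fun s => LinearMap.ext fun v => ?_
  simp only [LinearMap.comp_apply, Module.End.mul_apply]
  by_cases h : s.1 = i
  · subst h
    rw [epsTot_lof x (s := s) (t := (s.1, s.2 + 2 * (D.d s.1 : ℤ))) ⟨rfl, rfl⟩ v, vertexTot_lof, if_pos rfl]
  · rw [epsTot_lof_of_ne x h, map_zero]

theorem epsTot_mul_vertexTot (x : TripleRep D V) (i : I) :
    epsTot x i * vertexTot V i = epsTot x i := by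
  refine DirectSum.linearMap_ext ℂ fun s => LinearMap.ext fun v => ?_
  simp only [LinearMap.comp_apply, Module.End.mul_apply, vertexTot_lof]
  split_ifs with h
  · rfl
  · rw [epsTot_lof_of_ne x h, map_zero]

/-- The cyclic derivative of the potential with respect to `α_{ji}`, up to sign, on the total
space. -/
def derivAl (x : TripleRep D V) (i j : I) : Module.End ℂ (⨁ s, V s) :=
  epsTot x i ^ D.m i j * alphaTot x i j - alphaTot x i j * epsTot x j ^ D.m j i

/-- The cyclic derivative of the potential with respect to `ε_i`, on the total space. -/
def derivEp (x : TripleRep D V) (i : I) : Module.End ℂ (⨁ s, V s) :=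
  ∑ j : I, ∑ k ∈ Finset.range (D.m i j), (D.o i j : ℂ) •
    (epsTot x i ^ k * alphaTot x i j * alphaTot x j i * epsTot x i ^ (D.m i j - 1 - k))

/-- The relations of the path algebra hold on every total space, so only the cyclic derivatives of
the potential have to be checked. -/
theorem freeRep_rel_iff (x : TripleRep D V) :
    (∀ a b, Rel D a b → freeRep x a = freeRep x b) ↔
      (∀ i j, D.c i j < 0 → derivAl x i j = 0) ∧ ∀ i, derivEp x i = 0 := by
  constructor
  · intro h
    refine ⟨fun i j hc => ?_, fun i => ?_⟩
    · simpa [genTot, derivAl, sub_eq_zero] using h _ _ (Rel.deriv_al i j hc)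
    · simpa [genTot, derivEp] using h _ _ (Rel.deriv_ep i)
  · rintro ⟨h1, h2⟩ a b hab
    cases hab with
    | idem i => simp [genTot, vertexTot_mul]
    | orth i j h => simp [genTot, vertexTot_mul, h]
    | one => simp [genTot, sum_vertexTot]
    | al_ends i j => simp [genTot, vertexTot_mul_alphaTot, alphaTot_mul_vertexTot]
    | al_zero i j h => simp [genTot, alphaTot_eq_zero x h]
    | ep_ends i => simp [genTot, vertexTot_mul_epsTot, epsTot_mul_vertexTot]
    | deriv_al i j h => simpa [genTot, derivAl, sub_eq_zero] using h1 i j h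
    | deriv_ep i => simpa [genTot, derivEp] using h2 i

end Total

/-! ### Homogeneous endomorphisms of the total space -/

section Homogeneous

variable {V : I × ℤ → Type*} [∀ s, AddCommGroup (V s)] [∀ s, Module ℂ (V s)]

/-- An endomorphism of the total space is homogeneous of degree `n` if it sends the vectors
supported in degree `k` to vectors supported in degree `k + n`. -/
def IsHomog (T : Module.End ℂ (⨁ s, V s)) (n : ℤ) : Prop :=
  ∀ (k : ℤ) (w : ⨁ s, V s), (∀ t : I × ℤ, t.2 ≠ k → w t = 0) →
    ∀ t : I × ℤ, t.2 ≠ k + n → T w t = 0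

theorem isHomog_of_lof {T : Module.End ℂ (⨁ s, V s)} {n : ℤ}
    (h : ∀ s v (t : I × ℤ), t.2 ≠ s.2 + n → T (DirectSum.lof ℂ (I × ℤ) V s v) t = 0) :
    IsHomog T n := by
  classical
  intro k w hw t ht
  have h1 : w = ∑ s ∈ DFinsupp.support w, DirectSum.lof ℂ (I × ℤ) V s (w s) :=
    (DirectSum.sum_support_of w).symm
  rw [h1, map_sum, DFinsupp.finsetSum_apply]
  refine Finset.sum_eq_zero fun s _ => ?_
  by_cases hs : s.2 = k
  · exact h s _ t (by rw [hs]; exact ht)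
  · simp [hw s hs]

theorem IsHomog.mul {T S : Module.End ℂ (⨁ s, V s)} {n m : ℤ} (hT : IsHomog T n)
    (hS : IsHomog S m) : IsHomog (T * S) (n + m) := by
  intro k w hw t ht
  exact hT (k + m) (S w) (hS k w hw) t (by rwa [add_assoc, add_comm m n])

theorem IsHomog.add {T S : Module.End ℂ (⨁ s, V s)} {n : ℤ} (hT : IsHomog T n)
    (hS : IsHomog S n) : IsHomog (T + S) n := by
  intro k w hw t ht
  rw [LinearMap.add_apply, DirectSum.add_apply, hT k w hw t ht, hS k w hw t ht, add_zero]

theorem IsHomog.smul {T : Module.End ℂ (⨁ s, V s)} {n : ℤ} (hT : IsHomog T n) (a : ℂ) :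
    IsHomog (a • T) n := by
  intro k w hw t ht
  rw [LinearMap.smul_apply, DirectSum.smul_apply, hT k w hw t ht, smul_zero]

theorem IsHomog.sub {T S : Module.End ℂ (⨁ s, V s)} {n : ℤ} (hT : IsHomog T n)
    (hS : IsHomog S n) : IsHomog (T - S) n := by
  intro k w hw t ht
  rw [LinearMap.sub_apply, DirectSum.sub_apply, hT k w hw t ht, hS k w hw t ht, sub_zero]

theorem IsHomog.sum {K : Type*} (A : Finset K) {T : K → Module.End ℂ (⨁ s, V s)} {n : ℤ}
    (hT : ∀ a ∈ A, IsHomog (T a) n) : IsHomog (∑ a ∈ A, T a) n := by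
  classical
  induction A using Finset.induction_on with
  | empty => intro k w _ t _; simp
  | insert a A ha ih =>
    rw [Finset.sum_insert ha]
    exact (hT a (Finset.mem_insert_self _ _)).add
      (ih fun b hb => hT b (Finset.mem_insert_of_mem hb))

theorem IsHomog.pow {T : Module.End ℂ (⨁ s, V s)} {n : ℤ} (hT : IsHomog T n) (l : ℕ) :
    IsHomog (T ^ l) (l * n) := by
  induction l with
  | zero => intro k w hw t ht; exact hw t (by simpa using ht)
  | succ l ih =>
    rw [pow_succ, Nat.cast_succ, add_mul, one_mul]
    exact ih.mul hT

theorem lof_apply_of_ne {s t : I × ℤ} (h : s ≠ t) (v : V s) :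
    DirectSum.lof ℂ (I × ℤ) V s v t = 0 :=
  DFinsupp.single_eq_of_ne h.symm

theorem isHomog_alphaTot (x : TripleRep D V) (i j : I) : IsHomog (alphaTot x i j) (D.b i j) := by
  by_cases hc : D.c i j < 0
  · refine isHomog_of_lof fun s v t ht => ?_
    by_cases h : s.1 = j
    · subst h
      rw [alphaTot_lof x (t := (i, s.2 + D.b i s.1)) ⟨hc, rfl⟩ v]
      exact lof_apply_of_ne (fun h => ht (by rw [← h])) _
    · simp [alphaTot_lof_of_ne x h]
  · rw [alphaTot_eq_zero x hc]
    intro k w _ t _; simp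

theorem isHomog_epsTot (x : TripleRep D V) (i : I) : IsHomog (epsTot x i) (2 * (D.d i : ℤ)) := by
  refine isHomog_of_lof fun s v t ht => ?_
  by_cases h : s.1 = i
  · subst h
    rw [epsTot_lof x (s := s) (t := (s.1, s.2 + 2 * (D.d s.1 : ℤ))) ⟨rfl, rfl⟩ v]
    exact lof_apply_of_ne (fun h => ht (by rw [← h])) _
  · simp [epsTot_lof_of_ne x h]

theorem CartanDatum.m_mul_d {i j : I} (h : D.c i j ≤ 0) : (D.m i j : ℤ) * D.d i = - D.b i j := by
  rw [CartanDatum.m, CartanDatum.b, Int.toNat_of_nonneg (by omega)]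
  ring

theorem CartanDatum.c_neg_symm {i j : I} (h : D.c i j < 0) : D.c j i < 0 := by
  rcases (D.orient i j).2 h with h1 | h1
  · exact (D.orient j i).1 (Or.inr h1)
  · exact (D.orient j i).1 (Or.inl h1)

theorem CartanDatum.m_eq_zero {i j : I} (h : ¬ D.c i j < 0) : D.m i j = 0 := by
  rw [CartanDatum.m]; omega

theorem CartanDatum.o_symm (i j : I) : D.o j i = - D.o i j := by
  have h := D.orient_asymm i j
  unfold CartanDatum.o
  by_cases h1 : (i, j) ∈ D.O
  · simp [h1, h h1]
  · by_cases h2 : (j, i) ∈ D.O <;> simp [h1, h2]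

theorem CartanDatum.o_ne_zero {i j : I} (h : D.c i j < 0) : D.o i j ≠ 0 := by
  unfold CartanDatum.o
  by_cases h1 : (i, j) ∈ D.O
  · simp [h1]
  · have h2 := ((D.orient i j).2 h).resolve_left h1
    simp [h1, h2]

theorem CartanDatum.o_eq_zero {i j : I} (h : ¬ D.c i j < 0) : D.o i j = 0 := by
  have h1 := not_or.1 fun h' => h ((D.orient i j).1 h')
  simp [CartanDatum.o, h1.1, h1.2]

theorem isHomog_derivAl (x : TripleRep D V) {i j : I} (hc : D.c i j < 0) :
    IsHomog (derivAl x i j) (- D.b i j) := by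
  have h1 := ((isHomog_epsTot x i).pow (D.m i j)).mul (isHomog_alphaTot x i j)
  have h2 := (isHomog_alphaTot x i j).mul ((isHomog_epsTot x j).pow (D.m j i))
  have e1 := D.m_mul_d hc.le
  have e2 := D.m_mul_d (D.c_neg_symm hc).le
  rw [← D.b_symm] at e2
  have e3 : (D.m i j : ℤ) * (2 * D.d i) + D.b i j = - D.b i j := by linarith
  have e4 : D.b i j + (D.m j i : ℤ) * (2 * D.d j) = - D.b i j := by linarith
  rw [e3] at h1
  rw [e4] at h2
  exact h1.sub h2

theorem isHomog_derivEp (x : TripleRep D V) (i : I) :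
    IsHomog (derivEp x i) (-(2 * (D.d i : ℤ))) := by
  refine IsHomog.sum _ fun j _ => IsHomog.sum _ fun k hk => IsHomog.smul ?_ _
  have h := ((((isHomog_epsTot x i).pow k).mul (isHomog_alphaTot x i j)).mul
    (isHomog_alphaTot x j i)).mul ((isHomog_epsTot x i).pow (D.m i j - 1 - k))
  have hk' := Finset.mem_range.1 hk
  have hc : D.c i j < 0 := by
    by_contra hc
    rw [D.m_eq_zero hc] at hk'
    omega
  have e1 := D.m_mul_d hc.le
  have e2 : ((D.m i j - 1 - k : ℕ) : ℤ) = D.m i j - 1 - k := by omega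
  have e3 : (k : ℤ) * (2 * D.d i) + D.b i j + D.b j i + ((D.m i j - 1 - k : ℕ) : ℤ) * (2 * D.d i)
      = -(2 * (D.d i : ℤ)) := by
    rw [e2, D.b_symm j i]; linarith
  rwa [e3] at h

theorem vertexTot_apply (i : I) (w : ⨁ s, V s) (t : I × ℤ) :
    vertexTot V i w t = if t.1 = i then w t else 0 := by
  induction w using DirectSum.induction_on with
  | zero => simp
  | of s v =>
    change vertexTot V i (DirectSum.lof ℂ (I × ℤ) V s v) t =
      if t.1 = i then DirectSum.lof ℂ (I × ℤ) V s v t else 0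
    rw [vertexTot_lof]
    by_cases hs : s = t
    · subst hs; split_ifs <;> simp
    · rw [lof_apply_of_ne hs]
      split_ifs <;> simp [lof_apply_of_ne hs]
  | add w w' h h' =>
    rw [map_add, DirectSum.add_apply, DirectSum.add_apply, h, h']
    split_ifs <;> simp

/-- A homogeneous endomorphism from the vertex `i` to the vertex `j` vanishes if its blocks of
the right degree do. -/
theorem IsHomog.eq_zero {T : Module.End ℂ (⨁ s, V s)} {n : ℤ} {i j : I} (hT : IsHomog T n)
    (hj : vertexTot V j * T = T) (hi : T * vertexTot V i = T)
    (h : ∀ k v, T (DirectSum.lof ℂ (I × ℤ) V (i, k) v) (j, k + n) = 0) : T = 0 := by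
  refine DirectSum.linearMap_ext ℂ fun s => LinearMap.ext fun v => ?_
  rw [LinearMap.comp_apply, LinearMap.comp_apply, LinearMap.zero_apply]
  by_cases hs : s.1 = i
  · obtain ⟨i', k⟩ := s
    simp only at hs
    subst hs
    refine DFinsupp.ext fun t => ?_
    change T (DirectSum.lof ℂ (I × ℤ) V (i', k) v) t = 0
    by_cases ht : t.1 = j
    · by_cases hk : t.2 = k + n
      · obtain ⟨j', l⟩ := t
        simp only at ht hk
        subst ht hk
        exact h k v
      · refine hT k _ (fun t' ht' => lof_apply_of_ne (fun h' => ht' ?_) v) t hk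
        rw [← h']
    · rw [← hj, Module.End.mul_apply, vertexTot_apply, if_neg ht]
  · rw [← hi, Module.End.mul_apply, vertexTot_lof, if_neg hs, map_zero]

theorem commute_vertexTot_epsTot (x : TripleRep D V) (i : I) (k : ℕ) :
    Commute (vertexTot V i) (epsTot x i ^ k) := by
  refine Commute.pow_right ?_ k
  rw [commute_iff_eq, vertexTot_mul_epsTot, epsTot_mul_vertexTot]

theorem vertexTot_mul_derivAl (x : TripleRep D V) (i j : I) :
    vertexTot V i * derivAl x i j = derivAl x i j := by
  rw [derivAl, mul_sub, ← mul_assoc, ← mul_assoc, (commute_vertexTot_epsTot x i _).eq, mul_assoc,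
    vertexTot_mul_alphaTot]

theorem derivAl_mul_vertexTot (x : TripleRep D V) (i j : I) :
    derivAl x i j * vertexTot V j = derivAl x i j := by
  rw [derivAl, sub_mul, mul_assoc, mul_assoc, ← (commute_vertexTot_epsTot x j _).eq, ← mul_assoc,
    ← mul_assoc, alphaTot_mul_vertexTot, mul_assoc, alphaTot_mul_vertexTot]

theorem vertexTot_mul_derivEp (x : TripleRep D V) (i : I) :
    vertexTot V i * derivEp x i = derivEp x i := by
  rw [derivEp, Finset.mul_sum]
  refine Finset.sum_congr rfl fun j _ => ?_
  rw [Finset.mul_sum]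
  refine Finset.sum_congr rfl fun k _ => ?_
  rw [mul_smul_comm, ← mul_assoc, ← mul_assoc, ← mul_assoc, (commute_vertexTot_epsTot x i _).eq,
    mul_assoc (epsTot x i ^ k), vertexTot_mul_alphaTot]

theorem derivEp_mul_vertexTot (x : TripleRep D V) (i : I) :
    derivEp x i * vertexTot V i = derivEp x i := by
  rw [derivEp, Finset.sum_mul]
  refine Finset.sum_congr rfl fun j _ => ?_
  rw [Finset.sum_mul]
  refine Finset.sum_congr rfl fun k _ => ?_
  rw [smul_mul_assoc, mul_assoc _ _ (vertexTot V i), ← (commute_vertexTot_epsTot x i _).eq,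
    ← mul_assoc, mul_assoc _ (alphaTot x j i), alphaTot_mul_vertexTot]

end Homogeneous

/-! ### The differential of the potential -/

section Differential

/-- The map `h` to a vector space has coordinatewise derivative `h'` at `0`. -/
def HasCoordDeriv {E : Type*} [AddCommGroup E] [Module ℂ E] (h : ℂ → E) (h' : E) : Prop :=
  ∀ φ : Module.Dual ℂ E, HasDerivAt (fun t => φ (h t)) (φ h') 0

section

variable {E : Type*} [AddCommGroup E] [Module ℂ E]

theorem HasCoordDeriv.affine (e e' : E) : HasCoordDeriv (fun t => e + t • e') e' := by
  intro φ
  have h := ((hasDerivAt_id (0 : ℂ)).mul_const (φ e')).const_add (φ e)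
  rw [one_mul] at h
  have e : (fun t : ℂ => φ (e + t • e')) = fun t => φ e + id t * φ e' := by
    ext t
    rw [map_add, map_smul, smul_eq_mul, id]
  rwa [e]

theorem HasCoordDeriv.const (e : E) : HasCoordDeriv (fun _ => e) 0 := by
  intro φ
  rw [map_zero]
  exact hasDerivAt_const (0 : ℂ) (φ e)

/-- The Leibniz rule. -/
theorem HasCoordDeriv.mul {R : Type*} [Ring R] [Algebra ℂ R] [Module.Finite ℂ R] {h k : ℂ → R}
    {h' k' : R} (H : HasCoordDeriv h h') (K : HasCoordDeriv k k') :
    HasCoordDeriv (fun t => h t * k t) (h' * k 0 + h 0 * k') := by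
  intro φ
  let b := Module.finBasis ℂ R
  have e : ∀ x y : R, φ (x * y) = ∑ i, b.coord i x * φ (b i * y) := by
    intro x y
    have h := congrArg (fun e => φ (e * y)) (b.sum_repr x).symm
    simpa only [Module.Basis.coord_apply, Finset.sum_mul, smul_mul_assoc, map_sum, map_smul,
      smul_eq_mul] using h
  have hfun : (fun t => φ (h t * k t)) = fun t => ∑ i, b.coord i (h t) * φ (b i * k t) :=
    funext fun t => e _ _
  rw [hfun, map_add, e h', e (h 0), ← Finset.sum_add_distrib]
  refine HasDerivAt.fun_sum fun i _ => ?_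
  exact (H (b.coord i)).mul (K (φ ∘ₗ LinearMap.mulLeft ℂ (b i)))

theorem HasCoordDeriv.pow {R : Type*} [Ring R] [Algebra ℂ R] [Module.Finite ℂ R] {h : ℂ → R}
    {h' : R} (H : HasCoordDeriv h h') (n : ℕ) :
    HasCoordDeriv (fun t => h t ^ n)
      (∑ k ∈ Finset.range n, h 0 ^ k * h' * h 0 ^ (n - 1 - k)) := by
  induction n with
  | zero => simpa using HasCoordDeriv.const (1 : R)
  | succ n ih =>
    have h1 := ih.mul H
    simp only [← pow_succ] at h1
    convert h1 using 1
    rw [Finset.sum_range_succ, Finset.sum_mul]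
    congr 1
    · refine Finset.sum_congr rfl fun k hk => ?_
      have := Finset.mem_range.1 hk
      rw [mul_assoc _ _ (h 0), ← pow_succ]
      congr 2
      omega
    · simp

end

variable {V : I × ℤ → Type*} [∀ s, AddCommGroup (V s)] [∀ s, Module ℂ (V s)]
variable {W : I × ℤ → Type*} [∀ s, AddCommGroup (W s)] [∀ s, Module ℂ (W s)]

theorem alphaTot_add_smul (x y : TripleRep D V) (t : ℂ) (i j : I) :
    alphaTot (x + t • y) i j = alphaTot x i j + t • alphaTot y i j := by
  refine DirectSum.linearMap_ext ℂ fun s => LinearMap.ext fun v => ?_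
  simp only [LinearMap.comp_apply, LinearMap.add_apply, LinearMap.smul_apply, alphaTot,
    DirectSum.toModule_lof]
  split_ifs <;> simp

theorem epsTot_add_smul (x y : TripleRep D V) (t : ℂ) (i : I) :
    epsTot (x + t • y) i = epsTot x i + t • epsTot y i := by
  refine DirectSum.linearMap_ext ℂ fun s => LinearMap.ext fun v => ?_
  simp only [LinearMap.comp_apply, LinearMap.add_apply, LinearMap.smul_apply, epsTot,
    DirectSum.toModule_lof]
  split_ifs <;> simp

/-- The differential of the potential pairs, under the trace, the variations of the arrows with the
cyclic derivatives. -/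
theorem lineDeriv_potential [Module.Finite ℂ (⨁ s, V s)] (x y : FramedRep D V W) :
    lineDeriv ℂ (potential (D := D) (V := V) (W := W)) x y =
      ∑ i : I, LinearMap.trace ℂ _ (epsTot y.1 i * derivEp x.1 i) -
      ∑ i : I, ∑ j : I, (D.o i j : ℂ) *
        LinearMap.trace ℂ _ (alphaTot y.1 i j * derivAl x.1 j i) := by
  set tr := LinearMap.trace ℂ (⨁ s, V s)
  have hA := fun i j => HasCoordDeriv.affine (alphaTot x.1 i j) (alphaTot y.1 i j)
  have hE := fun i => HasCoordDeriv.affine (epsTot x.1 i) (epsTot y.1 i)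
  have key : HasDerivAt (fun t : ℂ => potential (x + t • y))
      (∑ i : I, ∑ j : I, (D.o i j : ℂ) * tr
        (((∑ k ∈ Finset.range (D.m i j),
          epsTot x.1 i ^ k * epsTot y.1 i * epsTot x.1 i ^ (D.m i j - 1 - k)) * alphaTot x.1 i j +
        epsTot x.1 i ^ D.m i j * alphaTot y.1 i j) * alphaTot x.1 j i +
        epsTot x.1 i ^ D.m i j * alphaTot x.1 i j * alphaTot y.1 j i)) 0 := by
    refine HasDerivAt.fun_sum fun i _ => HasDerivAt.fun_sum fun j _ => HasDerivAt.const_mul _ ?_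
    have h := (((hE i).pow (D.m i j)).mul (hA i j)).mul (hA j i) tr
    simp only [zero_smul, add_zero] at h
    simpa only [Prod.fst_add, Prod.smul_fst, alphaTot_add_smul, epsTot_add_smul] using h
  rw [lineDeriv, key.deriv]
  have e1 : ∀ i j, tr ((∑ k ∈ Finset.range (D.m i j),
      epsTot x.1 i ^ k * epsTot y.1 i * epsTot x.1 i ^ (D.m i j - 1 - k)) * alphaTot x.1 i j *
        alphaTot x.1 j i) = tr (epsTot y.1 i * ∑ k ∈ Finset.range (D.m i j), epsTot x.1 i ^ k *
          alphaTot x.1 i j * alphaTot x.1 j i * epsTot x.1 i ^ (D.m i j - 1 - k)) := by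
    intro i j
    rw [← Finset.sum_range_reflect (fun k => epsTot x.1 i ^ k *
          alphaTot x.1 i j * alphaTot x.1 j i * epsTot x.1 i ^ (D.m i j - 1 - k))]
    simp only [Finset.sum_mul, Finset.mul_sum, map_sum]
    refine Finset.sum_congr rfl fun k hk => ?_
    have hk' := Finset.mem_range.1 hk
    have : D.m i j - 1 - (D.m i j - 1 - k) = k := by omega
    rw [this]
    simp only [mul_assoc]
    refine (LinearMap.trace_mul_comm ℂ _ _).trans ?_
    simp only [mul_assoc, tr]
  have e2 : ∀ i j, tr (epsTot x.1 i ^ D.m i j * alphaTot y.1 i j * alphaTot x.1 j i) =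
      tr (alphaTot y.1 i j * (alphaTot x.1 j i * epsTot x.1 i ^ D.m i j)) := by
    intro i j
    rw [mul_assoc]
    refine (LinearMap.trace_mul_comm ℂ _ _).trans ?_
    simp only [mul_assoc, tr]
  have e3 : ∀ i j, tr (epsTot x.1 i ^ D.m i j * alphaTot x.1 i j * alphaTot y.1 j i) =
      tr (alphaTot y.1 j i * (epsTot x.1 i ^ D.m i j * alphaTot x.1 i j)) := by
    intro i j
    rw [LinearMap.trace_mul_comm]
  have e4 : ∑ i : I, ∑ j : I, (D.o i j : ℂ) *
      tr (alphaTot y.1 j i * (epsTot x.1 i ^ D.m i j * alphaTot x.1 i j)) =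
      ∑ i : I, ∑ j : I, (D.o i j : ℂ) *
      (- tr (alphaTot y.1 i j * (epsTot x.1 j ^ D.m j i * alphaTot x.1 j i))) := by
    rw [Finset.sum_comm]
    refine Finset.sum_congr rfl fun i _ => Finset.sum_congr rfl fun j _ => ?_
    rw [D.o_symm i j]
    push_cast
    ring
  simp only [add_mul, map_add, mul_add, Finset.sum_add_distrib, e1, e2, e3]
  rw [e4, add_assoc, ← Finset.sum_add_distrib, sub_eq_add_neg, ← Finset.sum_neg_distrib]
  congr 1
  · refine Finset.sum_congr rfl fun i _ => ?_
    rw [derivEp, Finset.mul_sum, map_sum]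
    refine Finset.sum_congr rfl fun j _ => ?_
    rw [← Finset.smul_sum, mul_smul_comm, map_smul, smul_eq_mul]
  · refine Finset.sum_congr rfl fun i _ => ?_
    rw [← Finset.sum_add_distrib, ← Finset.sum_neg_distrib]
    refine Finset.sum_congr rfl fun j _ => ?_
    rw [derivAl, mul_sub, map_sub]
    ring

theorem trace_lof_smulRight_component [Module.Finite ℂ (⨁ s, V s)] (s t : I × ℤ)
    (φ : Module.Dual ℂ (V s)) (v : V t) (M : Module.End ℂ (⨁ s, V s)) :
    LinearMap.trace ℂ (⨁ s, V s) ((DirectSum.lof ℂ (I × ℤ) V t ∘ₗ φ.smulRight v ∘ₗ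
      DirectSum.component ℂ (I × ℤ) V s) * M) = φ (M (DirectSum.lof ℂ (I × ℤ) V t v) s) := by
  have : (DirectSum.lof ℂ (I × ℤ) V t ∘ₗ φ.smulRight v ∘ₗ
      DirectSum.component ℂ (I × ℤ) V s) * M =
      (φ ∘ₗ DirectSum.component ℂ (I × ℤ) V s ∘ₗ M).smulRight (DirectSum.lof ℂ (I × ℤ) V t v) := by
    refine LinearMap.ext fun w => ?_
    simp only [Module.End.mul_apply, LinearMap.comp_apply, LinearMap.smulRight_apply, map_smul]
  rw [this, LinearMap.trace_smulRight]
  rfl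

theorem component_lof_eq {s : I × ℤ} (v : V s) :
    DirectSum.component ℂ (I × ℤ) V s (DirectSum.lof ℂ (I × ℤ) V s v) = v :=
  DirectSum.component.lof_self ℂ s v

open Classical in
/-- The representation whose only non-zero arrow is the given arrow `α`. -/
def alphaSingle {s t : I × ℤ} (h : AlphaArrow D s t) (Z : V s →ₗ[ℂ] V t) : TripleRep D V :=
  (Pi.single (M := fun p : {p : (I × ℤ) × (I × ℤ) // AlphaArrow D p.1 p.2} =>
    V p.1.1 →ₗ[ℂ] V p.1.2) ⟨(s, t), h⟩ Z, 0)

open Classical in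
/-- The representation whose only non-zero arrow is the given arrow `ε`. -/
def epsSingle {s t : I × ℤ} (h : EpsArrow D s t) (Z : V s →ₗ[ℂ] V t) : TripleRep D V :=
  (0, Pi.single (M := fun p : {p : (I × ℤ) × (I × ℤ) // EpsArrow D p.1 p.2} =>
    V p.1.1 →ₗ[ℂ] V p.1.2) ⟨(s, t), h⟩ Z)

theorem alphaSingle_same {s t : I × ℤ} (h : AlphaArrow D s t) (Z : V s →ₗ[ℂ] V t) :
    (alphaSingle h Z).1 ⟨(s, t), h⟩ = Z :=
  Pi.single_eq_same _ _

theorem alphaSingle_of_ne {s t : I × ℤ} (h : AlphaArrow D s t) (Z : V s →ₗ[ℂ] V t)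
    {p : {p : (I × ℤ) × (I × ℤ) // AlphaArrow D p.1 p.2}} (hp : p.1 ≠ (s, t)) :
    (alphaSingle h Z).1 p = 0 :=
  Pi.single_eq_of_ne (fun h' => hp (congrArg Subtype.val h')) _

theorem epsSingle_same {s t : I × ℤ} (h : EpsArrow D s t) (Z : V s →ₗ[ℂ] V t) :
    (epsSingle h Z).2 ⟨(s, t), h⟩ = Z :=
  Pi.single_eq_same _ _

theorem epsSingle_of_ne {s t : I × ℤ} (h : EpsArrow D s t) (Z : V s →ₗ[ℂ] V t)
    {p : {p : (I × ℤ) × (I × ℤ) // EpsArrow D p.1 p.2}} (hp : p.1 ≠ (s, t)) :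
    (epsSingle h Z).2 p = 0 :=
  Pi.single_eq_of_ne (fun h' => hp (congrArg Subtype.val h')) _

theorem alphaTot_single {s t : I × ℤ} (h : AlphaArrow D s t) (Z : V s →ₗ[ℂ] V t) (i j : I) :
    alphaTot (alphaSingle h Z) i j =
      if i = t.1 ∧ j = s.1 then
        DirectSum.lof ℂ (I × ℤ) V t ∘ₗ Z ∘ₗ DirectSum.component ℂ (I × ℤ) V s else 0 := by
  refine DirectSum.linearMap_ext ℂ fun s' => LinearMap.ext fun v => ?_
  rw [LinearMap.comp_apply, LinearMap.comp_apply]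
  by_cases hs : s' = s
  · subst hs
    by_cases hij : i = t.1 ∧ j = s'.1
    · obtain ⟨rfl, rfl⟩ := hij
      rw [alphaTot_lof _ h, if_pos ⟨rfl, rfl⟩]
      simp only [LinearMap.comp_apply, component_lof_eq, alphaSingle_same]
    · rw [if_neg hij]
      by_cases hj : s'.1 = j
      · subst hj
        have hi : i ≠ t.1 := fun hi => hij ⟨hi, rfl⟩
        by_cases hc : D.c i s'.1 < 0
        · rw [alphaTot_lof (t := (i, s'.2 + D.b i s'.1)) _ ⟨hc, rfl⟩, alphaSingle_of_ne]
          · simp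
          · exact fun h' => hi (congrArg (fun p => p.2.1) h')
        · rw [alphaTot_eq_zero _ hc]
      · rw [alphaTot_lof_of_ne _ hj]; simp
  · have h0 : DirectSum.component ℂ (I × ℤ) V s (DirectSum.lof ℂ (I × ℤ) V s' v) = 0 :=
      lof_apply_of_ne hs v
    have hr : (if i = t.1 ∧ j = s.1 then
        DirectSum.lof ℂ (I × ℤ) V t ∘ₗ Z ∘ₗ DirectSum.component ℂ (I × ℤ) V s else 0)
        (DirectSum.lof ℂ (I × ℤ) V s' v) = 0 := by
      split_ifs
      · simp only [LinearMap.comp_apply, h0, map_zero]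
      · simp
    rw [hr]
    by_cases hj : s'.1 = j
    · subst hj
      by_cases hc : D.c i s'.1 < 0
      · rw [alphaTot_lof (t := (i, s'.2 + D.b i s'.1)) _ ⟨hc, rfl⟩, alphaSingle_of_ne]
        · simp
        · exact fun h' => hs (congrArg (fun p => p.1) h')
      · rw [alphaTot_eq_zero _ hc]; simp
    · rw [alphaTot_lof_of_ne _ hj]

theorem epsTot_single {s t : I × ℤ} (h : EpsArrow D s t) (Z : V s →ₗ[ℂ] V t) (i : I) :
    epsTot (epsSingle h Z) i =
      if i = s.1 then
        DirectSum.lof ℂ (I × ℤ) V t ∘ₗ Z ∘ₗ DirectSum.component ℂ (I × ℤ) V s else 0 := by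
  refine DirectSum.linearMap_ext ℂ fun s' => LinearMap.ext fun v => ?_
  rw [LinearMap.comp_apply, LinearMap.comp_apply]
  by_cases hi : s'.1 = i
  · subst hi
    by_cases hs : s' = s
    · subst hs
      rw [epsTot_lof _ h, if_pos rfl]
      simp only [LinearMap.comp_apply, component_lof_eq, epsSingle_same]
    · rw [epsTot_lof (s := s') (t := (s'.1, s'.2 + 2 * (D.d s'.1 : ℤ))) _ ⟨rfl, rfl⟩,
        epsSingle_of_ne]
      · have h0 : DirectSum.component ℂ (I × ℤ) V s (DirectSum.lof ℂ (I × ℤ) V s' v) = 0 :=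
          lof_apply_of_ne hs v
        split_ifs
        · simp only [LinearMap.comp_apply, h0, map_zero, LinearMap.zero_apply]
        · simp
      · exact fun h' => hs (congrArg (fun p => p.1) h')
  · rw [epsTot_lof_of_ne _ hi]
    split_ifs with h'
    · have hs : s' ≠ s := fun hs => hi (by rw [h', hs])
      have h0 : DirectSum.component ℂ (I × ℤ) V s (DirectSum.lof ℂ (I × ℤ) V s' v) = 0 :=
          lof_apply_of_ne hs v
      simp only [LinearMap.comp_apply, h0, map_zero]
    · simp

theorem alphaTot_epsSingle {s t : I × ℤ} (h : EpsArrow D s t) (Z : V s →ₗ[ℂ] V t) (i j : I) :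
    alphaTot (epsSingle h Z) i j = 0 := by
  refine DirectSum.linearMap_ext ℂ fun s => LinearMap.ext fun v => ?_
  simp [alphaTot, DirectSum.toModule_lof, epsSingle]

theorem epsTot_alphaSingle {s t : I × ℤ} (h : AlphaArrow D s t) (Z : V s →ₗ[ℂ] V t) (i : I) :
    epsTot (alphaSingle h Z) i = 0 := by
  refine DirectSum.linearMap_ext ℂ fun s => LinearMap.ext fun v => ?_
  simp [epsTot, DirectSum.toModule_lof, alphaSingle]

/-- The critical points of the potential are the modules over the generalized preprojective
algebra. -/
theorem isCritical_iff [Module.Finite ℂ (⨁ s, V s)] (x : FramedRep D V W) :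
    IsCritical x ↔ ∀ a b, Rel D a b → freeRep x.1 a = freeRep x.1 b := by
  rw [freeRep_rel_iff]
  constructor
  · intro h
    constructor
    · intro i j hc
      refine (isHomog_derivAl x.1 hc).eq_zero (vertexTot_mul_derivAl _ _ _)
        (derivAl_mul_vertexTot _ _ _) fun k v => ?_
      have harr : AlphaArrow D (i, k + -D.b i j) (j, k) :=
        ⟨D.c_neg_symm hc, by simp [D.b_symm j i]⟩
      refine (Module.forall_dual_apply_eq_zero_iff ℂ _).1 fun φ => ?_
      have h1 := h (alphaSingle harr (φ.smulRight v), 0)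
      rw [lineDeriv_potential] at h1
      simp only [epsTot_alphaSingle, zero_mul, map_zero, Finset.sum_const_zero, zero_sub,
        neg_eq_zero] at h1
      rw [Finset.sum_eq_single j, Finset.sum_eq_single i] at h1
      · simp only [alphaTot_single, and_self, if_true] at h1
        rw [trace_lof_smulRight_component] at h1
        refine (mul_eq_zero.1 h1).resolve_left ?_
        exact_mod_cast D.o_ne_zero (D.c_neg_symm hc)
      · intro i' _ hi'
        simp [alphaTot_single, hi']
      · simp
      · intro j' _ hj'
        simp [alphaTot_single, hj']
      · simp
    · intro i
      refine (isHomog_derivEp x.1 i).eq_zero (vertexTot_mul_derivEp _ _)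
        (derivEp_mul_vertexTot _ _) fun k v => ?_
      have harr : EpsArrow D (i, k + -(2 * (D.d i : ℤ))) (i, k) := ⟨rfl, by simp⟩
      refine (Module.forall_dual_apply_eq_zero_iff ℂ _).1 fun φ => ?_
      have h1 := h (epsSingle harr (φ.smulRight v), 0)
      rw [lineDeriv_potential] at h1
      simp only [alphaTot_epsSingle, zero_mul, map_zero, mul_zero, Finset.sum_const_zero, sub_zero]
        at h1
      rw [Finset.sum_eq_single i] at h1
      · simp only [epsTot_single, if_true] at h1
        rwa [trace_lof_smulRight_component] at h1
      · intro i' _ hi'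
        simp [epsTot_single, hi']
      · simp
  · rintro ⟨h1, h2⟩ y
    rw [lineDeriv_potential]
    have e : ∀ i j, (D.o i j : ℂ) *
        LinearMap.trace ℂ _ (alphaTot y.1 i j * derivAl x.1 j i) = 0 := by
      intro i j
      by_cases hc : D.c i j < 0
      · simp [h1 j i (D.c_neg_symm hc)]
      · simp [D.o_eq_zero hc]
    simp [e, h2]

end Differential

/-! ### Nilpotency of finite dimensional modules -/

variable (D)

section Nilpotent

/-- The only vector `n ≥ 0` with `C n ≤ 0`, for the Cartan matrix `C`, is zero: pair `n` with the
positive definite form. -/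
theorem CartanDatum.eq_zero_of_sum_le {n : I → ℕ}
    (h : ∀ i, 2 * n i ≤ ∑ j, D.m i j * n j) : n = 0 := by
  by_contra hn
  have hx : (fun i => (n i : ℝ)) ≠ 0 := by
    intro h0
    refine hn (funext fun i => ?_)
    exact Nat.cast_eq_zero.1 (congrFun h0 i : (n i : ℝ) = 0)
  have hpos := D.finiteType.dotProduct_mulVec_pos hx
  have hc : ∀ i, ∑ j, D.c i j * (n j : ℤ) ≤ 0 := by
    intro i
    have e : ∀ j, D.c i j * (n j : ℤ) = (if i = j then 2 * (n j : ℤ) else 0) - D.m i j * n j := by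
      intro j
      by_cases hij : i = j
      · subst hij
        simp [CartanDatum.m, D.diag]
      · have h1 : (D.m i j : ℤ) = - D.c i j := by
          rw [CartanDatum.m, Int.toNat_of_nonneg]
          have := D.nonpos i j hij
          omega
        rw [if_neg hij, h1]; ring
    simp only [e, Finset.sum_sub_distrib, Finset.sum_ite_eq, Finset.mem_univ, if_true]
    have := h i
    zify at this
    linarith
  have hle : star (fun i => (n i : ℝ)) ⬝ᵥ
      (Matrix.of fun i j => ((D.d i : ℝ) * (D.c i j : ℝ))).mulVec (fun i => (n i : ℝ)) ≤ 0 := by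
    simp only [dotProduct, Matrix.mulVec, Matrix.of_apply]
    refine Finset.sum_nonpos fun i _ => ?_
    have h1 : ∑ j, (D.d i : ℝ) * (D.c i j : ℝ) * (n j : ℝ) =
        D.d i * ((∑ j, D.c i j * (n j : ℤ) : ℤ) : ℝ) := by
      push_cast
      rw [Finset.mul_sum]
      exact Finset.sum_congr rfl fun j _ => by ring
    rw [h1]
    have h2 : ((∑ j, D.c i j * (n j : ℤ) : ℤ) : ℝ) ≤ 0 := by exact_mod_cast hc i
    have h3 : star (fun i => (n i : ℝ)) i = n i := rfl
    rw [h3]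
    exact mul_nonpos_of_nonneg_of_nonpos (Nat.cast_nonneg _)
      (mul_nonpos_of_nonneg_of_nonpos (Nat.cast_nonneg _) h2)
  exact absurd hpos (not_lt.2 hle)

/-- A subspace of the generalized preprojective algebra which contains `1` and is stable under left
multiplication by the generators is everything. -/
theorem mem_of_gen_mul_mem {N : Submodule ℂ (PreprojAlg D)} (h1 : 1 ∈ N)
    (hg : ∀ g, ∀ y ∈ N, pgen D g * y ∈ N) (y : PreprojAlg D) : y ∈ N := by
  obtain ⟨a, rfl⟩ := RingQuot.mkAlgHom_surjective ℂ (Rel D) y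
  have h : ∀ y ∈ N, RingQuot.mkAlgHom ℂ (Rel D) a * y ∈ N := by
    induction a using FreeAlgebra.induction with
    | grade0 r =>
      intro y hy
      rw [AlgHom.commutes, ← Algebra.smul_def]
      exact N.smul_mem r hy
    | grade1 g => exact fun y hy => hg g y hy
    | mul a b ha hb =>
      intro y hy
      rw [map_mul, mul_assoc]
      exact ha _ (hb _ hy)
    | add a b ha hb =>
      intro y hy
      rw [map_add, add_mul]
      exact N.add_mem (ha _ hy) (hb _ hy)
  simpa using h 1 h1

theorem e_mul_e_of_ne {i j : I} (h : i ≠ j) : pgen D (.e i) * pgen D (.e j) = 0 := by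
  simpa [pgen] using RingQuot.mkAlgHom_rel ℂ (Rel.orth (D := D) i j h)

theorem sum_e : ∑ i : I, pgen D (.e i) = 1 := by
  simpa [pgen] using RingQuot.mkAlgHom_rel ℂ (Rel.one (D := D))

theorem al_mul_e (i j : I) : pgen D (.al i j) * pgen D (.e j) = pgen D (.al i j) := by
  have h : pgen D (.e i) * pgen D (.al i j) * pgen D (.e j) = pgen D (.al i j) := by
    simpa [pgen] using RingQuot.mkAlgHom_rel ℂ (Rel.al_ends (D := D) i j)
  rw [← h, mul_assoc, e_mul_e]

theorem ep_mul_e (i : I) : pgen D (.ep i) * pgen D (.e i) = pgen D (.ep i) := by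
  have h : pgen D (.e i) * pgen D (.ep i) * pgen D (.e i) = pgen D (.ep i) := by
    simpa [pgen] using RingQuot.mkAlgHom_rel ℂ (Rel.ep_ends (D := D) i)
  rw [← h, mul_assoc, e_mul_e]

theorem al_eq_zero {i j : I} (h : ¬ D.c i j < 0) : pgen D (.al i j) = 0 := by
  simpa [pgen] using RingQuot.mkAlgHom_rel ℂ (Rel.al_zero (D := D) i j h)

theorem ep_pow_mul_al {i j : I} (h : D.c i j < 0) :
    pgen D (.ep i) ^ D.m i j * pgen D (.al i j) = pgen D (.al i j) * pgen D (.ep j) ^ D.m j i := by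
  simpa [pgen] using RingQuot.mkAlgHom_rel ℂ (Rel.deriv_al (D := D) i j h)

theorem sum_ep_al_al_ep (i : I) :
    ∑ j : I, ∑ k ∈ Finset.range (D.m i j), (D.o i j : ℂ) •
      (pgen D (.ep i) ^ k * pgen D (.al i j) * pgen D (.al j i) *
        pgen D (.ep i) ^ (D.m i j - 1 - k)) = 0 := by
  simpa [pgen] using RingQuot.mkAlgHom_rel ℂ (Rel.deriv_ep (D := D) i)

variable {M : Type*} [AddCommGroup M] [Module ℂ M] [Module (PreprojAlg D) M]
  [IsScalarTower ℂ (PreprojAlg D) M]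

/-- A subspace of a module which is stable under the generators is a submodule. -/
def submoduleOfGen (N : Submodule ℂ M) (h : ∀ g, ∀ m ∈ N, pgen D g • m ∈ N) :
    Submodule (PreprojAlg D) M where
  carrier := N
  add_mem' := N.add_mem
  zero_mem' := N.zero_mem
  smul_mem' y m hm := by
    let S : Submodule ℂ (PreprojAlg D) :=
      { carrier := {y | y • m ∈ N}
        add_mem' := fun {a b} ha hb => by
          change (a + b) • m ∈ N
          rw [add_smul]; exact N.add_mem ha hb
        zero_mem' := by
          change (0 : PreprojAlg D) • m ∈ N
          rw [zero_smul]; exact N.zero_mem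
        smul_mem' := fun r a ha => by
          change (r • a) • m ∈ N
          rw [smul_assoc]; exact N.smul_mem r ha }
    refine mem_of_gen_mul_mem D (N := S) ?_ ?_ y
    · change (1 : PreprojAlg D) • m ∈ N
      rwa [one_smul]
    · intro g y hy
      change (pgen D g * y) • m ∈ N
      rw [mul_smul]
      exact h g _ hy

variable {D}

theorem mem_submoduleOfGen {N : Submodule ℂ M} {h : ∀ g, ∀ m ∈ N, pgen D g • m ∈ N} {m : M} :
    m ∈ submoduleOfGen D N h ↔ m ∈ N := Iff.rfl

/-- The action of an element of the algebra as a complex linear map. -/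
def lmul (y : PreprojAlg D) : M →ₗ[ℂ] M := Module.toModuleEnd ℂ M y

theorem lmul_apply (y : PreprojAlg D) (m : M) : lmul y m = y • m := rfl

/-- A simple module supported at one vertex on which the `α` vanish and the `ε` are nilpotent
is one of the obvious one dimensional modules. -/
theorem ep_smul_eq_zero_of_simple [IsSimpleModule (PreprojAlg D) M]
    (hnil : ∀ i, ∃ n : ℕ, ∀ m : M, pgen D (.ep i) ^ n • m = 0)
    (hal : ∀ i j (m : M), pgen D (.al i j) • m = 0) {i : I} (hi : ∀ m : M, pgen D (.e i) • m = m)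
    (j : I) (m : M) : pgen D (.ep j) • m = 0 := by
  have hj : ∀ j, j ≠ i → ∀ m : M, pgen D (.e j) • m = 0 := by
    intro j hj m
    rw [← hi m, ← mul_smul, e_mul_e_of_ne D hj, zero_smul]
  by_cases hji : j = i
  · subst hji
    let K : Submodule (PreprojAlg D) M := submoduleOfGen D (LinearMap.ker (lmul (pgen D (.ep j)))) <| by
      intro g m hm
      simp only [LinearMap.mem_ker, lmul_apply] at hm ⊢
      cases g with
      | e k =>
        by_cases hk : k = j
        · subst hk; rw [hi, hm]
        · rw [hj k hk, smul_zero]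
      | al k l => rw [hal, smul_zero]
      | ep k =>
        by_cases hk : k = j
        · subst hk; rw [hm, smul_zero]
        · have : pgen D (.ep k) • m = 0 := by rw [← ep_mul_e, mul_smul, hj k hk, smul_zero]
          rw [this, smul_zero]
    rcases eq_bot_or_eq_top K with hK | hK
    · exfalso
      obtain ⟨n, hn⟩ := hnil j
      have hz : ∀ (n : ℕ) (m : M), pgen D (.ep j) ^ n • m = 0 → m = 0 := by
        intro n
        induction n with
        | zero => intro m hm; simpa using hm
        | succ n ih =>
          intro m hm
          refine ih m ?_
          have : pgen D (.ep j) ^ n • m ∈ K := by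
            refine mem_submoduleOfGen.2 (LinearMap.mem_ker.2 ?_)
            rw [lmul_apply, ← mul_smul, ← pow_succ', hm]
          rwa [hK, Submodule.mem_bot] at this
      have := IsSimpleModule.nontrivial (PreprojAlg D) M
      obtain ⟨m, hm⟩ := exists_ne (0 : M)
      exact hm (hz n m (hn m))
    · have : m ∈ K := hK ▸ Submodule.mem_top
      exact this
  · rw [← ep_mul_e, mul_smul, hj j hji, smul_zero]

/-- The span of the images of the `ε_i^l α_{ij}`. -/
def inSpan (M : Type*) [AddCommGroup M] [Module ℂ M] [Module (PreprojAlg D) M]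
    [IsScalarTower ℂ (PreprojAlg D) M] (i : I) : Submodule ℂ M :=
  Submodule.span ℂ {m | ∃ (l : ℕ) (j : I) (m' : M), m = (pgen D (.ep i) ^ l * pgen D (.al i j)) • m'}

/-- The dimension count at the vertex `i`: if no vector is killed by all the `α_{ji} ε_i^l` and if
the images of the `ε_i^l α_{ij}` span, then the complex `M_i → ⨁_j M_j^{m_{ij}} → M_i` is injective
on the left and surjective on the right. -/
theorem two_mul_finrank_le [Module.Finite ℂ M] (i : I)
    (hout : ∀ m : M, pgen D (.e i) • m = m →
      (∀ j (l : ℕ), (pgen D (.al j i) * pgen D (.ep i) ^ l) • m = 0) → m = 0)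
    (hin : ∀ m : M, pgen D (.e i) • m ∈ inSpan (D := D) M i) :
    2 * Module.finrank ℂ (LinearMap.range (lmul (M := M) (pgen D (.e i)))) ≤
      ∑ j, D.m i j * Module.finrank ℂ (LinearMap.range (lmul (M := M) (pgen D (.e j)))) := by
  let N : I → Submodule ℂ M := fun j => LinearMap.range (lmul (pgen D (.e j)))
  let P := ∀ j, Fin (D.m i j) → N j
  let inn : P →ₗ[ℂ] M := ∑ j, ∑ k : Fin (D.m i j),
    lmul (pgen D (.ep i) ^ (k : ℕ) * pgen D (.al i j)) ∘ₗ (N j).subtype ∘ₗ LinearMap.proj k ∘ₗ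
      LinearMap.proj j
  let out : M →ₗ[ℂ] P := LinearMap.pi fun j => LinearMap.pi fun k =>
    (lmul ((D.o i j : ℂ) • (pgen D (.al j i) * pgen D (.ep i) ^ (D.m i j - 1 - k)))).codRestrict (N j)
      fun m => ⟨((D.o i j : ℂ) • (pgen D (.al j i) * pgen D (.ep i) ^ (D.m i j - 1 - k))) • m, by
        rw [lmul_apply, lmul_apply, ← mul_smul, mul_smul_comm, ← mul_assoc, e_mul_al]⟩
  have hinn : ∀ f : P, inn f = ∑ j, ∑ k : Fin (D.m i j),
      (pgen D (.ep i) ^ (k : ℕ) * pgen D (.al i j)) • (f j k : M) := by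
    intro f
    simp only [inn, LinearMap.sum_apply]
    rfl
  -- the composition is the action of the relation at the vertex `i`
  have hcomp : ∀ m, inn (out m) = 0 := by
    intro m
    have h := congrArg (fun y => y • m) (sum_ep_al_al_ep D i)
    simp only [zero_smul, Finset.sum_smul] at h
    rw [← h]
    rw [hinn]
    refine Finset.sum_congr rfl fun j _ => ?_
    rw [← Fin.sum_univ_eq_sum_range (fun k => ((D.o i j : ℂ) •
      (pgen D (.ep i) ^ k * pgen D (.al i j) * pgen D (.al j i) *
        pgen D (.ep i) ^ (D.m i j - 1 - k))) • m) (D.m i j)]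
    refine Finset.sum_congr rfl fun k _ => ?_
    change (pgen D (.ep i) ^ (k : ℕ) * pgen D (.al i j)) •
      (((D.o i j : ℂ) • (pgen D (.al j i) * pgen D (.ep i) ^ (D.m i j - 1 - k))) • m) = _
    rw [← mul_smul, mul_smul_comm]
    simp only [mul_assoc]
  have hinj : ∀ m ∈ N i, out m = 0 → m = 0 := by
    rintro _ ⟨m', rfl⟩ hm
    refine hout _ (by rw [lmul_apply, ← mul_smul, e_mul_e]) fun j l => ?_
    set m := lmul (pgen D (.e i)) m'
    by_cases hc : D.c i j < 0
    · induction l using Nat.strong_induction_on with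
      | _ l ih =>
        by_cases hl : l < D.m i j
        · have h1 : ((D.o i j : ℂ) • (pgen D (.al j i) * pgen D (.ep i) ^
              (D.m i j - 1 - (D.m i j - 1 - l)))) • m = 0 :=
            congrArg (fun f : P => (f j ⟨D.m i j - 1 - l, by omega⟩ : M)) hm
          rw [show D.m i j - 1 - (D.m i j - 1 - l) = l by omega, smul_assoc] at h1
          refine (smul_eq_zero.1 h1).resolve_left ?_
          exact_mod_cast D.o_ne_zero hc
        -- a power of `ε_i` with exponent at least `m i j` can be moved across `α_{ji}`
        · obtain ⟨r, rfl⟩ := Nat.exists_eq_add_of_le (not_lt.1 hl)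
          have hm0 : 0 < D.m i j := by rw [CartanDatum.m]; omega
          rw [pow_add, ← mul_assoc, ← ep_pow_mul_al D (D.c_neg_symm hc), mul_assoc, mul_smul,
            ih r (by omega), smul_zero]
    · rw [al_eq_zero D (fun h => hc (D.c_neg_symm h)), zero_mul, zero_smul]
  have hspan : inSpan (D := D) M i ≤ LinearMap.range inn := by
    refine Submodule.span_le.2 ?_
    rintro _ ⟨l, j, m, rfl⟩
    by_cases hc : D.c i j < 0
    · induction l using Nat.strong_induction_on generalizing m with
      | _ l ih =>
        by_cases hl : l < D.m i j
        · classical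
          let m₀ : N j := ⟨lmul (pgen D (.e j)) m, LinearMap.mem_range_self _ _⟩
          let f : P := Pi.single j (Pi.single ⟨l, hl⟩ m₀)
          have hf : f j ⟨l, hl⟩ = m₀ := by simp [f]
          have hm₀ : (m₀ : M) = pgen D (.e j) • m := rfl
          refine ⟨f, ?_⟩
          rw [hinn, Finset.sum_eq_single j, Finset.sum_eq_single ⟨l, hl⟩]
          · rw [hf, hm₀, ← mul_smul, mul_assoc, al_mul_e]
          · intro k _ hk
            have : f j k = 0 := by simp [f, hk]
            rw [this, Submodule.coe_zero, smul_zero]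
          · simp
          · intro j' _ hj'
            have : f j' = 0 := by simp [f, hj']
            simp [this]
          · simp
        · obtain ⟨r, rfl⟩ := Nat.exists_eq_add_of_le (not_lt.1 hl)
          have hm0 : 0 < D.m i j := by rw [CartanDatum.m]; omega
          rw [add_comm, pow_add, mul_assoc, ep_pow_mul_al D hc, ← mul_assoc, mul_smul]
          exact ih r (by omega) _
    · rw [al_eq_zero D hc, mul_zero, zero_smul]
      exact zero_mem _
  have hN : N i ≤ LinearMap.range inn := by
    rintro _ ⟨m, rfl⟩
    exact hspan (hin m)
  have h1 : Module.finrank ℂ (N i) ≤ Module.finrank ℂ (LinearMap.range inn) :=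
    Submodule.finrank_mono hN
  have h2 : Module.finrank ℂ (N i) ≤ Module.finrank ℂ (LinearMap.ker inn) := by
    let f : N i →ₗ[ℂ] LinearMap.ker inn :=
      (out ∘ₗ (N i).subtype).codRestrict _ fun m => hcomp m
    refine LinearMap.finrank_le_finrank_of_injective (f := f) ?_
    refine LinearMap.ker_eq_bot.1 (LinearMap.ker_eq_bot'.2 fun m hm => ?_)
    exact Subtype.ext (hinj m.1 m.2 (congrArg Subtype.val hm))
  have h3 := LinearMap.finrank_range_add_finrank_ker inn
  have h4 : Module.finrank ℂ P = ∑ j, D.m i j * Module.finrank ℂ (N j) := by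
    rw [Module.finrank_pi_fintype]
    refine Finset.sum_congr rfl fun j _ => ?_
    rw [Module.finrank_pi_fintype]
    simp
  change 2 * Module.finrank ℂ (N i) ≤ ∑ j, D.m i j * Module.finrank ℂ (N j)
  omega

/-- On a simple finite dimensional module on which the `ε_i` are nilpotent, all the arrows vanish.
Otherwise the dimension vector would be in the cone where the positive definite form of `D` is
non-positive. -/
theorem arrow_smul_eq_zero_of_simple [IsSimpleModule (PreprojAlg D) M] [Module.Finite ℂ M]
    (hnil : ∀ i, ∃ n : ℕ, ∀ m : M, pgen D (.ep i) ^ n • m = 0) :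
    (∀ i j (m : M), pgen D (.al i j) • m = 0) ∧ ∀ i (m : M), pgen D (.ep i) • m = 0 := by
  suffices h : ∃ i, (∀ m : M, pgen D (.e i) • m = m) ∧ ∀ i j (m : M), pgen D (.al i j) • m = 0 by
    obtain ⟨i, h1, h2⟩ := h
    exact ⟨h2, ep_smul_eq_zero_of_simple hnil h2 h1⟩
  have ee : ∀ {i j : I}, i ≠ j → ∀ m : M, pgen D (.e i) • pgen D (.e j) • m = 0 := by
    intro i j h m
    rw [← mul_smul, e_mul_e_of_ne D h, zero_smul]
  -- either the vectors at some vertex killed by all the `α_{ji} ε_i^l` form a non-zero submodule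
  by_cases h1 : ∃ (i : I) (m : M), m ≠ 0 ∧ pgen D (.e i) • m = m ∧
      ∀ j (l : ℕ), (pgen D (.al j i) * pgen D (.ep i) ^ l) • m = 0
  · obtain ⟨i, m, hm0, hm⟩ := h1
    let K₀ : Submodule ℂ M :=
      { carrier := {m | pgen D (.e i) • m = m ∧
          ∀ j (l : ℕ), (pgen D (.al j i) * pgen D (.ep i) ^ l) • m = 0}
        add_mem' := fun {a b} ha hb => ⟨by rw [smul_add, ha.1, hb.1], fun j l => by
          rw [smul_add, ha.2, hb.2, add_zero]⟩
        zero_mem' := ⟨smul_zero _, fun j l => smul_zero _⟩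
        smul_mem' := fun r a ha => ⟨by rw [smul_comm, ha.1], fun j l => by
          rw [smul_comm, ha.2, smul_zero]⟩ }
    let K : Submodule (PreprojAlg D) M := submoduleOfGen D K₀ <| by
      rintro g m ⟨hm1, hm2⟩
      cases g with
      | e k =>
        by_cases hk : k = i
        · subst hk; rw [hm1]; exact ⟨hm1, hm2⟩
        · rw [← hm1, ee hk]; exact zero_mem _
      | al j k =>
        by_cases hk : k = i
        · subst hk
          have := hm2 j 0
          rw [pow_zero, mul_one] at this
          rw [this]; exact zero_mem _
        · rw [← hm1, ← al_mul_e, mul_smul, ee hk, smul_zero]; exact zero_mem _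
      | ep k =>
        by_cases hk : k = i
        · subst hk
          refine ⟨by rw [← mul_smul, e_mul_ep], fun j l => ?_⟩
          rw [← mul_smul, mul_assoc, ← pow_succ, hm2]
        · rw [← hm1, ← ep_mul_e, mul_smul, ee hk, smul_zero]; exact zero_mem _
    have hK : K = ⊤ := by
      refine (eq_bot_or_eq_top K).resolve_left fun hK => hm0 ?_
      have : m ∈ K := hm
      rwa [hK, Submodule.mem_bot] at this
    have hK' : ∀ m : M, m ∈ K := fun m => hK ▸ Submodule.mem_top
    refine ⟨i, fun m => (hK' m).1, fun j k m => ?_⟩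
    by_cases hk : k = i
    · subst hk
      simpa using (hK' m).2 j 0
    · rw [← (hK' m).1, ← al_mul_e, mul_smul, ee hk, smul_zero]
  -- or the vectors whose component at some vertex is in the span of the images form a proper one
  by_cases h2 : ∃ (i : I) (m : M), pgen D (.e i) • m ∉ inSpan (D := D) M i
  · obtain ⟨i, m, hm⟩ := h2
    have hal : ∀ k (m : M), pgen D (.al i k) • m ∈ inSpan (D := D) M i := fun k m =>
      Submodule.subset_span ⟨0, k, m, by rw [pow_zero, one_mul]⟩
    have hep : ∀ m ∈ inSpan (D := D) M i, pgen D (.ep i) • m ∈ inSpan (D := D) M i := by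
      intro m hm
      have : inSpan (D := D) M i ≤ (inSpan (D := D) M i).comap (lmul (pgen D (.ep i))) := by
        refine Submodule.span_le.2 ?_
        rintro _ ⟨l, j, m', rfl⟩
        refine Submodule.subset_span ⟨l + 1, j, m', ?_⟩
        rw [lmul_apply, ← mul_smul, ← mul_assoc, ← pow_succ']
      exact this hm
    let K : Submodule (PreprojAlg D) M :=
      submoduleOfGen D ((inSpan (D := D) M i).comap (lmul (pgen D (.e i)))) <| by
        intro g m hm
        rw [Submodule.mem_comap, lmul_apply] at hm ⊢
        cases g with
        | e k =>
          by_cases hk : k = i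
          · subst hk; rwa [← mul_smul, e_mul_e]
          · rw [ee (Ne.symm hk)]; exact zero_mem _
        | al j k =>
          by_cases hj : j = i
          · subst hj; rw [← mul_smul, e_mul_al]; exact hal _ _
          · rw [← e_mul_al, mul_smul, ee (Ne.symm hj)]; exact zero_mem _
        | ep k =>
          by_cases hk : k = i
          · subst hk
            rw [← mul_smul, e_mul_ep, ← ep_mul_e, mul_smul]
            exact hep _ hm
          · rw [← e_mul_ep, mul_smul, ee (Ne.symm hk)]; exact zero_mem _
    have hK : K = ⊥ := by
      refine (eq_bot_or_eq_top K).resolve_right fun hK => hm ?_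
      have : m ∈ K := hK ▸ Submodule.mem_top
      exact this
    have hK' : ∀ m : M, pgen D (.e i) • m ∈ inSpan (D := D) M i → m = 0 := by
      intro m hm
      have : m ∈ K := hm
      rwa [hK, Submodule.mem_bot] at this
    have hej : ∀ j, j ≠ i → ∀ m : M, pgen D (.e j) • m = 0 := fun j hj m =>
      hK' _ (by rw [ee (Ne.symm hj)]; exact zero_mem _)
    refine ⟨i, fun m => ?_, fun j k m => ?_⟩
    · have h := congrArg (fun y => y • m) (sum_e D)
      simp only [Finset.sum_smul, one_smul] at h
      rwa [Finset.sum_eq_single i (fun j _ hj => hej j hj m) (by simp)] at h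
    · by_cases hj : j = i
      · subst hj
        exact hK' _ (by rw [← mul_smul, e_mul_al]; exact hal _ _)
      · rw [← e_mul_al, mul_smul, hej j hj]
  -- or the dimension count applies at every vertex
  · exfalso
    push Not at h1 h2
    have h0 := D.eq_zero_of_sum_le (n := fun i =>
      Module.finrank ℂ (LinearMap.range (lmul (M := M) (pgen D (.e i))))) fun i => by
        refine two_mul_finrank_le i (fun m hm h => ?_) (h2 i)
        by_contra hne
        obtain ⟨j, l, hjl⟩ := h1 i m hne hm
        exact hjl (h j l)
    have := IsSimpleModule.nontrivial (PreprojAlg D) M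
    obtain ⟨m, hm⟩ := exists_ne (0 : M)
    refine hm ?_
    have h := congrArg (fun y => y • m) (sum_e D)
    simp only [Finset.sum_smul, one_smul] at h
    rw [← h]
    refine Finset.sum_eq_zero fun i _ => ?_
    have h3 : LinearMap.range (lmul (M := M) (pgen D (.e i))) = ⊥ :=
      Submodule.finrank_eq_zero.1 (congrFun h0 i)
    have h4 : pgen D (.e i) • m ∈ LinearMap.range (lmul (M := M) (pgen D (.e i))) := ⟨m, rfl⟩
    rwa [h3, Submodule.mem_bot] at h4

variable (D) in
/-- The left ideal generated by the arrows. -/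
def arrowIdeal : Ideal (PreprojAlg D) :=
  Ideal.span ({y | ∃ i j, y = pgen D (.al i j)} ∪ {y | ∃ i, y = pgen D (.ep i)})

theorem al_mem_arrowIdeal (i j : I) : pgen D (.al i j) ∈ arrowIdeal D :=
  Submodule.subset_span (Or.inl ⟨i, j, rfl⟩)

theorem ep_mem_arrowIdeal (i : I) : pgen D (.ep i) ∈ arrowIdeal D :=
  Submodule.subset_span (Or.inr ⟨i, rfl⟩)

/-- The arrows act nilpotently on a finite dimensional module on which the `ε_i` are nilpotent. -/
theorem list_prod_smul_eq_zero {M : Type*} [AddCommGroup M] [Module ℂ M]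
    [Module (PreprojAlg D) M] [IsScalarTower ℂ (PreprojAlg D) M] [Module.Finite ℂ M]
    (hnil : ∀ i, ∃ n : ℕ, ∀ m : M, pgen D (.ep i) ^ n • m = 0) (L : List (PreprojAlg D))
    (hL : ∀ y ∈ L, y ∈ arrowIdeal D) (hlen : Module.finrank ℂ M ≤ L.length) (m : M) :
    L.prod • m = 0 := by
  induction hn : Module.finrank ℂ M using Nat.strong_induction_on generalizing M L with
  | _ n ih =>
    rcases subsingleton_or_nontrivial M with hM | hM
    · exact Subsingleton.elim _ _
    have hfin : Module.Finite (PreprojAlg D) M := Module.Finite.of_restrictScalars_finite ℂ _ M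
    -- the ideal of the arrows maps `M` to a maximal submodule `K`, as it kills the simple quotient
    obtain ⟨K, hK⟩ := IsCoatomic.exists_coatom (Submodule (PreprojAlg D) M)
    have hsimple : IsSimpleModule (PreprojAlg D) (M ⧸ K) := isSimpleModule_iff_isCoatom.2 hK
    have hQ : Module.Finite ℂ (M ⧸ K) :=
      Module.Finite.of_surjective (K.mkQ.restrictScalars ℂ) K.mkQ_surjective
    have hnilQ : ∀ i, ∃ n : ℕ, ∀ m : M ⧸ K, pgen D (.ep i) ^ n • m = 0 := by
      intro i
      obtain ⟨n, hn⟩ := hnil i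
      refine ⟨n, fun m => ?_⟩
      obtain ⟨m, rfl⟩ := K.mkQ_surjective m
      rw [← map_smul, hn, map_zero]
    obtain ⟨ha, he⟩ := arrow_smul_eq_zero_of_simple hnilQ
    have hmem : ∀ y ∈ arrowIdeal D, ∀ m : M, y • m ∈ K := by
      intro y hy m
      rw [← Submodule.Quotient.mk_eq_zero, Submodule.Quotient.mk_smul]
      induction hy using Submodule.span_induction with
      | mem y hy =>
        rcases hy with ⟨i, j, rfl⟩ | ⟨i, rfl⟩
        · exact ha i j _
        · exact he i _
      | zero => rw [zero_smul]
      | add a b _ _ ha hb => rw [add_smul, ha, hb, add_zero]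
      | smul r a _ ha => rw [smul_eq_mul, mul_smul, ha, smul_zero]
    have hlt : Module.finrank ℂ K < Module.finrank ℂ M := by
      refine Submodule.finrank_lt (s := K.restrictScalars ℂ) ?_
      intro h
      exact hK.1 (by rwa [Submodule.restrictScalars_eq_top_iff] at h)
    rcases L.eq_nil_or_concat with rfl | ⟨L', y, rfl⟩
    · rw [List.length_nil] at hlen
      omega
    · have hKfin : Module.Finite ℂ K :=
        inferInstanceAs (Module.Finite ℂ (K.restrictScalars ℂ))
      rw [List.concat_eq_append] at hL hlen ⊢
      rw [List.length_append, List.length_singleton] at hlen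
      rw [List.prod_append, List.prod_singleton, mul_smul]
      have hy := hmem y (hL y (by simp)) m
      have := ih (Module.finrank ℂ K) (by omega) (M := K) (fun i => by
        obtain ⟨n, hn⟩ := hnil i
        exact ⟨n, fun m => Subtype.ext (hn m.1)⟩) L' (fun z hz => hL z (by simp [hz])) (by omega)
        ⟨y • m, hy⟩ rfl
      exact congrArg Subtype.val this

end Nilpotent

/-! ### The anti-involution of the generalized preprojective algebra -/

section Involution

open MulOpposite

/-- The involution on the generators. -/
def Gen.star : Gen I → Gen I
  | .e i => .e i
  | .al i j => .al j i
  | .ep i => .ep i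

theorem Gen.star_star (g : Gen I) : g.star.star = g := by cases g <;> rfl

/-- The anti-homomorphism from the free algebra given by the involution of the generators. -/
def starFree : FreeAlgebra ℂ (Gen I) →ₐ[ℂ] (PreprojAlg D)ᵐᵒᵖ :=
  FreeAlgebra.lift ℂ fun g => op (pgen D g.star)

@[simp]
theorem starFree_gen (g : Gen I) : starFree D (gen g) = op (pgen D g.star) :=
  FreeAlgebra.lift_ι_apply _ _

theorem starFree_rel {a b : FreeAlgebra ℂ (Gen I)} (h : Rel D a b) :
    starFree D a = starFree D b := by
  refine unop_injective ?_
  cases h with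
  | idem i => simp [Gen.star, e_mul_e]
  | orth i j h => simp [Gen.star, e_mul_e_of_ne D h.symm]
  | one => simp [Gen.star, sum_e]
  | al_ends i j => simp [Gen.star, e_mul_al, al_mul_e]
  | al_zero i j h => simp [Gen.star, al_eq_zero D fun h' => h (D.c_neg_symm h')]
  | ep_ends i => simp [Gen.star, e_mul_ep, ep_mul_e]
  | deriv_al i j h => simp [Gen.star, ep_pow_mul_al D (D.c_neg_symm h)]
  | deriv_ep i =>
    rw [map_zero, unop_zero, ← sum_ep_al_al_ep D i]
    simp only [map_sum, Finset.unop_sum, map_smul, unop_smul, map_mul, unop_mul, map_pow, unop_pow,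
      starFree_gen, Gen.star, unop_op]
    refine Finset.sum_congr rfl fun j _ => ?_
    rw [← Finset.sum_range_reflect]
    refine Finset.sum_congr rfl fun k hk => ?_
    have hk' := Finset.mem_range.1 hk
    rw [show D.m i j - 1 - (D.m i j - 1 - k) = k by omega]
    simp only [mul_assoc]

/-- The anti-involution of the generalized preprojective algebra which fixes the `e_i`, `ε_i` and
exchanges `α_{ij}` and `α_{ji}`. -/
def starHom : PreprojAlg D →ₐ[ℂ] (PreprojAlg D)ᵐᵒᵖ :=
  RingQuot.liftAlgHom ℂ ⟨starFree D, fun _ _ h => starFree_rel D h⟩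

variable {D}

theorem starHom_pgen (g : Gen I) : starHom D (pgen D g) = op (pgen D g.star) := by
  rw [starHom, pgen, RingQuot.liftAlgHom_mkAlgHom_apply, starFree_gen]

/-- The anti-involution as a linear map. -/
def pstar : PreprojAlg D →ₗ[ℂ] PreprojAlg D :=
  (opLinearEquiv ℂ).symm.toLinearMap ∘ₗ (starHom D).toLinearMap

theorem pstar_one : pstar (1 : PreprojAlg D) = 1 := by
  simp [pstar]

theorem pstar_mul (y z : PreprojAlg D) : pstar (y * z) = pstar z * pstar y := by
  simp [pstar]

theorem pstar_pgen (g : Gen I) : pstar (pgen D g) = pgen D g.star := by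
  simp [pstar, starHom_pgen]

end Involution

/-! ### The grading of the generalized preprojective algebra -/

section Grading

open AddMonoidAlgebra

/-- The coaction of the grading, from the free algebra. -/
def coactFree : FreeAlgebra ℂ (Gen I) →ₐ[ℂ] AddMonoidAlgebra (PreprojAlg D) ℤ :=
  FreeAlgebra.lift ℂ fun g => single (g.deg D) (pgen D g)

@[simp]
theorem coactFree_gen (g : Gen I) : coactFree D (gen g) = single (g.deg D) (pgen D g) :=
  FreeAlgebra.lift_ι_apply _ _

theorem coactFree_rel {a b : FreeAlgebra ℂ (Gen I)} (h : Rel D a b) :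
    coactFree D a = coactFree D b := by
  cases h with
  | idem i => simp only [map_mul, coactFree_gen, Gen.deg, single_mul_single, e_mul_e, add_zero]
  | orth i j h =>
    simp only [map_mul, coactFree_gen, single_mul_single, e_mul_e_of_ne D h, map_zero, single_zero]
  | one =>
    simp only [map_sum, coactFree_gen, Gen.deg, map_one]
    rw [one_def, ← sum_e D]
    exact (map_sum (singleAddHom (0 : ℤ)) _ _).symm
  | al_ends i j =>
    simp only [map_mul, coactFree_gen, Gen.deg, single_mul_single, e_mul_al, al_mul_e, add_zero,
      zero_add]
  | al_zero i j h => simp [Gen.deg, al_eq_zero D h]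
  | ep_ends i =>
    simp only [map_mul, coactFree_gen, Gen.deg, single_mul_single, e_mul_ep, ep_mul_e, add_zero,
      zero_add]
  | deriv_al i j h =>
    simp only [map_mul, map_pow, coactFree_gen, Gen.deg, single_mul_single, single_pow,
      ep_pow_mul_al D h]
    congr 1
    have e1 := D.m_mul_d h.le
    have e2 := D.m_mul_d (D.c_neg_symm h).le
    rw [← D.b_symm] at e2
    simp only [nsmul_eq_mul]
    linarith
  | deriv_ep i =>
    simp only [map_sum, map_smul, map_mul, map_pow, coactFree_gen, Gen.deg, single_mul_single,
      single_pow, map_zero]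
    have e : ∀ j, ∀ k ∈ Finset.range (D.m i j), (D.o i j : ℂ) •
        (single (k • (2 * (D.d i : ℤ)) + D.b i j + D.b j i + (D.m i j - 1 - k) • (2 * (D.d i : ℤ)))
          (pgen D (.ep i) ^ k * pgen D (.al i j) * pgen D (.al j i) *
            pgen D (.ep i) ^ (D.m i j - 1 - k)) : AddMonoidAlgebra (PreprojAlg D) ℤ) =
        singleAddHom (-(2 * (D.d i : ℤ))) ((D.o i j : ℂ) •
          (pgen D (.ep i) ^ k * pgen D (.al i j) * pgen D (.al j i) *
            pgen D (.ep i) ^ (D.m i j - 1 - k))) := by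
      intro j k hk
      have hk' := Finset.mem_range.1 hk
      have hc : D.c i j < 0 := by
        by_contra hc
        rw [D.m_eq_zero hc] at hk'
        omega
      have e1 := D.m_mul_d hc.le
      have e2 : ((D.m i j - 1 - k : ℕ) : ℤ) = D.m i j - 1 - k := by omega
      have e3 : k • (2 * (D.d i : ℤ)) + D.b i j + D.b j i + (D.m i j - 1 - k) • (2 * (D.d i : ℤ))
          = -(2 * (D.d i : ℤ)) := by
        rw [nsmul_eq_mul, nsmul_eq_mul, e2, D.b_symm j i]; linarith
      rw [e3, singleAddHom_apply, smul_single]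
    rw [Finset.sum_congr rfl fun j _ => Finset.sum_congr rfl (e j)]
    simp only [← map_sum]
    rw [sum_ep_al_al_ep, map_zero]

/-- The coaction of the grading: an element of degree `n` is sent to its multiple by the `n`-th
power of the variable. -/
def coact : PreprojAlg D →ₐ[ℂ] AddMonoidAlgebra (PreprojAlg D) ℤ :=
  RingQuot.liftAlgHom ℂ ⟨coactFree D, fun _ _ h => coactFree_rel D h⟩

theorem coact_pgen (g : Gen I) : coact D (pgen D g) = single (g.deg D) (pgen D g) := by
  rw [coact, pgen, RingQuot.liftAlgHom_mkAlgHom_apply, coactFree_gen]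
  rfl

/-- The projection to the homogeneous part of degree `n`. -/
def projDeg (n : ℤ) : PreprojAlg D →ₗ[ℂ] PreprojAlg D where
  toFun y := (coact D y).coeff n
  map_add' y z := by simp
  map_smul' r y := by simp

variable {D}

theorem projDeg_gen_mul (g : Gen I) (n : ℤ) (y : PreprojAlg D) :
    projDeg D n (pgen D g * y) = pgen D g * projDeg D (n - g.deg D) y := by
  simp only [projDeg, LinearMap.coe_mk, AddHom.coe_mk, map_mul, coact_pgen, coeff_single_mul_apply]
  rw [neg_add_eq_sub]

theorem projDeg_one (n : ℤ) : projDeg D n 1 = if n = 0 then 1 else 0 := by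
  simp only [projDeg, LinearMap.coe_mk, AddHom.coe_mk, map_one, one_def, coeff_single, Finsupp.single_apply,
    eq_comm]

theorem projDeg_of_mem_grade {n : ℤ} {y : PreprojAlg D} (hy : y ∈ grade D n) (k : ℤ) :
    projDeg D k y = if k = n then y else 0 := by
  induction hy using Submodule.span_induction with
  | mem y hy =>
    obtain ⟨L, hL, rfl⟩ := hy
    induction L generalizing n k with
    | nil =>
      rw [List.map_nil, List.sum_nil] at hL
      rw [List.map_nil, List.prod_nil, projDeg_one, ← hL]
    | cons g L ih =>
      rw [List.map_cons, List.sum_cons] at hL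
      rw [List.map_cons, List.prod_cons, projDeg_gen_mul, ih _ rfl, ← hL]
      by_cases h : k = g.deg D + (L.map (Gen.deg D)).sum
      · rw [if_pos h, if_pos (by rw [h]; ring)]
      · rw [if_neg h, if_neg (fun h' => h (by rw [← h']; ring)), mul_zero]
  | zero => simp
  | add a b _ _ ha hb => rw [map_add, ha, hb]; split_ifs <;> simp
  | smul r a _ ha => rw [map_smul, ha]; split_ifs <;> simp

theorem projDeg_mem_grade (n : ℤ) (y : PreprojAlg D) : projDeg D n y ∈ grade D n := by
  let N : Submodule ℂ (PreprojAlg D) := ⨅ n, (grade D n).comap (projDeg D n)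
  have : y ∈ N := by
    refine mem_of_gen_mul_mem D ?_ ?_ y
    · refine (Submodule.mem_iInf _).2 fun n => Submodule.mem_comap.2 ?_
      rw [projDeg_one]
      split_ifs with h
      · exact Submodule.subset_span ⟨[], by simp [h], by simp⟩
      · exact zero_mem _
    · intro g y hy
      refine (Submodule.mem_iInf _).2 fun n => Submodule.mem_comap.2 ?_
      rw [projDeg_gen_mul]
      have h := gen_mul_mem_grade D g ((Submodule.mem_iInf _).1 hy (n - g.deg D))
      rwa [add_sub_cancel] at h
  exact (Submodule.mem_iInf _).1 this n

theorem mul_e_mem_grade {n : ℤ} {y : PreprojAlg D} (hy : y ∈ grade D n) (i : I) :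
    y * pgen D (.e i) ∈ grade D n := by
  induction hy using Submodule.span_induction with
  | mem y hy =>
    obtain ⟨L, hL, rfl⟩ := hy
    exact Submodule.subset_span ⟨L ++ [.e i], by simp [hL, Gen.deg], by simp⟩
  | zero => rw [zero_mul]; exact zero_mem _
  | add a b _ _ ha hb => rw [add_mul]; exact add_mem ha hb
  | smul r a _ ha => rw [smul_mul_assoc]; exact Submodule.smul_mem _ r ha

variable (D) in
/-- The projection to the homogeneous part of degree `n` of `e_j Π e_i`. -/
def pieceProj (j i : I) (n : ℤ) : PreprojAlg D →ₗ[ℂ] piece D j i n :=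
  (LinearMap.mulLeft ℂ (pgen D (.e j)) ∘ₗ LinearMap.mulRight ℂ (pgen D (.e i)) ∘ₗ
    projDeg D n).codRestrict _ fun y => by
      refine mem_piece.2 ⟨?_, ?_, ?_⟩
      · have h := gen_mul_mem_grade D (.e j) (mul_e_mem_grade (projDeg_mem_grade n y) i)
        rwa [Gen.deg, zero_add] at h
      · simp only [LinearMap.comp_apply, LinearMap.mulLeft_apply]
        rw [← mul_assoc, e_mul_e]
      · simp only [LinearMap.comp_apply, LinearMap.mulLeft_apply, LinearMap.mulRight_apply]
        rw [mul_assoc, mul_assoc, e_mul_e]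

theorem coe_pieceProj (j i : I) (n : ℤ) (y : PreprojAlg D) :
    (pieceProj D j i n y : PreprojAlg D) =
      pgen D (.e j) * (projDeg D n y * pgen D (.e i)) := rfl

theorem pieceProj_of_mem {j i : I} {n : ℤ} (z : piece D j i n) : pieceProj D j i n z = z := by
  obtain ⟨h1, h2, h3⟩ := mem_piece.1 z.2
  refine Subtype.ext ?_
  rw [coe_pieceProj, projDeg_of_mem_grade h1, if_pos rfl, h3, h2]

theorem pieceProj_of_mem_of_ne {j i j' : I} {n n' : ℤ} (z : piece D j i n)
    (h : (j', n') ≠ (j, n)) : pieceProj D j' i n' z = 0 := by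
  obtain ⟨h1, h2, h3⟩ := mem_piece.1 z.2
  refine Subtype.ext ?_
  rw [coe_pieceProj, projDeg_of_mem_grade h1, Submodule.coe_zero]
  by_cases hn : n' = n
  · have hj : j' ≠ j := fun hj => h (by rw [hj, hn])
    rw [if_pos hn, h3, ← h2, ← mul_assoc, e_mul_e_of_ne D hj, zero_mul]
  · rw [if_neg hn, zero_mul, mul_zero]

theorem pieceProj_gen_mul (j i : I) (n : ℤ) (g : Gen I) (y : PreprojAlg D) :
    (pieceProj D j i n (pgen D g * y) : PreprojAlg D) =
      pgen D (.e j) * pgen D g * (projDeg D (n - g.deg D) y * pgen D (.e i)) := by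
  rw [coe_pieceProj, projDeg_gen_mul, mul_assoc, mul_assoc]

end Grading

/-! ### Modules over the generalized preprojective algebra -/

section PiRep

variable {D}
variable {V : I × ℤ → Type*} [∀ s, AddCommGroup (V s)] [∀ s, Module ℂ (V s)]

/-- A representation of the triple quiver which satisfies the relations gives an action of the
generalized preprojective algebra on its total space. -/
def piRep (x : TripleRep D V) (hx : ∀ a b, Rel D a b → freeRep x a = freeRep x b) :
    PreprojAlg D →ₐ[ℂ] Module.End ℂ (⨁ s, V s) :=
  RingQuot.liftAlgHom ℂ ⟨freeRep x, fun _ _ h => hx _ _ h⟩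

theorem piRep_pgen (x : TripleRep D V) (hx : ∀ a b, Rel D a b → freeRep x a = freeRep x b)
    (g : Gen I) : piRep x hx (pgen D g) = genTot x g := by
  rw [piRep, pgen, RingQuot.liftAlgHom_mkAlgHom_apply, freeRep_gen]

end PiRep

variable {D}

/-! ### Nilpotency on finite dimensional graded spaces -/

section StdNilpotent

variable {v : DimVec I}

instance finite_total_std : Module.Finite ℂ (⨁ s, Std v s) := by
  let f : (⨁ s, Std v s) →ₗ[ℂ] (∀ s : v.support, Std v s.1) :=
    LinearMap.pi fun s => DirectSum.component ℂ (I × ℤ) (Std v) s.1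
  refine Module.Finite.of_injective f fun w w' h => DFinsupp.ext fun s => ?_
  by_cases hs : s ∈ v.support
  · exact congrFun h ⟨s, hs⟩
  · have h0 : v s = 0 := Finsupp.notMem_support_iff.1 hs
    have : IsEmpty (Fin (v s)) := by rw [h0]; infer_instance
    exact Subsingleton.elim (α := Std v s) _ _

theorem epsTot_pow_eq_zero (x : TripleRep D (Std v)) (i : I) : ∃ n, epsTot x i ^ n = 0 := by
  obtain ⟨B, hB⟩ : ∃ B : ℕ, ∀ s ∈ v.support, s.2.natAbs ≤ B :=
    ⟨v.support.sup fun s => s.2.natAbs, fun s hs => Finset.le_sup (f := fun s => s.2.natAbs) hs⟩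
  have hsub : ∀ s : I × ℤ, ¬ s.2.natAbs ≤ B → ∀ m : Std v s, m = 0 := by
    intro s hs m
    have h0 : v s = 0 := Finsupp.notMem_support_iff.1 fun h => hs (hB s h)
    have : IsEmpty (Fin (v s)) := by rw [h0]; infer_instance
    exact Subsingleton.elim (α := Std v s) _ _
  refine ⟨2 * B + 1, DirectSum.linearMap_ext ℂ fun s => LinearMap.ext fun m => ?_⟩
  rw [LinearMap.comp_apply, LinearMap.comp_apply, LinearMap.zero_apply]
  by_cases hs : s.2.natAbs ≤ B
  · refine DFinsupp.ext fun t => ?_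
    by_cases ht : t.2 = s.2 + ((2 * B + 1 : ℕ) : ℤ) * (2 * (D.d i : ℤ))
    · refine hsub t (fun h => ?_) _
      have hd := D.d_pos i
      have h1 : ((2 * B + 1 : ℕ) : ℤ) * 2 ≤ ((2 * B + 1 : ℕ) : ℤ) * (2 * (D.d i : ℤ)) :=
        mul_le_mul_of_nonneg_left (by omega) (by positivity)
      omega
    · refine (isHomog_epsTot x i).pow (2 * B + 1) s.2 _ (fun t' ht' => lof_apply_of_ne ?_ m) t ht
      rintro rfl
      exact ht' rfl
  · rw [hsub s hs m, map_zero, map_zero]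

/-- Products of sufficiently many elements of the ideal of the arrows act by zero. -/
theorem piRep_list_prod (x : TripleRep D (Std v))
    (hx : ∀ a b, Rel D a b → freeRep x a = freeRep x b) (L : List (PreprojAlg D))
    (hL : ∀ y ∈ L, y ∈ arrowIdeal D)
    (hlen : Module.finrank ℂ (⨁ s, Std v s) ≤ L.length) : piRep x hx L.prod = 0 := by
  let _ : Module (PreprojAlg D) (⨁ s, Std v s) := Module.compHom _ (piRep x hx).toRingHom
  have hsmul : ∀ (y : PreprojAlg D) (w : ⨁ s, Std v s), y • w = piRep x hx y w := fun _ _ => rfl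
  have : IsScalarTower ℂ (PreprojAlg D) (⨁ s, Std v s) := ⟨fun r y w => by
    rw [hsmul, hsmul, map_smul, LinearMap.smul_apply]⟩
  refine LinearMap.ext fun w => ?_
  rw [LinearMap.zero_apply, ← hsmul]
  refine list_prod_smul_eq_zero (fun i => ?_) L hL hlen w
  obtain ⟨n, hn⟩ := epsTot_pow_eq_zero x i
  refine ⟨n, fun m => ?_⟩
  rw [hsmul, map_pow, piRep_pgen]
  exact LinearMap.congr_fun hn m

theorem CartanDatum.texp_pos (i : I) : 0 < D.texp i :=
  Nat.div_pos (Nat.le_of_dvd (lt_of_lt_of_le one_pos (le_max_left _ _)) (D.d_dvd i)) (D.d_pos i)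

theorem omega_mem_arrowIdeal : omega D ∈ arrowIdeal D := by
  refine Ideal.sum_mem _ fun i _ => ?_
  obtain ⟨n, hn⟩ := Nat.exists_eq_succ_of_ne_zero (D.texp_pos i).ne'
  rw [hn, pow_succ]
  exact Ideal.mul_mem_left _ _ (ep_mem_arrowIdeal i)

theorem pstar_pow (y : PreprojAlg D) (n : ℕ) : pstar (y ^ n) = pstar y ^ n := by
  induction n with
  | zero => rw [pow_zero, pow_zero, pstar_one]
  | succ n ih => rw [pow_succ, pstar_mul, ih, pow_succ']

theorem pstar_omega : pstar (omega D) = omega D := by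
  simp only [omega, map_sum, pstar_pow, pstar_pgen, Gen.star]

theorem piRep_omega_pow (x : TripleRep D (Std v))
    (hx : ∀ a b, Rel D a b → freeRep x a = freeRep x b) :
    piRep x hx (omega D ^ Module.finrank ℂ (⨁ s, Std v s)) = 0 := by
  have h := piRep_list_prod x hx (List.replicate (Module.finrank ℂ (⨁ s, Std v s)) (omega D))
    (fun y hy => by rw [List.eq_of_mem_replicate hy]; exact omega_mem_arrowIdeal) (by simp)
  rwa [List.prod_replicate] at h

end StdNilpotent

/-! ### Morphisms to the injective type modules -/

section Pairing

variable {ι : Type*} {q : ι → I × ℤ}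
variable {V : I × ℤ → Type*} [∀ s, AddCommGroup (V s)] [∀ s, Module ℂ (V s)]
variable {W : I × ℤ → Type*} [∀ s, AddCommGroup (W s)] [∀ s, Module ℂ (W s)]

/-- A graded map to `I_W` commuting with all the arrows. -/
structure IsMor (x : TripleRep D V) (f : ∀ s, V s →ₗ[ℂ] InjW D q s) : Prop where
  al : ∀ p m, f p.1.2 (x.1 p m) = (injW D q).1 p (f p.1.1 m)
  ep : ∀ p m, f p.1.2 (x.2 p m) = (injW D q).2 p (f p.1.1 m)

/-- A morphism to `I_W` which is compatible with the framings. -/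
structure IsFramedMor (β : ∀ s, Module.Basis {r : ι // q r = s} ℂ (W s)) (x : FramedRep D V W)
    (f : ∀ s, V s →ₗ[ℂ] InjW D q s) : Prop extends IsMor x.1 f where
  frame : ∀ p m (r : ι) (hr : q r = p.1.2),
    (β p.1.2).repr (x.2 p m) ⟨r, hr⟩ = evalAt D q p.2 hr (f p.1.1 m)

theorem IsMor.apply_al {x : TripleRep D V} {f : ∀ s, V s →ₗ[ℂ] InjW D q s} (h : IsMor x f)
    {s t : I × ℤ} (hst : AlphaArrow D s t) (m : V s) :
    f t (x.1 ⟨(s, t), hst⟩ m) = (injW D q).1 ⟨(s, t), hst⟩ (f s m) := h.al ⟨(s, t), hst⟩ m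

theorem IsMor.apply_ep {x : TripleRep D V} {f : ∀ s, V s →ₗ[ℂ] InjW D q s} (h : IsMor x f)
    {s t : I × ℤ} (hst : EpsArrow D s t) (m : V s) :
    f t (x.2 ⟨(s, t), hst⟩ m) = (injW D q).2 ⟨(s, t), hst⟩ (f s m) := h.ep ⟨(s, t), hst⟩ m

theorem IsFramedMor.apply_frame {β : ∀ s, Module.Basis {r : ι // q r = s} ℂ (W s)}
    {x : FramedRep D V W} {f : ∀ s, V s →ₗ[ℂ] InjW D q s} (h : IsFramedMor β x f) {s : I × ℤ}
    {r : ι} (hs : FrameArrow D s (q r)) (m : V s) :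
    (β (q r)).repr (x.2 ⟨(s, q r), hs⟩ m) ⟨r, rfl⟩ = evalAt D q hs rfl (f s m) :=
  h.frame ⟨(s, q r), hs⟩ m r rfl

/-- The `r`-th component of a graded map to `I_W`, as a map to the linear forms on the whole algebra,
where forms on a homogeneous part are extended by zero to the other ones. -/
def toPairing (f : ∀ s, V s →ₗ[ℂ] InjW D q s) (r : ι) :
    (⨁ s, V s) →ₗ[ℂ] Module.Dual ℂ (PreprojAlg D) :=
  DirectSum.toModule ℂ (I × ℤ) _ fun s =>
    Module.Dual.transpose (pieceProj D s.1 (q r).1 ((q r).2 + D.d (q r).1 - s.2)) ∘ₗ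
      (injComp D (q r).1 ((q r).2 + D.d (q r).1) s).subtype ∘ₗ LinearMap.proj r ∘ₗ f s

theorem toPairing_lof (f : ∀ s, V s →ₗ[ℂ] InjW D q s) (r : ι) (s : I × ℤ) (m : V s)
    (y : PreprojAlg D) : toPairing f r (DirectSum.lof ℂ (I × ℤ) V s m) y =
      (f s m r).1 (pieceProj D s.1 (q r).1 ((q r).2 + D.d (q r).1 - s.2) y) := by
  rw [toPairing, DirectSum.toModule_lof]
  rfl

theorem toPairing_lof_coe (f : ∀ s, V s →ₗ[ℂ] InjW D q s) (r : ι) (s : I × ℤ) (m : V s)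
    (z : piece D s.1 (q r).1 ((q r).2 + D.d (q r).1 - s.2)) :
    toPairing f r (DirectSum.lof ℂ (I × ℤ) V s m) z = (f s m r).1 z := by
  rw [toPairing_lof, pieceProj_of_mem]

theorem toPairing_coe (f : ∀ s, V s →ₗ[ℂ] InjW D q s) (r : ι) (s : I × ℤ) (w : ⨁ s, V s)
    (z : piece D s.1 (q r).1 ((q r).2 + D.d (q r).1 - s.2)) :
    toPairing f r w z = (f s (w s) r).1 z := by
  induction w using DirectSum.induction_on with
  | zero => simp
  | of t m =>
    change toPairing f r (DirectSum.lof ℂ (I × ℤ) V t m) z =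
      (f s (DirectSum.lof ℂ (I × ℤ) V t m s) r).1 z
    by_cases h : t = s
    · subst h
      rw [toPairing_lof_coe, DirectSum.lof_apply]
    · rw [lof_apply_of_ne h, toPairing_lof, pieceProj_of_mem_of_ne]
      · simp
      · intro h'
        have h1 := congrArg Prod.fst h'
        have h2 := congrArg Prod.snd h'
        simp only at h1 h2
        exact h (Prod.ext h1 (by linarith))
  | add w w' h h' =>
    rw [map_add, LinearMap.add_apply, h, h', DirectSum.add_apply, map_add]
    rfl

theorem eq_zero_of_toPairing {f : ∀ s, V s →ₗ[ℂ] InjW D q s}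
    (hf : ∀ s, Function.Injective (f s)) {w : ⨁ s, V s} (h : ∀ r, toPairing f r w = 0) : w = 0 := by
  refine DFinsupp.ext fun s => hf s ?_
  rw [DirectSum.zero_apply, map_zero]
  funext r
  refine Subtype.ext (LinearMap.ext fun z => ?_)
  rw [← toPairing_coe, h r]
  rfl

theorem IsMor.toPairing_gen {x : TripleRep D V} {f : ∀ s, V s →ₗ[ℂ] InjW D q s} (h : IsMor x f)
    (r : ι) (g : Gen I) (w : ⨁ s, V s) (y : PreprojAlg D) :
    toPairing f r (genTot x g w) y = toPairing f r w (pgen D g.star * y) := by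
  induction w using DirectSum.induction_on with
  | zero => simp
  | add w w' h h' => rw [map_add, map_add, map_add, LinearMap.add_apply, LinearMap.add_apply, h, h']
  | of s m =>
    change toPairing f r (genTot x g (DirectSum.lof ℂ (I × ℤ) V s m)) y =
      toPairing f r (DirectSum.lof ℂ (I × ℤ) V s m) (pgen D g.star * y)
    have hzero : pgen D (.e s.1) * pgen D g.star = 0 →
        toPairing f r (DirectSum.lof ℂ (I × ℤ) V s m) (pgen D g.star * y) = 0 := by
      intro h0
      have : pieceProj D s.1 (q r).1 ((q r).2 + D.d (q r).1 - s.2) (pgen D g.star * y) = 0 :=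
        Subtype.ext (by rw [pieceProj_gen_mul, h0, zero_mul, Submodule.coe_zero])
      rw [toPairing_lof, this, map_zero]
    cases g with
    | e i =>
      rw [genTot, vertexTot_lof]
      split_ifs with hi
      · subst hi
        rw [toPairing_lof, toPairing_lof]
        congr 1
        refine Subtype.ext ?_
        rw [pieceProj_gen_mul, Gen.star, e_mul_e, coe_pieceProj, Gen.deg, sub_zero]
      · rw [map_zero, hzero (e_mul_e_of_ne D hi)]
        rfl
    | al i j =>
      by_cases hj : s.1 = j
      · subst hj
        by_cases hc : D.c i s.1 < 0
        · have harr : AlphaArrow D s (i, s.2 + D.b i s.1) := ⟨hc, rfl⟩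
          rw [genTot, alphaTot_lof x harr, toPairing_lof, toPairing_lof, h.apply_al harr]
          change (f s m r).1 (pieceAlpha D _ _ _ _ harr _) = _
          congr 1
          refine Subtype.ext ?_
          rw [pieceProj_gen_mul, coe_pieceAlpha, coe_pieceProj, Gen.star, e_mul_al, ← mul_assoc,
            al_mul_e, Gen.deg, D.b_symm, sub_sub]
        · rw [genTot, alphaTot_eq_zero x hc, LinearMap.zero_apply, map_zero, hzero]
          · rfl
          · rw [Gen.star, al_eq_zero D (fun h => hc (D.c_neg_symm h)), mul_zero]
      · rw [genTot, alphaTot_lof_of_ne x hj, map_zero, hzero]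
        · rfl
        · rw [Gen.star, ← e_mul_al, ← mul_assoc, e_mul_e_of_ne D hj, zero_mul]
    | ep i =>
      by_cases hi : s.1 = i
      · subst hi
        have harr : EpsArrow D s (s.1, s.2 + 2 * (D.d s.1 : ℤ)) := ⟨rfl, rfl⟩
        rw [genTot, epsTot_lof (s := s) x harr, toPairing_lof, toPairing_lof, h.apply_ep harr]
        change (f s m r).1 (pieceEps D _ _ _ _ harr _) = _
        congr 1
        refine Subtype.ext ?_
        rw [pieceProj_gen_mul, coe_pieceEps, coe_pieceProj, Gen.star, e_mul_ep, ← mul_assoc,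
          ep_mul_e, Gen.deg, sub_sub]
      · rw [genTot, epsTot_lof_of_ne x hi, map_zero, hzero]
        · rfl
        · rw [Gen.star, ← e_mul_ep, ← mul_assoc, e_mul_e_of_ne D hi, zero_mul]

theorem IsMor.toPairing_freeRep {x : TripleRep D V} {f : ∀ s, V s →ₗ[ℂ] InjW D q s}
    (h : IsMor x f) (r : ι) (a : FreeAlgebra ℂ (Gen I)) (w : ⨁ s, V s) (y : PreprojAlg D) :
    toPairing f r (freeRep x a w) y = toPairing f r w ((starFree D a).unop * y) := by
  induction a using FreeAlgebra.induction generalizing w y with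
  | grade0 c =>
    rw [AlgHom.commutes, AlgHom.commutes, Module.algebraMap_end_apply, map_smul,
      LinearMap.smul_apply, MulOpposite.algebraMap_apply, MulOpposite.unop_op, ← Algebra.smul_def,
      map_smul]
  | grade1 g =>
    have h1 := freeRep_gen x g
    have h2 := starFree_gen D g
    rw [gen] at h1 h2
    rw [h1, h2, h.toPairing_gen, MulOpposite.unop_op]
  | mul a b ha hb =>
    rw [map_mul, Module.End.mul_apply, ha, hb, map_mul (starFree D), MulOpposite.unop_mul, mul_assoc]
  | add a b ha hb =>
    rw [map_add, LinearMap.add_apply, map_add, LinearMap.add_apply, ha, hb, map_add,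
      MulOpposite.unop_add, add_mul, map_add]

/-- A submodule of `I_W` satisfies the relations, because the algebra does. -/
theorem IsMor.freeRep_rel {x : TripleRep D V} {f : ∀ s, V s →ₗ[ℂ] InjW D q s} (h : IsMor x f)
    (hf : ∀ s, Function.Injective (f s)) (a b : FreeAlgebra ℂ (Gen I)) (hab : Rel D a b) :
    freeRep x a = freeRep x b := by
  refine LinearMap.ext fun w => sub_eq_zero.1 (eq_zero_of_toPairing hf fun r => ?_)
  refine LinearMap.ext fun y => ?_
  rw [map_sub, LinearMap.sub_apply, h.toPairing_freeRep, h.toPairing_freeRep, starFree_rel D hab,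
    sub_self, LinearMap.zero_apply]

variable (β : ∀ s, Module.Basis {r : ι // q r = s} ℂ (W s))

open Classical in
/-- The `r`-th coordinate of the framing, as a linear form on the total space. -/
def frameForm (x : FramedRep D V W) (r : ι) : (⨁ s, V s) →ₗ[ℂ] ℂ :=
  DirectSum.toModule ℂ (I × ℤ) ℂ fun s =>
    if h : FrameArrow D s (q r) then (β (q r)).coord ⟨r, rfl⟩ ∘ₗ x.2 ⟨(s, q r), h⟩ else 0

theorem frameForm_lof (x : FramedRep D V W) {r : ι} {s : I × ℤ} (h : FrameArrow D s (q r))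
    (m : V s) : frameForm β x r (DirectSum.lof ℂ (I × ℤ) V s m) =
      (β (q r)).repr (x.2 ⟨(s, q r), h⟩ m) ⟨r, rfl⟩ := by
  rw [frameForm, DirectSum.toModule_lof, dif_pos h]
  rfl

theorem frameForm_lof_of_not (x : FramedRep D V W) {r : ι} {s : I × ℤ}
    (h : ¬ FrameArrow D s (q r)) (m : V s) :
    frameForm β x r (DirectSum.lof ℂ (I × ℤ) V s m) = 0 := by
  rw [frameForm, DirectSum.toModule_lof, dif_neg h, LinearMap.zero_apply]

variable {β}

theorem IsFramedMor.toPairing_one {x : FramedRep D V W} {f : ∀ s, V s →ₗ[ℂ] InjW D q s}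
    (h : IsFramedMor β x f) (r : ι) (w : ⨁ s, V s) :
    toPairing f r w 1 = frameForm β x r w := by
  induction w using DirectSum.induction_on with
  | zero => simp
  | add w w' h h' => rw [map_add, LinearMap.add_apply, h, h', map_add]
  | of s m =>
    change toPairing f r (DirectSum.lof ℂ (I × ℤ) V s m) 1 =
      frameForm β x r (DirectSum.lof ℂ (I × ℤ) V s m)
    rw [toPairing_lof]
    by_cases hs : FrameArrow D s (q r)
    · rw [frameForm_lof β x hs, h.apply_frame hs]
      change _ = (f s m r).1 _
      congr 1
      refine Subtype.ext ?_
      have h1 : (q r).1 = s.1 := hs.1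
      have h2 : (q r).2 = s.2 - D.d s.1 := hs.2
      have h3 : pgen D (.e s.1) * pgen D (.e (q r).1) = pgen D (.e (q r).1) := by
        rw [h1, e_mul_e]
      rw [coe_pieceProj, projDeg_one, if_pos (by rw [h1, h2]; ring), one_mul]
      exact h3
    · rw [frameForm_lof_of_not β x hs]
      have : pieceProj D s.1 (q r).1 ((q r).2 + D.d (q r).1 - s.2) 1 = 0 := by
        refine Subtype.ext ?_
        rw [coe_pieceProj, projDeg_one, Submodule.coe_zero]
        by_cases h1 : (q r).1 = s.1
        · rw [if_neg, zero_mul, mul_zero]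
          intro h2
          exact hs ⟨h1, by rw [h1] at h2; linarith⟩
        · split_ifs
          · rw [one_mul, e_mul_e_of_ne D (Ne.symm h1)]
          · rw [zero_mul, mul_zero]
      rw [this, map_zero]

/-- A framed morphism to `I_W` is determined by the framed representation. -/
theorem IsFramedMor.unique {x : FramedRep D V W} {f f' : ∀ s, V s →ₗ[ℂ] InjW D q s}
    (h : IsFramedMor β x f) (h' : IsFramedMor β x f') : f = f' := by
  have key : ∀ r (y : PreprojAlg D) w, toPairing f r w y = toPairing f' r w y := by
    intro r y
    let N : Submodule ℂ (PreprojAlg D) :=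
      ⨅ w, LinearMap.ker (toPairing f r w - toPairing f' r w)
    have hN : ∀ {y}, y ∈ N ↔ ∀ w, toPairing f r w y = toPairing f' r w y := by
      intro y
      simp only [N, Submodule.mem_iInf, LinearMap.mem_ker, LinearMap.sub_apply, sub_eq_zero]
    refine hN.1 (mem_of_gen_mul_mem D (hN.2 fun w => ?_) (fun g y hy => hN.2 fun w => ?_) y)
    · rw [h.toPairing_one, h'.toPairing_one]
    · rw [← g.star_star, ← h.toPairing_gen, ← h'.toPairing_gen]
      exact hN.1 hy _
  funext s
  refine LinearMap.ext fun m => funext fun r => Subtype.ext (LinearMap.ext fun z => ?_)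
  rw [← toPairing_lof_coe, ← toPairing_lof_coe, key]

/-- A submodule of `I_W` with its restricted framing is stable. -/
theorem IsFramedMor.stable {x : FramedRep D V W} {f : ∀ s, V s →ₗ[ℂ] InjW D q s}
    (h : IsFramedMor β x f) (hf : ∀ s, Function.Injective (f s)) : Stable x := by
  intro U hU hker
  let T : Submodule ℂ (⨁ s, V s) := ⨆ s, (U s).map (DirectSum.lof ℂ (I × ℤ) V s)
  have hlof : ∀ s, ∀ m ∈ U s, DirectSum.lof ℂ (I × ℤ) V s m ∈ T := fun s m hm =>
    Submodule.mem_iSup_of_mem s (Submodule.mem_map_of_mem hm)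
  have hT : ∀ g, T ≤ T.comap (genTot x.1 g) := by
    intro g
    refine iSup_le fun s => ?_
    rintro _ ⟨m, hm, rfl⟩
    rw [Submodule.mem_comap]
    cases g with
    | e i =>
      rw [genTot, vertexTot_lof]
      split_ifs
      · exact hlof s m hm
      · exact zero_mem _
    | al i j =>
      by_cases hj : s.1 = j
      · subst hj
        by_cases hc : D.c i s.1 < 0
        · have harr : AlphaArrow D s (i, s.2 + D.b i s.1) := ⟨hc, rfl⟩
          rw [genTot, alphaTot_lof x.1 harr]
          exact hlof _ _ (hU.1 ⟨(s, (i, s.2 + D.b i s.1)), harr⟩ hm)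
        · rw [genTot, alphaTot_eq_zero x.1 hc, LinearMap.zero_apply]; exact zero_mem _
      · rw [genTot, alphaTot_lof_of_ne x.1 hj]; exact zero_mem _
    | ep i =>
      by_cases hi : s.1 = i
      · subst hi
        have harr : EpsArrow D s (s.1, s.2 + 2 * (D.d s.1 : ℤ)) := ⟨rfl, rfl⟩
        rw [genTot, epsTot_lof (s := s) x.1 harr]
        exact hlof _ _ (hU.2 ⟨(s, (s.1, s.2 + 2 * (D.d s.1 : ℤ))), harr⟩ hm)
      · rw [genTot, epsTot_lof_of_ne x.1 hi]; exact zero_mem _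
  have hone : ∀ r, T ≤ LinearMap.ker (frameForm β x r) := by
    intro r
    refine iSup_le fun s => ?_
    rintro _ ⟨m, hm, rfl⟩
    rw [LinearMap.mem_ker]
    by_cases hs : FrameArrow D s (q r)
    · have h0 : x.2 ⟨(s, q r), hs⟩ m = 0 := hker ⟨(s, q r), hs⟩ hm
      rw [frameForm_lof β x hs, h0, map_zero]
      rfl
    · rw [frameForm_lof_of_not β x hs]
  have key : ∀ r (y : PreprojAlg D), ∀ w ∈ T, toPairing f r w y = 0 := by
    intro r y
    let N : Submodule ℂ (PreprojAlg D) := ⨅ w : T, LinearMap.ker (toPairing f r w.1)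
    have hN : ∀ {y}, y ∈ N ↔ ∀ w ∈ T, toPairing f r w y = 0 := by
      intro y
      simp only [N, Submodule.mem_iInf, LinearMap.mem_ker, Subtype.forall]
    refine hN.1 (mem_of_gen_mul_mem D (hN.2 fun w hw => ?_) (fun g y hy => hN.2 fun w hw => ?_) y)
    · rw [h.toPairing_one]
      exact hone r hw
    · rw [← g.star_star, ← h.toPairing_gen]
      exact hN.1 hy _ (hT _ hw)
  intro s
  refine (Submodule.eq_bot_iff _).2 fun m hm => ?_
  have h0 := eq_zero_of_toPairing hf fun r =>
    LinearMap.ext fun y => key r y _ (hlof s m hm)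
  have h1 := congrArg (fun w : ⨁ s, V s => w s) h0
  simpa only [DirectSum.lof_apply, DirectSum.zero_apply] using h1

/-- A framed morphism from a stable representation is injective. -/
theorem IsFramedMor.injective {x : FramedRep D V W} {f : ∀ s, V s →ₗ[ℂ] InjW D q s}
    (h : IsFramedMor β x f) (hx : Stable x) (s : I × ℤ) : Function.Injective (f s) := by
  refine LinearMap.ker_eq_bot.1 (hx (fun s => LinearMap.ker (f s)) ⟨?_, ?_⟩ ?_ s)
  · intro p m hm
    rw [Submodule.mem_comap, LinearMap.mem_ker, h.al, LinearMap.mem_ker.1 hm, map_zero]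
  · intro p m hm
    rw [Submodule.mem_comap, LinearMap.mem_ker, h.ep, LinearMap.mem_ker.1 hm, map_zero]
  · intro p m hm
    rw [LinearMap.mem_ker]
    refine (β p.1.2).repr.map_eq_zero_iff.1 (Finsupp.ext fun r => ?_)
    rw [h.frame p m r.1 r.2, LinearMap.mem_ker.1 hm]
    rfl

theorem IsMor.isSubrep_range {x : TripleRep D V} {f : ∀ s, V s →ₗ[ℂ] InjW D q s}
    (h : IsMor x f) : IsSubrep (injW D q) fun s => LinearMap.range (f s) := by
  constructor
  · rintro p _ ⟨m, rfl⟩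
    exact ⟨x.1 p m, h.al p m⟩
  · rintro p _ ⟨m, rfl⟩
    exact ⟨x.2 p m, h.ep p m⟩

/-- The framed representation is determined by an injective framed morphism to `I_W`. -/
theorem IsFramedMor.unique_left {x x' : FramedRep D V W} {f : ∀ s, V s →ₗ[ℂ] InjW D q s}
    (hf : ∀ s, Function.Injective (f s)) (h : IsFramedMor β x f) (h' : IsFramedMor β x' f) :
    x = x' := by
  refine Prod.ext (Prod.ext ?_ ?_) ?_ <;> funext p <;> refine LinearMap.ext fun m => ?_
  · exact hf _ (by rw [h.al, h'.al])
  · exact hf _ (by rw [h.ep, h'.ep])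
  · refine (β p.1.2).repr.injective (Finsupp.ext fun r => ?_)
    rw [h.frame p m r.1 r.2, h'.frame p m r.1 r.2]

theorem IsFramedMor.act {x : FramedRep D V W} {f : ∀ s, V s →ₗ[ℂ] InjW D q s}
    (h : IsFramedMor β x f) (g : ∀ s, V s ≃ₗ[ℂ] V s) :
    IsFramedMor β (act g x) fun s => f s ∘ₗ (g s).symm.toLinearMap where
  al p m := by simp [GradedTriple.act, h.al]
  ep p m := by simp [GradedTriple.act, h.ep]
  frame p m r hr := by
    simpa [GradedTriple.act] using h.frame p ((g p.1.1).symm m) r hr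

end Pairing

/-! ### The morphism to the injective type module of a critical point -/

section CritFrame

variable {ι : Type*} {q : ι → I × ℤ} {v : DimVec I}
variable {V : I × ℤ → Type*} [∀ s, AddCommGroup (V s)] [∀ s, Module ℂ (V s)]
variable {W : I × ℤ → Type*} [∀ s, AddCommGroup (W s)] [∀ s, Module ℂ (W s)]
variable (β : ∀ s, Module.Basis {r : ι // q r = s} ℂ (W s))

/-- The matrix coefficients `y ↦ a_r (y^* w)` of a module over the generalized preprojective
algebra, with respect to the `r`-th coordinate `a_r` of the framing. -/
def critForm (x : FramedRep D V W) (hx : ∀ a b, Rel D a b → freeRep x.1 a = freeRep x.1 b)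
    (r : ι) : (⨁ s, V s) →ₗ[ℂ] Module.Dual ℂ (PreprojAlg D) :=
  LinearMap.mk₂ ℂ (fun w y => frameForm β x r (piRep x.1 hx (pstar y) w))
    (fun w w' y => by simp) (fun c w y => by simp) (fun w y y' => by simp) (fun c w y => by simp)

theorem critForm_apply (x : FramedRep D V W)
    (hx : ∀ a b, Rel D a b → freeRep x.1 a = freeRep x.1 b) (r : ι) (w : ⨁ s, V s)
    (y : PreprojAlg D) : critForm β x hx r w y = frameForm β x r (piRep x.1 hx (pstar y) w) := rfl

theorem critForm_gen_mul (x : FramedRep D V W)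
    (hx : ∀ a b, Rel D a b → freeRep x.1 a = freeRep x.1 b) (r : ι) (w : ⨁ s, V s) (g : Gen I)
    (y : PreprojAlg D) :
    critForm β x hx r w (pgen D g * y) = critForm β x hx r (genTot x.1 g.star w) y := by
  rw [critForm_apply, critForm_apply, pstar_mul, map_mul, Module.End.mul_apply, pstar_pgen,
    piRep_pgen]

/-- The framed morphism to `I_W` of a critical point, given by the matrix coefficients. -/
def critFrame (x : FramedRep D (Std v) W)
    (hx : ∀ a b, Rel D a b → freeRep x.1 a = freeRep x.1 b) (s : I × ℤ) :
    Std v s →ₗ[ℂ] InjW D q s :=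
  LinearMap.pi fun r => (Module.Dual.transpose
    (piece D s.1 (q r).1 ((q r).2 + D.d (q r).1 - s.2)).subtype ∘ₗ critForm β x hx r ∘ₗ
      DirectSum.lof ℂ (I × ℤ) (Std v) s).codRestrict
        (injComp D (q r).1 ((q r).2 + D.d (q r).1) s) fun m => by
    refine ⟨Module.finrank ℂ (⨁ s, Std v s) + 1, Nat.succ_pos _, ?_⟩
    rintro z ⟨y, hy⟩
    change critForm β x hx r _ z.1 = 0
    rw [hy, critForm_apply, pstar_mul, pstar_pow, pstar_omega, pow_succ, mul_assoc, map_mul,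
      piRep_omega_pow, zero_mul, LinearMap.zero_apply, map_zero]

theorem critFrame_apply (x : FramedRep D (Std v) W)
    (hx : ∀ a b, Rel D a b → freeRep x.1 a = freeRep x.1 b) (s : I × ℤ) (m : Std v s) (r : ι)
    (z : piece D s.1 (q r).1 ((q r).2 + D.d (q r).1 - s.2)) :
    (critFrame β x hx s m r).1 z =
      critForm β x hx r (DirectSum.lof ℂ (I × ℤ) (Std v) s m) z.1 := rfl

theorem isFramedMor_critFrame (x : FramedRep D (Std v) W)
    (hx : ∀ a b, Rel D a b → freeRep x.1 a = freeRep x.1 b) :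
    IsFramedMor β x (critFrame β x hx) where
  al p m := by
    obtain ⟨⟨s, t⟩, h⟩ := p
    refine funext fun r => Subtype.ext (LinearMap.ext fun z => ?_)
    change _ = critForm β x hx r (DirectSum.lof ℂ (I × ℤ) (Std v) s m)
      (pgen D (.al s.1 t.1) * z.1)
    rw [critFrame_apply, critForm_gen_mul, Gen.star, genTot]
    exact congrArg (fun w => critForm β x hx r w z.1) (alphaTot_lof x.1 h m).symm
  ep p m := by
    obtain ⟨⟨s, t⟩, h⟩ := p
    refine funext fun r => Subtype.ext (LinearMap.ext fun z => ?_)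
    change _ = critForm β x hx r (DirectSum.lof ℂ (I × ℤ) (Std v) s m)
      (pgen D (.ep s.1) * z.1)
    rw [critFrame_apply, critForm_gen_mul, Gen.star, genTot]
    exact congrArg (fun w => critForm β x hx r w z.1) (epsTot_lof x.1 h m).symm
  frame p m r hr := by
    obtain ⟨⟨s, t⟩, h⟩ := p
    simp only at hr
    subst hr
    have h1 : (q r).1 = s.1 := h.1
    change _ = critForm β x hx r (DirectSum.lof ℂ (I × ℤ) (Std v) s m) (pgen D (.e (q r).1))
    rw [← mul_one (pgen D (.e (q r).1)), critForm_gen_mul, Gen.star, genTot, vertexTot_lof,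
      if_pos h1.symm, critForm_apply, pstar_one, map_one, Module.End.one_apply,
      frameForm_lof β x h]

end CritFrame

/-! ### The framed representation of a submodule -/

section Frames

variable {v : DimVec I} {M : I × ℤ → Type*} [∀ s, AddCommGroup (M s)] [∀ s, Module ℂ (M s)]
  {X : TripleRep D M}

theorem GrassFrame.al_mem_range (f : GrassFrame X v)
    (p : {p : (I × ℤ) × (I × ℤ) // AlphaArrow D p.1 p.2}) (m : Std v p.1.1) :
    X.1 p (f.1 p.1.1 m) ∈ LinearMap.range (f.1 p.1.2) :=
  f.2.2.1 p (LinearMap.mem_range_self (f.1 p.1.1) m)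

theorem GrassFrame.ep_mem_range (f : GrassFrame X v)
    (p : {p : (I × ℤ) × (I × ℤ) // EpsArrow D p.1 p.2}) (m : Std v p.1.1) :
    X.2 p (f.1 p.1.1 m) ∈ LinearMap.range (f.1 p.1.2) :=
  f.2.2.2 p (LinearMap.mem_range_self (f.1 p.1.1) m)

theorem GrassFrame.apply_leftInverse (f : GrassFrame X v) {s : I × ℤ} {m : M s}
    (hm : m ∈ LinearMap.range (f.1 s)) : f.1 s ((f.1 s).leftInverse m) = m := by
  obtain ⟨m, rfl⟩ := hm
  rw [LinearMap.leftInverse_apply_of_inj (LinearMap.ker_eq_bot.2 (f.2.1 s))]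

/-- The representation given by the restriction of the arrows to the image of an injective map. -/
def restrictRep (f : GrassFrame X v) : TripleRep D (Std v) :=
  (fun p => (f.1 p.1.2).leftInverse ∘ₗ X.1 p ∘ₗ f.1 p.1.1,
    fun p => (f.1 p.1.2).leftInverse ∘ₗ X.2 p ∘ₗ f.1 p.1.1)

theorem apply_restrictRep_al (f : GrassFrame X v)
    (p : {p : (I × ℤ) × (I × ℤ) // AlphaArrow D p.1 p.2}) (m : Std v p.1.1) :
    f.1 p.1.2 ((restrictRep f).1 p m) = X.1 p (f.1 p.1.1 m) :=
  f.apply_leftInverse (f.al_mem_range p m)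

theorem apply_restrictRep_ep (f : GrassFrame X v)
    (p : {p : (I × ℤ) × (I × ℤ) // EpsArrow D p.1 p.2}) (m : Std v p.1.1) :
    f.1 p.1.2 ((restrictRep f).2 p m) = X.2 p (f.1 p.1.1 m) :=
  f.apply_leftInverse (f.ep_mem_range p m)

end Frames

section FrameRep

variable {ι : Type*} [Finite ι] {q : ι → I × ℤ} {v : DimVec I}
variable {W : I × ℤ → Type*} [∀ s, AddCommGroup (W s)] [∀ s, Module ℂ (W s)]
variable (β : ∀ s, Module.Basis {r : ι // q r = s} ℂ (W s))

/-- The evaluation `I_W → W` in the degree of a framing arrow. -/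
def evalFrame {s t : I × ℤ} (h : FrameArrow D s t) : InjW D q s →ₗ[ℂ] W t :=
  (β t).equivFun.symm.toLinearMap ∘ₗ LinearMap.pi fun r =>
    LinearMap.applyₗ (⟨pgen D (.e (q r.1).1), e_mem_piece_of_frameArrow D q h r.2⟩ :
      piece D s.1 (q r.1).1 ((q r.1).2 + D.d (q r.1).1 - s.2)) ∘ₗ
      (injComp D (q r.1).1 ((q r.1).2 + D.d (q r.1).1) s).subtype ∘ₗ LinearMap.proj r.1

theorem repr_evalFrame {s t : I × ℤ} (h : FrameArrow D s t) (φ : InjW D q s) (r : ι)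
    (hr : q r = t) : (β t).repr (evalFrame β h φ) ⟨r, hr⟩ = evalAt D q h hr φ := by
  rw [← Module.Basis.equivFun_apply, evalFrame, LinearMap.comp_apply, LinearEquiv.coe_coe,
    LinearEquiv.apply_symm_apply]
  rfl

/-- The framed representation given by the restriction of the action and of the evaluation to the
image of an injective map to `I_W`. -/
def frameRep (f : GrassFrame (injW D q) v) : FramedRep D (Std v) W :=
  (restrictRep f, fun p => evalFrame β p.2 ∘ₗ f.1 p.1.1)

theorem isFramedMor_frameRep (f : GrassFrame (injW D q) v) :
    IsFramedMor β (frameRep β f) f.1 where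
  al p m := apply_restrictRep_al f p m
  ep p m := apply_restrictRep_ep f p m
  frame p m r hr := repr_evalFrame β p.2 (f.1 p.1.1 m) r hr

end FrameRep

/-! ### Regularity of the morphism to the injective type module -/

section Words

/-- The generators which are arrows. -/
def Gen.IsArrow : Gen I → Prop
  | .e _ => False
  | .al _ _ => True
  | .ep _ => True

theorem Gen.IsArrow.mem_arrowIdeal {g : Gen I} (h : g.IsArrow) : pgen D g ∈ arrowIdeal D := by
  cases g with
  | e i => exact h.elim
  | al i j => exact al_mem_arrowIdeal i j
  | ep i => exact ep_mem_arrowIdeal i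

theorem Gen.IsArrow.star {g : Gen I} (h : g.IsArrow) : g.star.IsArrow := by
  cases g <;> exact h

theorem e_mul_pgen (i : I) (g : Gen I) :
    pgen D (.e i) * pgen D g = 0 ∨ pgen D (.e i) * pgen D g = pgen D g := by
  have key : ∀ j, pgen D (.e j) * pgen D g = pgen D g →
      pgen D (.e i) * pgen D g = 0 ∨ pgen D (.e i) * pgen D g = pgen D g := by
    intro j hj
    by_cases h : i = j
    · right; rw [h, hj]
    · left; rw [← hj, ← mul_assoc, e_mul_e_of_ne D h, zero_mul]
  cases g with
  | e j => exact key j (e_mul_e D j)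
  | al j k => exact key j (e_mul_al D j k)
  | ep j => exact key j (e_mul_ep D j)

theorem pgen_mul_e (j : I) (g : Gen I) :
    pgen D g * pgen D (.e j) = 0 ∨ pgen D g * pgen D (.e j) = pgen D g := by
  have key : ∀ i, pgen D g * pgen D (.e i) = pgen D g →
      pgen D g * pgen D (.e j) = 0 ∨ pgen D g * pgen D (.e j) = pgen D g := by
    intro i hi
    by_cases h : i = j
    · right; rw [← h, hi]
    · left; rw [← hi, mul_assoc, e_mul_e_of_ne D h, mul_zero]
  cases g with
  | e i => exact key i (e_mul_e D i)
  | al i k => exact key k (al_mul_e D i k)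
  | ep i => exact key i (ep_mul_e D i)

/-- The idempotents can be removed from a word which is not zero and has length at least two. -/
theorem word_reduce (L : List (Gen I)) : (L.map (pgen D)).prod = 0 ∨ ∃ L' : List (Gen I),
    (L.map (pgen D)).prod = (L'.map (pgen D)).prod ∧
      (L'.length ≤ 1 ∨ ∀ g ∈ L', g.IsArrow) := by
  induction L with
  | nil => exact Or.inr ⟨[], rfl, Or.inl (by simp)⟩
  | cons g L ih =>
    rw [List.map_cons, List.prod_cons]
    rcases ih with h0 | ⟨L', hL', hA⟩
    · left; rw [h0, mul_zero]
    rw [hL']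
    cases L' with
    | nil => exact Or.inr ⟨[g], by simp, Or.inl (by simp)⟩
    | cons h L'' =>
      by_cases hg : g.IsArrow
      · by_cases hall : ∀ g ∈ h :: L'', g.IsArrow
        · refine Or.inr ⟨g :: h :: L'', by simp, Or.inr fun g' hg' => ?_⟩
          rcases List.mem_cons.1 hg' with rfl | hg'
          · exact hg
          · exact hall g' hg'
        · have hnil : L'' = [] := by
            have := hA.resolve_right hall
            rw [List.length_cons] at this
            exact List.eq_nil_of_length_eq_zero (by omega)
          subst hnil
          cases h with
          | e j =>
            simp only [List.map_cons, List.map_nil, List.prod_cons, List.prod_nil, mul_one]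
            rcases pgen_mul_e (D := D) j g with h0 | h1
            · exact Or.inl h0
            · exact Or.inr ⟨[g], by simp [h1], Or.inl (by simp)⟩
          | al i j => exact absurd (fun g hg => by rw [List.mem_singleton.1 hg]; trivial) hall
          | ep i => exact absurd (fun g hg => by rw [List.mem_singleton.1 hg]; trivial) hall
      · cases g with
        | al i j => exact absurd trivial hg
        | ep i => exact absurd trivial hg
        | e i =>
          rw [List.map_cons, List.prod_cons, ← mul_assoc]
          rcases e_mul_pgen (D := D) i h with h0 | h1
          · left; rw [h0, zero_mul]
          · exact Or.inr ⟨h :: L'', by rw [h1, List.map_cons, List.prod_cons], hA⟩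

/-- A linear form which vanishes on the long words in the arrows and on the short words is zero. -/
theorem eq_zero_of_words {φ : Module.Dual ℂ (PreprojAlg D)} {n : ℕ}
    (hlong : ∀ L : List (Gen I), (∀ g ∈ L, g.IsArrow) → n ≤ L.length →
      φ (L.map (pgen D)).prod = 0)
    (hshort : ∀ L : List (Gen I), L.length ≤ n + 1 → φ (L.map (pgen D)).prod = 0) : φ = 0 := by
  have hw : ∀ L : List (Gen I), φ (L.map (pgen D)).prod = 0 := by
    intro L
    rcases word_reduce (D := D) L with h0 | ⟨L', hL', h1 | hA⟩
    · rw [h0, map_zero]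
    · rw [hL']; exact hshort L' (by omega)
    · rw [hL']
      rcases le_total n L'.length with h | h
      · exact hlong L' hA h
      · exact hshort L' (by omega)
  refine LinearMap.ext fun y => ?_
  let S : Submodule ℂ (PreprojAlg D) := Submodule.span ℂ (Set.range fun L : List (Gen I) =>
    (L.map (pgen D)).prod)
  have hS : S ≤ LinearMap.ker φ := by
    refine Submodule.span_le.2 ?_
    rintro _ ⟨L, rfl⟩
    exact hw L
  refine hS (mem_of_gen_mul_mem D (N := S) (Submodule.subset_span ⟨[], by simp⟩) ?_ y)
  intro g y hy
  have : S ≤ S.comap (LinearMap.mulLeft ℂ (pgen D g)) := by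
    refine Submodule.span_le.2 ?_
    rintro _ ⟨L, rfl⟩
    exact Submodule.subset_span ⟨g :: L, by simp⟩
  exact this hy

instance : Finite (Gen I) := by
  let f : Gen I → I ⊕ (I × I) ⊕ I := fun g => match g with
    | .e i => Sum.inl i
    | .al i j => Sum.inr (Sum.inl (i, j))
    | .ep i => Sum.inr (Sum.inr i)
  refine Finite.of_injective f fun g g' h => ?_
  cases g <;> cases g' <;> simp_all [f]

end Words

section Regular

variable {X : Type*} {𝒜 : Subalgebra ℂ (X → ℂ)} {v : DimVec I}
variable {ι : Type*} {q : ι → I × ℤ}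
variable {W : I × ℤ → Type*} [∀ s, AddCommGroup (W s)] [∀ s, Module ℂ (W s)]

theorem MapIn.of_add_smul {E E' : Type*} [AddCommGroup E] [Module ℂ E] [AddCommGroup E']
    [Module ℂ E'] {Θ : X → E} (h : MapIn 𝒜 Θ) {T : E → E'}
    (hT : ∀ x y (t : ℂ), T (x + t • y) = T x + t • T y) : MapIn 𝒜 fun a => T (Θ a) := by
  have h0 : T 0 = 0 := by simpa using hT 0 0 1
  exact h.comp_linear
    { toFun := T
      map_add' := fun x y => by simpa using hT x y 1
      map_smul' := fun t y => by simpa [h0] using hT 0 y t }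

theorem MapIn.genTot {Θ : X → TripleRep D (Std v)} (h : MapIn 𝒜 Θ) (g : Gen I) :
    MapIn 𝒜 fun a => genTot (Θ a) g := by
  cases g with
  | e i => exact MapIn.const _
  | al i j => exact h.of_add_smul (T := fun z => alphaTot z i j) fun x y t => alphaTot_add_smul x y t i j
  | ep i => exact h.of_add_smul (T := fun z => epsTot z i) fun x y t => epsTot_add_smul x y t i

theorem MapIn.word {Θ : X → TripleRep D (Std v)} (h : MapIn 𝒜 Θ) (L : List (Gen I))
    (w : ⨁ s, Std v s) : MapIn 𝒜 fun a => (L.map (GradedTriple.genTot (Θ a))).prod w := by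
  induction L with
  | nil => exact MapIn.const w
  | cons g L ih =>
    simp only [List.map_cons, List.prod_cons, Module.End.mul_apply]
    exact MapIn.bilin (E₁ := (⨁ s, Std v s) →ₗ[ℂ] (⨁ s, Std v s)) LinearMap.id (h.genTot g) ih

variable (β : ∀ s, Module.Basis {r : ι // q r = s} ℂ (W s))

theorem frameForm_add_smul (x y : FramedRep D (Std v) W) (t : ℂ) (r : ι) :
    frameForm β (x + t • y) r = frameForm β x r + t • frameForm β y r := by
  refine DirectSum.linearMap_ext ℂ fun s => LinearMap.ext fun m => ?_
  simp only [LinearMap.comp_apply, LinearMap.add_apply, LinearMap.smul_apply]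
  by_cases h : FrameArrow D s (q r)
  · rw [frameForm_lof β _ h, frameForm_lof β _ h, frameForm_lof β _ h]
    simp
  · rw [frameForm_lof_of_not β _ h, frameForm_lof_of_not β _ h, frameForm_lof_of_not β _ h]
    simp

theorem pstar_word (L : List (Gen I)) : pstar (L.map (pgen D)).prod =
    ((L.reverse.map Gen.star).map (pgen D)).prod := by
  induction L with
  | nil => simp [pstar_one]
  | cons g L ih => simp [pstar_mul, pstar_pgen, ih]

theorem piRep_word (x : TripleRep D (Std v))
    (hx : ∀ a b, Rel D a b → freeRep x a = freeRep x b) (L : List (Gen I)) :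
    piRep x hx (L.map (pgen D)).prod = (L.map (genTot x)).prod := by
  induction L with
  | nil => simp
  | cons g L ih => simp [piRep_pgen, ih]

theorem piRep_long_word (x : TripleRep D (Std v))
    (hx : ∀ a b, Rel D a b → freeRep x a = freeRep x b) (L : List (Gen I))
    (hL : ∀ g ∈ L, g.IsArrow) (hlen : Module.finrank ℂ (⨁ s, Std v s) ≤ L.length) :
    piRep x hx (L.map (pgen D)).prod = 0 := by
  refine piRep_list_prod x hx _ ?_ (by simpa using hlen)
  intro y hy
  obtain ⟨g, hg, rfl⟩ := List.mem_map.1 hy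
  exact (hL g hg).mem_arrowIdeal

/-- The matrix coefficients of critical points depend polynomially on the point, since they are
determined by their values on the words of bounded length. -/
theorem mapIn_critForm {Θ : X → FramedRep D (Std v) W} (hΘ : MapIn 𝒜 Θ)
    (hx : ∀ a, ∀ b c, Rel D b c → freeRep (Θ a).1 b = freeRep (Θ a).1 c) (r : ι)
    (w : ⨁ s, Std v s) : MapIn 𝒜 fun a => critForm β (Θ a) (hx a) r w := by
  intro φ
  set n := Module.finrank ℂ (⨁ s, Std v s)
  -- all the coefficients lie in the space `Y` of the forms vanishing on the long words, on which
  -- every linear form is a combination of the evaluations at the short words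
  let Y : Submodule ℂ (Module.Dual ℂ (PreprojAlg D)) :=
    ⨅ L : {L : List (Gen I) // (∀ g ∈ L, g.IsArrow) ∧ n ≤ L.length},
      LinearMap.ker (LinearMap.applyₗ (L.1.map (pgen D)).prod :
        Module.Dual ℂ (PreprojAlg D) →ₗ[ℂ] ℂ)
  have hY : ∀ {ψ}, ψ ∈ Y ↔ ∀ L : List (Gen I), (∀ g ∈ L, g.IsArrow) → n ≤ L.length →
      ψ (L.map (pgen D)).prod = 0 := by
    intro ψ
    simp only [Y, Submodule.mem_iInf, LinearMap.mem_ker, Subtype.forall, LinearMap.applyₗ_apply_apply,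
      and_imp]
  have hfin : Finite {L : List (Gen I) // L.length ≤ n + 1} :=
    (List.finite_length_le (Gen I) (n + 1)).to_subtype
  let _ : Fintype {L : List (Gen I) // L.length ≤ n + 1} := Fintype.ofFinite _
  obtain ⟨c, hc⟩ := exists_eval_combination
    (fun L : {L : List (Gen I) // L.length ≤ n + 1} => (L.1.map (pgen D)).prod) Y
    (fun ψ hψ h => eq_zero_of_words (hY.1 hψ) fun L hL => h ⟨L, hL⟩) (φ ∘ₗ Y.subtype)
  have hmem : ∀ a, critForm β (Θ a) (hx a) r w ∈ Y := by
    refine fun a => hY.2 fun L hL hlen => ?_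
    rw [critForm_apply, pstar_word, piRep_long_word, LinearMap.zero_apply, map_zero]
    · intro g hg
      obtain ⟨g', hg', rfl⟩ := List.mem_map.1 hg
      exact (hL g' (List.mem_reverse.1 hg')).star
    · simpa using hlen
  have hsum : (fun a => φ (critForm β (Θ a) (hx a) r w)) = fun a =>
      ∑ L : {L : List (Gen I) // L.length ≤ n + 1}, c L *
        frameForm β (Θ a) r (((L.1.reverse.map Gen.star).map (genTot (Θ a).1)).prod w) := by
    funext a
    have h := hc ⟨_, hmem a⟩
    rw [LinearMap.comp_apply, Submodule.subtype_apply] at h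
    rw [h]
    refine Finset.sum_congr rfl fun L _ => ?_
    rw [critForm_apply, pstar_word, piRep_word]
  rw [hsum]
  have h1 : MapIn 𝒜 fun a => frameForm β (Θ a) r :=
    hΘ.of_add_smul (T := fun z => frameForm β z r) fun x y t => frameForm_add_smul β x y t r
  have h2 : ∀ L : List (Gen I), MapIn 𝒜 fun a => (L.map (genTot (Θ a).1)).prod w := fun L =>
    (hΘ.comp_linear (LinearMap.fst ℂ _ _)).word L w
  have h3 := MapIn.sum Finset.univ (𝒜 := 𝒜)
    (Θ := fun (L : {L : List (Gen I) // L.length ≤ n + 1}) a => c L *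
        frameForm β (Θ a) r (((L.1.reverse.map Gen.star).map (genTot (Θ a).1)).prod w)) fun L _ =>
    MapIn.comp_linear (MapIn.bilin (LinearMap.id : Module.Dual ℂ (⨁ s, Std v s) →ₗ[ℂ] _) h1
      (h2 (L.1.reverse.map Gen.star))) (LinearMap.mulLeft ℂ (c L))
  exact h3 LinearMap.id

theorem subsingleton_hom_of_notMem {E : Type*} [AddCommGroup E] [Module ℂ E] {s : I × ℤ}
    (hs : s ∉ v.support) : Subsingleton (Std v s →ₗ[ℂ] E) := by
  have h0 : v s = 0 := Finsupp.notMem_support_iff.1 hs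
  have : IsEmpty (Fin (v s)) := by rw [h0]; infer_instance
  exact ⟨fun f g => LinearMap.ext fun m => by rw [Subsingleton.elim m 0, map_zero, map_zero]⟩

/-- The morphism to `I_W` of a critical point depends polynomially on the point. -/
theorem mapIn_critFrame [Finite ι] {Θ : X → FramedRep D (Std v) W} (hΘ : MapIn 𝒜 Θ)
    (hx : ∀ a, ∀ b c, Rel D b c → freeRep (Θ a).1 b = freeRep (Θ a).1 c) :
    MapIn 𝒜 fun a => critFrame β (Θ a) (hx a) := by
  refine MapIn.pi v.support.finite_toSet (fun s hs => subsingleton_hom_of_notMem hs) fun s => ?_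
  refine MapIn.hom fun k => ?_
  refine MapIn.pi (S := Set.univ) Set.finite_univ (fun r hr => absurd trivial hr) fun r => ?_
  intro φ
  obtain ⟨φ', hφ'⟩ := LinearMap.exists_extend φ
  have h := mapIn_critForm β hΘ hx r (DirectSum.lof ℂ (I × ℤ) (Std v) s (Pi.single k 1))
    (φ' ∘ₗ Module.Dual.transpose (piece D s.1 (q r).1 ((q r).2 + D.d (q r).1 - s.2)).subtype)
  have e : (fun a => φ (critFrame β (Θ a) (hx a) s (Pi.single k 1) r)) = fun a =>
      (φ' ∘ₗ Module.Dual.transpose (piece D s.1 (q r).1 ((q r).2 + D.d (q r).1 - s.2)).subtype)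
        (critForm β (Θ a) (hx a) r (DirectSum.lof ℂ (I × ℤ) (Std v) s (Pi.single k 1))) := by
    funext a
    rw [← hφ']
    rfl
  rw [e]
  exact h

end Regular

/-! ### Regularity of the framed representation of a submodule -/

section FrameRegular

variable {v : DimVec I} {M : I × ℤ → Type*} [∀ s, AddCommGroup (M s)] [∀ s, Module ℂ (M s)]

theorem MapIn.prodMk {X E E' : Type*} {𝒜 : Subalgebra ℂ (X → ℂ)} [AddCommGroup E] [Module ℂ E]
    [AddCommGroup E'] [Module ℂ E'] {Θ : X → E} {Θ' : X → E'} (h : MapIn 𝒜 Θ) (h' : MapIn 𝒜 Θ') :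
    MapIn 𝒜 fun a => (Θ a, Θ' a) := by
  intro φ
  have e : (fun a => φ (Θ a, Θ' a)) = (fun a => φ (LinearMap.inl ℂ E E' (Θ a))) +
      fun a => φ (LinearMap.inr ℂ E E' (Θ' a)) := by
    funext a
    rw [Pi.add_apply, ← map_add]
    simp
  rw [e]
  exact add_mem (h.comp_linear _ φ) (h'.comp_linear _ φ)

theorem mapIn_matrix {X : Type*} {𝒜 : Subalgebra ℂ (X → ℂ)} {n : ℕ}
    {A : X → Matrix (Fin n) (Fin n) ℂ} (h : ∀ k l, (fun a => A a k l) ∈ 𝒜) : MapIn 𝒜 A := by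
  have e : A = fun a => ∑ k, ∑ l, A a k l • Matrix.single k l (1 : ℂ) := by
    funext a
    conv_lhs => rw [Matrix.matrix_eq_sum_single (A a)]
    simp [Matrix.smul_single]
  rw [e]
  exact MapIn.sum _ fun k _ => MapIn.sum _ fun l _ => MapIn.smul (h k l) (MapIn.const _)

theorem mapIn_comp_apply {E : Type*} [AddCommGroup E] [Module ℂ E] {s : I × ℤ} (T : M s →ₗ[ℂ] E) :
    MapIn (polyFun (∀ s, Std v s →ₗ[ℂ] M s)) fun f => T ∘ₗ f s :=
  mapIn_id.comp_linear
    { toFun := fun f => T ∘ₗ f s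
      map_add' := fun _ _ => LinearMap.comp_add _ _ _
      map_smul' := fun _ _ => LinearMap.comp_smul _ _ _ :
      (∀ s, Std v s →ₗ[ℂ] M s) →ₗ[ℂ] (Std v s →ₗ[ℂ] E) }

/-- If `f_t x = T f_s` for injective maps `f_t`, then `x` is a locally regular function of `f`:
where a left inverse `l` of `f_t` at one point still makes `l f_t` invertible, it is given by
Cramer's rule. -/
theorem mapIn_locReg_restrict {X : Type*} (j : X → ∀ s, Std v s →ₗ[ℂ] M s) {s t : I × ℤ}
    (T : M s →ₗ[ℂ] M t) (hinj : ∀ a, Function.Injective (j a t))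
    (x : X → (Std v s →ₗ[ℂ] Std v t)) (hx : ∀ a m, j a t (x a m) = T (j a s m)) :
    MapIn (locReg j) x := by
  intro φ a₀
  let l : M t →ₗ[ℂ] Std v t := (j a₀ t).leftInverse
  let A : (∀ s, Std v s →ₗ[ℂ] M s) → Matrix (Fin (v t)) (Fin (v t)) ℂ :=
    fun f => LinearMap.toMatrix' (l ∘ₗ f t)
  -- `det A • x = adj A * l T f_s`
  have hA : ∀ k k', (fun f => A f k k') ∈ polyFun (∀ s, Std v s →ₗ[ℂ] M s) := by
    intro k k'
    let c : Module.Dual ℂ (∀ s, Std v s →ₗ[ℂ] M s) :=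
      LinearMap.proj k ∘ₗ l ∘ₗ LinearMap.applyₗ (Pi.single k' 1) ∘ₗ LinearMap.proj t
    have e : (fun f => A f k k') = fun f => c f := by
      funext f
      simp only [A, LinearMap.toMatrix'_apply]
      rfl
    rw [e]
    exact mapIn_id c
  have hadj := (mapIn_matrix (adjugate_mem hA)).comp_linear
    (Matrix.toLin' : Matrix (Fin (v t)) (Fin (v t)) ℂ ≃ₗ[ℂ] (Std v t →ₗ[ℂ] Std v t)).toLinearMap
  have hB : MapIn (polyFun (∀ s, Std v s →ₗ[ℂ] M s)) fun f => l ∘ₗ T ∘ₗ f s :=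
    mapIn_comp_apply (l ∘ₗ T)
  have hP := MapIn.bilin (LinearMap.llcomp ℂ (Std v s) (Std v t) (Std v t)) hadj hB
  refine ⟨_, hP φ, _, det_mem hA, ?_, fun b _ => ?_⟩
  · have : l ∘ₗ j a₀ t = LinearMap.id := LinearMap.ext fun m =>
      LinearMap.leftInverse_apply_of_inj (LinearMap.ker_eq_bot.2 (hinj a₀)) m
    simp only [A, this, LinearMap.toMatrix'_id, Matrix.det_one]
    exact one_ne_zero
  · have e : (A (j b)).det • x b = LinearMap.llcomp ℂ (Std v s) (Std v t) (Std v t)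
        (Matrix.toLin' (A (j b)).adjugate) (l ∘ₗ T ∘ₗ j b s) := by
      refine LinearMap.ext fun m => ?_
      rw [LinearMap.llcomp_apply, LinearMap.comp_apply, LinearMap.comp_apply, ← hx,
        LinearMap.smul_apply]
      have h1 : l (j b t (x b m)) = Matrix.toLin' (A (j b)) (x b m) := by
        simp only [A, Matrix.toLin'_toMatrix']
        rfl
      rw [h1, ← Matrix.toLin'_mul_apply, Matrix.adjugate_mul, map_smul, Matrix.toLin'_one]
      rfl
    have e' := congrArg φ e
    rw [map_smul, smul_eq_mul, mul_comm] at e'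
    exact e'

theorem finite_arrows {P : (I × ℤ) × (I × ℤ) → Prop} :
    {p : {p // P p} | p.1.1 ∈ v.support ∧ p.1.2 ∈ v.support}.Finite :=
  Set.Finite.preimage (Subtype.val_injective.injOn)
    (s := {p : (I × ℤ) × (I × ℤ) | p.1 ∈ v.support ∧ p.2 ∈ v.support})
    (((v.support ×ˢ v.support).finite_toSet).subset fun p hp => by simpa using hp)

theorem subsingleton_hom_std {s t : I × ℤ} (h : ¬ (s ∈ v.support ∧ t ∈ v.support)) :
    Subsingleton (Std v s →ₗ[ℂ] Std v t) := by
  by_cases hs : s ∈ v.support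
  · have h0 : v t = 0 := Finsupp.notMem_support_iff.1 fun ht => h ⟨hs, ht⟩
    have : IsEmpty (Fin (v t)) := by rw [h0]; infer_instance
    exact ⟨fun f g => LinearMap.ext fun m => Subsingleton.elim (α := Std v t) _ _⟩
  · exact subsingleton_hom_of_notMem hs

theorem mapIn_restrictRep (X : TripleRep D M) :
    MapIn (locReg fun f : GrassFrame X v => f.1) restrictRep := by
  refine MapIn.prodMk ?_ ?_
  · refine MapIn.pi (finite_arrows (v := v)) (fun p hp => subsingleton_hom_std hp) fun p => ?_
    exact mapIn_locReg_restrict _ (X.1 p) (fun f => f.2.1 _) _ fun f m => apply_restrictRep_al f p m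
  · refine MapIn.pi (finite_arrows (v := v)) (fun p hp => subsingleton_hom_std hp) fun p => ?_
    exact mapIn_locReg_restrict _ (X.2 p) (fun f => f.2.1 _) _ fun f m => apply_restrictRep_ep f p m

variable {ι : Type*} [Finite ι] {q : ι → I × ℤ}
variable {W : I × ℤ → Type*} [∀ s, AddCommGroup (W s)] [∀ s, Module ℂ (W s)]
variable (β : ∀ s, Module.Basis {r : ι // q r = s} ℂ (W s))

/-- The framed representation of a submodule is a locally regular function of the injective map. -/
theorem mapIn_frameRep :
    MapIn (locReg fun f : GrassFrame (injW D q) v => f.1) (frameRep β) := by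
  refine (mapIn_restrictRep (injW D q)).prodMk ?_
  refine MapIn.pi (S := {p : {p : (I × ℤ) × (I × ℤ) // FrameArrow D p.1 p.2} |
    p.1.1 ∈ v.support}) ?_ (fun p hp => subsingleton_hom_of_notMem hp)
    fun p => ?_
  · refine Set.Finite.preimage (f := fun p : {p : (I × ℤ) × (I × ℤ) // FrameArrow D p.1 p.2} => p.1.1)
      (fun p _ p' _ h => ?_) v.support.finite_toSet
    obtain ⟨⟨s, t⟩, h1, h2⟩ := p
    obtain ⟨⟨s', t'⟩, h1', h2'⟩ := p'
    simp only at h h1 h2 h1' h2'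
    subst h
    exact Subtype.ext (Prod.ext rfl (Prod.ext (h1.trans h1'.symm) (h2.trans h2'.symm)))
  · exact MapIn.locReg (fun f : GrassFrame (injW D q) v => f.1)
      (mapIn_comp_apply (evalFrame β p.2))

end FrameRegular

/-! ### Degeneration of nilpotent representations to zero -/

section Projections

variable {V : Type*} [AddCommGroup V] [Module ℂ V]

/-- A decreasing filtration of a vector space can be split. -/
theorem exists_filtration_projections {F : ℕ → Submodule ℂ V} (hF : Antitone F) (h0 : F 0 = ⊤)
    {N : ℕ} (hN : F N = ⊥) : ∃ P : ℕ → V →ₗ[ℂ] V,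
      (∀ n w, P n (P n w) = P n w) ∧ (∀ m n, m ≠ n → ∀ w, P m (P n w) = 0) ∧
      (∀ w, ∑ n ∈ Finset.range N, P n w = w) ∧ (∀ n w, P n w ∈ F n) ∧
      (∀ m n, m < n → ∀ w ∈ F n, P m w = 0) := by
  choose ϖ hϖ using fun n => (F n).subtype.exists_leftInverse_of_injective (F n).ker_subtype
  -- projections `π n` onto `F n` with `π n ∘ π k = π (max n k)`
  let π : ℕ → V →ₗ[ℂ] V := fun n =>
    Nat.rec LinearMap.id (fun n π => ((F (n + 1)).subtype ∘ₗ ϖ (n + 1)) ∘ₗ π) n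
  have hπ0 : ∀ w, π 0 w = w := fun w => rfl
  have hπs : ∀ n w, π (n + 1) w = (ϖ (n + 1) (π n w) : V) := fun n w => rfl
  have hmem : ∀ n w, π n w ∈ F n := by
    intro n w
    cases n with
    | zero => rw [h0]; trivial
    | succ n => rw [hπs]; exact Subtype.property _
  have hid : ∀ n, ∀ w ∈ F n, π n w = w := by
    intro n
    induction n with
    | zero => exact fun w _ => hπ0 w
    | succ n ih =>
      intro w hw
      rw [hπs, ih w (hF n.le_succ hw)]
      exact congrArg Subtype.val (LinearMap.congr_fun (hϖ (n + 1)) ⟨w, hw⟩)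
  have hle : ∀ k n, k ≤ n → ∀ w, π k (π n w) = π n w := fun k n hkn w =>
    hid k _ (hF hkn (hmem n w))
  have hge : ∀ k n, k ≤ n → ∀ w, π n (π k w) = π n w := by
    intro k n hkn w
    induction n, hkn using Nat.le_induction with
    | base => exact hle k k le_rfl w
    | succ n _ ih => rw [hπs, ih, ← hπs]
  refine ⟨fun n => π n - π (n + 1), fun n w => ?_, fun m n hmn w => ?_, fun w => ?_,
    fun n w => ?_, fun m n hmn w hw => ?_⟩
  · simp only [LinearMap.sub_apply, map_sub, hle n n le_rfl, hle n (n + 1) n.le_succ,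
      hge n (n + 1) n.le_succ, hle (n + 1) (n + 1) le_rfl]
    abel
  · rcases lt_or_gt_of_ne hmn with h | h
    · simp only [LinearMap.sub_apply, map_sub, hle m n h.le, hle (m + 1) n h,
        hle m (n + 1) (by omega), hle (m + 1) (n + 1) (by omega)]
      abel
    · simp only [LinearMap.sub_apply, map_sub, hge n m h.le, hge (n + 1) m h,
        hge n (m + 1) (by omega), hge (n + 1) (m + 1) (by omega)]
      abel
  · have h1 : π N w = 0 := by simpa [hN] using hmem N w
    simp only [LinearMap.sub_apply]
    rw [Finset.sum_range_sub' (fun n => π n w), h1, sub_zero, hπ0]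
  · exact sub_mem (hmem n w) (hF n.le_succ (hmem (n + 1) w))
  · rw [LinearMap.sub_apply, hid m w (hF hmn.le hw), hid (m + 1) w (hF hmn hw), sub_self]

/-- The sum of the projections of a split filtration, multiplied by invertible scalars. -/
theorem exists_scaling {P : ℕ → V →ₗ[ℂ] V} {N : ℕ} (hidem : ∀ n w, P n (P n w) = P n w)
    (horth : ∀ m n, m ≠ n → ∀ w, P m (P n w) = 0) (hsum : ∀ w, ∑ n ∈ Finset.range N, P n w = w)
    {a : ℕ → ℂ} (ha : ∀ n, a n ≠ 0) : ∃ g : V ≃ₗ[ℂ] V,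
      (∀ w, g w = ∑ n ∈ Finset.range N, a n • P n w) ∧
        ∀ w, g.symm w = ∑ n ∈ Finset.range N, (a n)⁻¹ • P n w := by
  let T : (ℕ → ℂ) → V →ₗ[ℂ] V := fun a => ∑ n ∈ Finset.range N, a n • P n
  have hT : ∀ a w, T a w = ∑ n ∈ Finset.range N, a n • P n w := by
    intro a w
    simp [T, LinearMap.sum_apply]
  have hTT : ∀ a b, (∀ n, a n * b n = 1) → T a ∘ₗ T b = LinearMap.id := by
    intro a b hab
    refine LinearMap.ext fun w => ?_
    rw [LinearMap.comp_apply, hT, LinearMap.id_apply]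
    conv_rhs => rw [← hsum w]
    refine Finset.sum_congr rfl fun n hn => ?_
    rw [hT, map_sum, Finset.sum_eq_single n, map_smul, hidem, smul_smul, hab, one_smul]
    · intro m _ hmn
      rw [map_smul, horth n m hmn.symm, smul_zero]
    · exact fun h => absurd hn h
  exact ⟨LinearEquiv.ofLinearMap (T a) (T fun n => (a n)⁻¹)
    (hTT _ _ fun n => mul_inv_cancel₀ (ha n)) (hTT _ _ fun n => inv_mul_cancel₀ (ha n)),
    fun w => hT _ w, fun w => hT _ w⟩

end Projections

section ZeroFiber

variable {V : I × ℤ → Type*} [∀ s, AddCommGroup (V s)] [∀ s, Module ℂ (V s)]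
variable {W : I × ℤ → Type*} [∀ s, AddCommGroup (W s)] [∀ s, Module ℂ (W s)]

/-- The filtration of a representation on which the words in the arrows of length at least `N` act
by zero: the vectors killed by the words of length at least `N - n`. -/
def wordFiltration (x : TripleRep D V) (N n : ℕ) (s : I × ℤ) : Submodule ℂ (V s) where
  carrier := {m | ∀ L : List (Gen I), (∀ g ∈ L, g.IsArrow) → N ≤ L.length + n →
    (L.map (genTot x)).prod (DirectSum.lof ℂ (I × ℤ) V s m) = 0}
  zero_mem' := fun L _ _ => by rw [map_zero, map_zero]
  add_mem' := fun h h' L hL hN => by rw [map_add, map_add, h L hL hN, h' L hL hN, add_zero]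
  smul_mem' := fun c m h L hL hN => by rw [map_smul, map_smul, h L hL hN, smul_zero]

theorem wordFiltration_antitone (x : TripleRep D V) (N : ℕ) (s : I × ℤ) :
    Antitone fun n => wordFiltration x N n s :=
  fun _ _ hn _ hm L hL hN => hm L hL (hN.trans (Nat.add_le_add_left hn _))

theorem wordFiltration_zero {x : TripleRep D V} {N : ℕ} (h : ∀ L : List (Gen I),
    (∀ g ∈ L, g.IsArrow) → N ≤ L.length → (L.map (genTot x)).prod = 0) (s : I × ℤ) :
    wordFiltration x N 0 s = ⊤ :=
  eq_top_iff.2 fun m _ L hL hN => by rw [h L hL hN, LinearMap.zero_apply]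

theorem wordFiltration_self (x : TripleRep D V) (N : ℕ) (s : I × ℤ) :
    wordFiltration x N N s = ⊥ := by
  refine (Submodule.eq_bot_iff _).2 fun m hm => ?_
  have h := hm [] (by simp) (by simp)
  have h1 := congrArg (fun w : ⨁ s, V s => w s) h
  simpa [DirectSum.lof_apply] using h1

theorem mem_wordFiltration_succ {x : TripleRep D V} {N n : ℕ} {s t : I × ℤ} {m : V s} {m' : V t}
    {g : Gen I} (hg : g.IsArrow)
    (h : genTot x g (DirectSum.lof ℂ (I × ℤ) V s m) = DirectSum.lof ℂ (I × ℤ) V t m')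
    (hm : m ∈ wordFiltration x N n s) : m' ∈ wordFiltration x N (n + 1) t := by
  intro L hL hN
  rw [← h, ← Module.End.mul_apply]
  have h1 := hm (L ++ [g]) (fun g' hg' => by
    rcases List.mem_append.1 hg' with h | h
    · exact hL g' h
    · rwa [List.mem_singleton.1 h]) (by simp; omega)
  simpa using h1

theorem continuous_of_mem_polyFun {h : ℂ → ℂ} (hh : h ∈ polyFun ℂ) : Continuous h := by
  induction hh using Algebra.adjoin_induction with
  | mem h hh => obtain ⟨φ, rfl⟩ := hh; exact φ.continuous_of_finiteDimensional
  | algebraMap r => exact continuous_const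
  | add p q _ _ hp hq => exact hp.add hq
  | mul p q _ _ hp hq => exact hp.mul hq

/-- Invariant polynomial functions take the value at `0` on the representations on which the long
words in the arrows act by zero: a one-parameter subgroup adapted to the filtration by the words
contracts such a representation to `0`. -/
theorem apply_eq_apply_zero_of_nilpotent {x : FramedRep D V W} {N : ℕ}
    (hN : ∀ L : List (Gen I), (∀ g ∈ L, g.IsArrow) → N ≤ L.length →
      (L.map (genTot x.1)).prod = 0)
    {p : FramedRep D V W → ℂ} (hp : p ∈ polyFun (FramedRep D V W))
    (hinv : ∀ g y, p (act g y) = p y) : p x = p 0 := by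
  choose P hidem horth hsum hmem hzero using fun s =>
    exists_filtration_projections (wordFiltration_antitone x.1 N s) (wordFiltration_zero hN s)
      (wordFiltration_self x.1 N s)
  have hal : ∀ (q : {q : (I × ℤ) × (I × ℤ) // AlphaArrow D q.1 q.2}) (k n : ℕ), k ≤ n → ∀ m,
      P q.1.2 k (x.1.1 q (P q.1.1 n m)) = 0 := fun q k n hkn m =>
    hzero _ k (n + 1) (by omega) _ (mem_wordFiltration_succ (g := .al q.1.2.1 q.1.1.1) trivial
      (alphaTot_lof x.1 q.2 _) (hmem _ n m))
  have hep : ∀ (q : {q : (I × ℤ) × (I × ℤ) // EpsArrow D q.1 q.2}) (k n : ℕ), k ≤ n → ∀ m,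
      P q.1.2 k (x.1.2 q (P q.1.1 n m)) = 0 := fun q k n hkn m =>
    hzero _ k (n + 1) (by omega) _ (mem_wordFiltration_succ (g := .ep q.1.1.1) trivial
      (epsTot_lof x.1 q.2 _) (hmem _ n m))
  let y : ℕ → ℕ → FramedRep D V W := fun k n =>
    ((fun q => P q.1.2 k ∘ₗ x.1.1 q ∘ₗ P q.1.1 n, fun q => P q.1.2 k ∘ₗ x.1.2 q ∘ₗ P q.1.1 n), 0)
  let z : ℕ → FramedRep D V W := fun n => (0, fun q => x.2 q ∘ₗ P q.1.1 n)
  -- the curve `τ ↦ g(τ) x` for `g(τ)` of weight `n - N` on the `n`-th piece: the arrows raise `n`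
  -- and the framing only sees negative weights, so no negative powers of `τ` occur
  let c : ℂ → FramedRep D V W := fun τ =>
    ∑ n ∈ Finset.range N, (∑ k ∈ Finset.range N, τ ^ (k - n) • y k n + τ ^ (N - n) • z n)
  have hy : ∀ k n, k ≤ n → y k n = 0 := fun k n hkn => Prod.ext (Prod.ext
    (funext fun q => LinearMap.ext fun m => hal q k n hkn m)
    (funext fun q => LinearMap.ext fun m => hep q k n hkn m)) rfl
  have hc0 : c 0 = 0 := by
    refine Finset.sum_eq_zero fun n hn => ?_
    rw [zero_pow (Nat.sub_ne_zero_of_lt (Finset.mem_range.1 hn)), zero_smul, add_zero]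
    refine Finset.sum_eq_zero fun k _ => ?_
    rcases le_or_gt k n with h | h
    · rw [hy k n h, smul_zero]
    · rw [zero_pow (Nat.sub_ne_zero_of_lt h), zero_smul]
  have hcact : ∀ τ : ℂ, τ ≠ 0 → ∃ g, c τ = act g x := by
    intro τ hτ
    choose g hg hg' using fun s => exists_scaling (hidem s) (horth s) (hsum s)
      (a := fun n => (τ ^ (N - n))⁻¹) fun n => inv_ne_zero (pow_ne_zero _ hτ)
    have hpow : ∀ k n, n < k → k < N → (τ ^ (N - k))⁻¹ * τ ^ (N - n) = τ ^ (k - n) := by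
      intro k n h h'
      rw [inv_mul_eq_iff_eq_mul₀ (pow_ne_zero _ hτ), ← pow_add]
      congr 1
      omega
    have key : ∀ s t (T : V s →ₗ[ℂ] V t), (∀ k n, k ≤ n → ∀ m, P t k (T (P s n m)) = 0) → ∀ m,
        ∑ n ∈ Finset.range N, ∑ k ∈ Finset.range N, τ ^ (k - n) • P t k (T (P s n m)) =
          g t (T ((g s).symm m)) := by
      intro s t T hT m
      simp only [hg', map_sum, map_smul, inv_inv]
      refine Finset.sum_congr rfl fun n _ => ?_
      rw [hg, Finset.smul_sum]
      refine Finset.sum_congr rfl fun k hk => ?_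
      rcases le_or_gt k n with h | h
      · rw [hT k n h, smul_zero, smul_zero, smul_zero]
      · rw [smul_smul, mul_comm, hpow k n h (Finset.mem_range.1 hk)]
    refine ⟨g, Prod.ext (Prod.ext ?_ ?_) ?_⟩ <;> funext q <;> refine LinearMap.ext fun m => ?_
    · refine Eq.trans ?_ (key _ _ (x.1.1 q) (hal q) m)
      simp [c, y, z, Prod.fst_sum, Finset.sum_apply, LinearMap.sum_apply]
    · refine Eq.trans ?_ (key _ _ (x.1.2 q) (hep q) m)
      simp [c, y, z, Prod.fst_sum, Prod.snd_sum, Finset.sum_apply, LinearMap.sum_apply]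
    · change _ = x.2 q ((g q.1.1).symm m)
      simp [c, y, z, Prod.snd_sum, Finset.sum_apply, LinearMap.sum_apply, hg']
  have hcpoly : MapIn (polyFun ℂ) c := by
    have hτ : (fun τ : ℂ => τ) ∈ polyFun ℂ := Algebra.subset_adjoin ⟨LinearMap.id, rfl⟩
    exact MapIn.sum _ fun n _ => (MapIn.sum _ fun k _ => MapIn.smul (pow_mem hτ _)
      (MapIn.const _)).add (MapIn.smul (pow_mem hτ _) (MapIn.const _))
  have hcont := continuous_of_mem_polyFun (hcpoly.polyFun_comp hp)
  have hconst : (fun τ => p (c τ)) = fun _ => p x := by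
    refine hcont.ext_on (dense_compl_singleton (0 : ℂ)) continuous_const fun τ hτ => ?_
    obtain ⟨g, hg⟩ := hcact τ hτ
    simp only [hg, hinv]
  rw [← hc0]
  exact (congrFun hconst 0).symm

theorem apply_eq_apply_zero_of_isCritical {v : DimVec I} {x : FramedRep D (Std v) W}
    (hx : IsCritical x) {p : FramedRep D (Std v) W → ℂ} (hp : p ∈ polyFun (FramedRep D (Std v) W))
    (hinv : ∀ g y, p (act g y) = p y) : p x = p 0 := by
  have hrel := (isCritical_iff x).1 hx
  refine apply_eq_apply_zero_of_nilpotent (N := Module.finrank ℂ (⨁ s, Std v s))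
    (fun L hL hlen => ?_) hp hinv
  rw [← piRep_word x.1 hrel, piRep_long_word x.1 hrel L hL hlen]

end ZeroFiber

/-! ### Critical points and submodules -/

section Bijection

variable {v : DimVec I} {M : I × ℤ → Type*} [∀ s, AddCommGroup (M s)] [∀ s, Module ℂ (M s)]

theorem frameImage_eq_iff {X : TripleRep D M} {f f' : GrassFrame X v} :
    frameImage X v f = frameImage X v f' ↔
      ∀ s, LinearMap.range (f.1 s) = LinearMap.range (f'.1 s) := by
  rw [frameImage, frameImage, GrassAt.mk.injEq, funext_iff]

theorem frameImage_surjective (X : TripleRep D M) : Function.Surjective (frameImage X v) := by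
  intro U
  have := U.finite
  let e : ∀ s, Std v s ≃ₗ[ℂ] U.U s := fun s =>
    LinearEquiv.ofFinrankEq (Std v s) (U.U s) (by rw [U.finrank_eq]; simp)
  have hrange : ∀ s, LinearMap.range ((U.U s).subtype ∘ₗ (e s).toLinearMap) = U.U s := fun s => by
    rw [LinearMap.range_comp_of_range_eq_top _ (e s).range, Submodule.range_subtype]
  refine ⟨⟨fun s => (U.U s).subtype ∘ₗ (e s).toLinearMap, fun s =>
    (U.U s).injective_subtype.comp (e s).injective, ?_⟩, ?_⟩
  · simp only [hrange]
    exact U.isSubrep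
  · obtain ⟨U, h, h', h''⟩ := U
    simp only [frameImage, GrassAt.mk.injEq]
    exact funext hrange

/-- Two injective maps with the same image differ by an automorphism of the source. -/
theorem exists_comp_symm_eq {V : Type*} [AddCommGroup V] [Module ℂ V] {E : Type*} [AddCommGroup E]
    [Module ℂ E] {f f' : V →ₗ[ℂ] E} (hf : Function.Injective f) (hf' : Function.Injective f')
    (h : LinearMap.range f = LinearMap.range f') : ∃ g : V ≃ₗ[ℂ] V, f ∘ₗ g.symm.toLinearMap = f' := by
  refine ⟨(LinearEquiv.ofInjective f hf).trans ((LinearEquiv.ofEq _ _ h).trans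
    (LinearEquiv.ofInjective f' hf').symm), LinearMap.ext fun m => ?_⟩
  have h1 := congrArg Subtype.val ((LinearEquiv.ofInjective f hf).apply_symm_apply
    ((LinearEquiv.ofEq _ _ h).symm (LinearEquiv.ofInjective f' hf' m)))
  exact h1

variable {ι : Type*} [Finite ι] {q : ι → I × ℤ}
variable {W : I × ℤ → Type*} [∀ s, AddCommGroup (W s)] [∀ s, Module ℂ (W s)]
variable (β : ∀ s, Module.Basis {r : ι // q r = s} ℂ (W s))

/-- The injective map to `I_W` of a stable critical point. -/
def critGrassFrame (x : StableRep D W v) (hx : IsCritical x.1) : GrassFrame (injW D q) v :=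
  have h := isFramedMor_critFrame β x.1 ((isCritical_iff x.1).1 hx)
  ⟨critFrame β x.1 ((isCritical_iff x.1).1 hx), h.injective x.2, h.isSubrep_range⟩

theorem isFramedMor_critGrassFrame (x : StableRep D W v) (hx : IsCritical x.1) :
    IsFramedMor β x.1 (critGrassFrame β x hx).1 :=
  isFramedMor_critFrame β x.1 ((isCritical_iff x.1).1 hx)

/-- The stable representation of an injective map to `I_W`. -/
def stableFrameRep (f : GrassFrame (injW D q) v) : StableRep D W v :=
  ⟨frameRep β f, (isFramedMor_frameRep β f).stable f.2.1⟩

theorem isCritical_stableFrameRep (f : GrassFrame (injW D q) v) :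
    IsCritical (stableFrameRep β f).1 :=
  (isCritical_iff _).2 ((isFramedMor_frameRep β f).freeRep_rel f.2.1)

theorem critGrassFrame_stableFrameRep (f : GrassFrame (injW D q) v)
    (hx : IsCritical (stableFrameRep β f).1) : critGrassFrame β (stableFrameRep β f) hx = f :=
  Subtype.ext ((isFramedMor_critGrassFrame β _ hx).unique (isFramedMor_frameRep β f))

theorem stableFrameRep_critGrassFrame (x : StableRep D W v) (hx : IsCritical x.1) :
    stableFrameRep β (critGrassFrame β x hx) = x :=
  Subtype.ext ((isFramedMor_frameRep β _).unique_left (critGrassFrame β x hx).2.1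
    (isFramedMor_critGrassFrame β x hx))

/-- Two stable critical points are in the same orbit if and only if they give the same submodule. -/
theorem orbit_eq_iff_frameImage_eq {x x' : StableRep D W v} (hx : IsCritical x.1)
    (hx' : IsCritical x'.1) :
    (orbitSetoid D W v) x x' ↔ frameImage (injW D q) v (critGrassFrame β x hx) =
      frameImage (injW D q) v (critGrassFrame β x' hx') := by
  rw [frameImage_eq_iff]
  have h := isFramedMor_critGrassFrame β x hx
  have h' := isFramedMor_critGrassFrame β x' hx'
  constructor
  · rintro ⟨g, hg⟩ s
    have h1 := h.act g
    rw [hg] at h1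
    rw [h'.unique h1, LinearMap.range_comp_of_range_eq_top _ (g s).symm.range]
  · intro hr
    choose g hg using fun s => exists_comp_symm_eq ((critGrassFrame β x hx).2.1 s)
      ((critGrassFrame β x' hx').2.1 s) (hr s)
    have h1 := h.act g
    rw [funext hg] at h1
    exact ⟨g, h1.unique_left (critGrassFrame β x' hx').2.1 h'⟩

end Bijection

section Locus

variable {ι : Type*} [Finite ι] {q : ι → I × ℤ} {v : DimVec I}
variable {W : I × ℤ → Type*} [∀ s, AddCommGroup (W s)] [∀ s, Module ℂ (W s)]
variable (β : ∀ s, Module.Basis {r : ι // q r = s} ℂ (W s))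

theorem orbit_eq_iff {v v' : DimVec I} {x : StableRep D W v} {x' : StableRep D W v'} :
    orbit x = orbit x' ↔ ∃ h : v = v', (orbitSetoid D W v') (h ▸ x) x' := by
  constructor
  · intro h
    obtain rfl : v = v' := congrArg Sigma.fst h
    exact ⟨rfl, Quotient.exact (eq_of_heq (Sigma.mk.inj h).2)⟩
  · rintro ⟨rfl, h⟩
    exact congrArg (Sigma.mk v) (Quotient.sound h)

theorem orbit_mem_critLocus_iff {x : StableRep D W v} :
    orbit x ∈ critLocus D W ↔ IsCritical x.1 := by
  refine ⟨?_, fun h => ⟨v, x, rfl, h⟩⟩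
  rintro ⟨v', x', h, hx'⟩
  obtain ⟨rfl, g, hg⟩ := orbit_eq_iff.1 h
  rw [← hg]
  exact isCritical_act g hx'

/-- The point of the critical locus given by a submodule of `I_W`. -/
def grassToCrit (U : Grass (injW D q)) : critLocus D W :=
  ⟨orbit (stableFrameRep β (frameImage_surjective (injW D q) U.2).choose),
    orbit_mem_critLocus_iff.2 (isCritical_stableFrameRep β _)⟩

theorem grassToCrit_frameImage (f : GrassFrame (injW D q) v) :
    (grassToCrit β ⟨v, frameImage (injW D q) v f⟩).1 = orbit (stableFrameRep β f) := by
  refine orbit_eq_iff.2 ⟨rfl, (orbit_eq_iff_frameImage_eq β (isCritical_stableFrameRep β _)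
    (isCritical_stableFrameRep β _)).2 ?_⟩
  rw [critGrassFrame_stableFrameRep, critGrassFrame_stableFrameRep]
  exact (frameImage_surjective (injW D q) (frameImage (injW D q) v f)).choose_spec

theorem grassToCrit_critGrassFrame (x : StableRep D W v) (hx : IsCritical x.1) :
    (grassToCrit β ⟨v, frameImage (injW D q) v (critGrassFrame β x hx)⟩).1 = orbit x := by
  rw [grassToCrit_frameImage, stableFrameRep_critGrassFrame]

theorem grassToCrit_bijective : Function.Bijective (grassToCrit (D := D) (W := W) β) := by
  constructor
  · rintro ⟨v, U⟩ ⟨v', U'⟩ h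
    obtain ⟨f, rfl⟩ := frameImage_surjective _ U
    obtain ⟨f', rfl⟩ := frameImage_surjective _ U'
    have h1 := congrArg Subtype.val h
    rw [grassToCrit_frameImage, grassToCrit_frameImage] at h1
    obtain ⟨rfl, h2⟩ := orbit_eq_iff.1 h1
    have h3 := (orbit_eq_iff_frameImage_eq β (isCritical_stableFrameRep β _)
      (isCritical_stableFrameRep β _)).1 h2
    rw [critGrassFrame_stableFrameRep, critGrassFrame_stableFrameRep] at h3
    rw [h3]
  · rintro ⟨_, v, x, rfl, hx⟩
    exact ⟨_, Subtype.ext (grassToCrit_critGrassFrame β x hx)⟩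

/-- The bijection between the critical locus and the quiver Grassmannian. -/
def critEquiv : critLocus D W ≃ Grass (injW D q) :=
  (Equiv.ofBijective _ (grassToCrit_bijective β)).symm

theorem critEquiv_orbit (x : StableRep D W v) (hx : IsCritical x.1) :
    critEquiv β ⟨orbit x, orbit_mem_critLocus_iff.2 hx⟩ =
      ⟨v, frameImage (injW D q) v (critGrassFrame β x hx)⟩ := by
  rw [critEquiv, Equiv.symm_apply_eq]
  exact Subtype.ext (grassToCrit_critGrassFrame β x hx).symm

end Locus

/-! ### Continuity of the bijection -/

section Continuity

variable {M : I × ℤ → Type*} [∀ s, AddCommGroup (M s)] [∀ s, Module ℂ (M s)]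

variable {ι : Type*} [Finite ι] {q : ι → I × ℤ} {v : DimVec I}
variable {W : I × ℤ → Type*} [∀ s, AddCommGroup (W s)] [∀ s, Module ℂ (W s)]
variable (β : ∀ s, Module.Basis {r : ι // q r = s} ℂ (W s))

/-- The topology of the space of stable representations. -/
abbrev stableTop (τ : TopKind) : TopologicalSpace (StableRep D W v) :=
  TopologicalSpace.induced Subtype.val (vecTop τ (FramedRep D (Std v) W))

section Generic

variable {X : TripleRep D M}

/-- The topology of the space of injective maps whose image is a submodule. -/
abbrev frameTop (X : TripleRep D M) (v : DimVec I) (τ : TopKind) :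
    TopologicalSpace (GrassFrame X v) :=
  TopologicalSpace.induced Subtype.val (vecTop τ (∀ s, Std v s →ₗ[ℂ] M s))

theorem continuous_mk_frameImage (X : TripleRep D M) (τ : TopKind) (v : DimVec I) :
    @Continuous _ _ (frameTop X v τ) (grassTop X τ)
      fun f => (⟨v, frameImage X v f⟩ : Grass X) := by
  let _ := frameTop X v τ
  let _ := fun v => TopologicalSpace.coinduced (frameImage X v) (frameTop X v τ)
  have h : Continuous (frameImage X v) := continuous_coinduced_rng
  have h' : Continuous (Sigma.mk v : GrassAt X v → Grass X) := continuous_sigmaMk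
  exact h'.comp h

theorem continuous_grass_dom {Y : Type*} [TopologicalSpace Y] (τ : TopKind) (F : Grass X → Y)
    (h : ∀ v, @Continuous _ _ (frameTop X v τ) _ fun f => F ⟨v, frameImage X v f⟩) :
    @Continuous _ _ (grassTop X τ) _ F := by
  let _ := fun v => TopologicalSpace.coinduced (frameImage X v) (frameTop X v τ)
  exact continuous_sigma_iff.2 fun v => continuous_coinduced_dom.2 (h v)

theorem continuous_frame_of_mapIn {Y E : Type*} [AddCommGroup E] [Module ℂ E] (τ : TopKind)
    (j : Y → E) {F : Y → GrassFrame X v} (h : MapIn (locReg j) fun y => (F y).1) :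
    @Continuous _ _ (TopologicalSpace.induced j (vecTop τ E)) (frameTop X v τ) F :=
  continuous_induced_rng.2 (continuous_of_mapIn_locReg τ j h)

theorem continuous_stable_of_mapIn {Y E : Type*} [AddCommGroup E] [Module ℂ E] (τ : TopKind)
    (j : Y → E) {F : Y → StableRep D W v} (h : MapIn (locReg j) fun y => (F y).1) :
    @Continuous _ _ (TopologicalSpace.induced j (vecTop τ E)) (stableTop τ) F :=
  continuous_induced_rng.2 (continuous_of_mapIn_locReg τ j h)

end Generic

theorem continuous_act (τ : TopKind) (g : ∀ s, Std v s ≃ₗ[ℂ] Std v s) :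
    @Continuous _ _ (vecTop τ (FramedRep D (Std v) W)) (vecTop τ (FramedRep D (Std v) W))
      (act g) := by
  have h0 : act g (0 : FramedRep D (Std v) W) = 0 := by
    simpa using act_add_smul g (0 : FramedRep D (Std v) W) 0 1
  exact continuous_vecTop_of_linear τ
    { toFun := act g
      map_add' := fun x y => by simpa using act_add_smul g x y 1
      map_smul' := fun c x => by simpa [h0] using act_add_smul g 0 x c }

theorem stable_act {V : I × ℤ → Type*} [∀ s, AddCommGroup (V s)] [∀ s, Module ℂ (V s)]
    (g : ∀ s, V s ≃ₗ[ℂ] V s) {x : FramedRep D V W} (hx : Stable x) : Stable (act g x) := by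
  intro U hU hker s
  have h := hx (fun s => (U s).comap (g s).toLinearMap) ⟨fun p m hm => ?_, fun p m hm => ?_⟩
    (fun p m hm => ?_) s
  · refine (Submodule.eq_bot_iff _).2 fun m hm => ?_
    have h1 : (g s).symm m ∈ (U s).comap (g s).toLinearMap := by simpa using hm
    rw [h, Submodule.mem_bot] at h1
    simpa using h1
  · simpa [act] using hU.1 p hm
  · simpa [act] using hU.2 p hm
  · simpa [act] using hker p hm

/-- The quotient map from the stable representations to the quiver variety is open. -/
theorem isOpen_image_orbit (τ : TopKind) {T : Set (StableRep D W v)}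
    (hT : @IsOpen _ (stableTop τ) T) :
    @IsOpen _ (TopologicalSpace.coinduced (Quotient.mk (orbitSetoid D W v)) (stableTop τ))
      (Quotient.mk (orbitSetoid D W v) '' T) := by
  let _ := vecTop τ (FramedRep D (Std v) W)
  obtain ⟨T, hT', rfl⟩ := isOpen_induced_iff.1 hT
  refine isOpen_coinduced.2 (isOpen_induced_iff.2 ⟨⋃ g : ∀ s, Std v s ≃ₗ[ℂ] Std v s,
    act g ⁻¹' T, isOpen_iUnion fun g => hT'.preimage (continuous_act τ g), ?_⟩)
  ext x
  simp only [Set.mem_preimage, Set.mem_iUnion, Set.mem_image]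
  constructor
  · rintro ⟨g, hg⟩
    have hs : Stable (act g x.1) := stable_act g x.2
    exact ⟨⟨act g x.1, hs⟩, hg, (Quotient.sound (s := orbitSetoid D W v) ⟨g, rfl⟩ :
      Quotient.mk (orbitSetoid D W v) x = Quotient.mk (orbitSetoid D W v) ⟨act g x.1, hs⟩).symm⟩
  · rintro ⟨y, hy, hyx⟩
    obtain ⟨g, hg⟩ := Quotient.exact (s := orbitSetoid D W v) hyx.symm
    exact ⟨g, by rw [hg]; exact hy⟩

theorem continuous_stableFrameRep (τ : TopKind) :
    @Continuous _ _ (frameTop (injW D q) v τ) (stableTop τ) (stableFrameRep (W := W) β) :=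
  continuous_stable_of_mapIn τ _ (mapIn_frameRep β)

theorem mapIn_critGrassFrame :
    MapIn (locReg fun x : {x : StableRep D W v // IsCritical x.1} => x.1.1)
      fun x => (critGrassFrame β x.1 x.2).1 := by
  have h : MapIn (locReg fun x : {x : StableRep D W v // IsCritical x.1} => x.1.1)
      fun x : {x : StableRep D W v // IsCritical x.1} => x.1.1 :=
    MapIn.locReg _ mapIn_id
  exact mapIn_critFrame β h fun x => (isCritical_iff x.1.1).1 x.2

theorem continuous_critGrassFrame (τ : TopKind) :
    @Continuous {x : StableRep D W v // IsCritical x.1} (GrassFrame (injW D q) v)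
      (TopologicalSpace.induced Subtype.val (stableTop τ)) (frameTop (injW D q) v τ)
      fun x => critGrassFrame β x.1 x.2 := by
  rw [induced_compose]
  exact continuous_frame_of_mapIn τ _ (mapIn_critGrassFrame β)

theorem continuous_mk_orbit (τ : TopKind) :
    @Continuous _ _ (stableTop τ) (quiverVarietyTop D W τ)
      (orbit : StableRep D W v → QuiverVariety D W) := by
  let _ : ∀ v, TopologicalSpace (QuiverVarietyAt D W v) := fun v =>
    TopologicalSpace.coinduced (Quotient.mk (orbitSetoid D W v)) (stableTop τ)
  let _ : TopologicalSpace (StableRep D W v) := stableTop τ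
  have h : Continuous (Quotient.mk (orbitSetoid D W v)) := continuous_coinduced_rng
  have h' : Continuous (Sigma.mk v : QuiverVarietyAt D W v → QuiverVariety D W) :=
    @continuous_sigmaMk _ (QuiverVarietyAt D W) _ v
  exact h'.comp h

theorem continuous_grassToCrit (τ : TopKind) :
    @Continuous _ _ (grassTop (injW D q) τ)
      (TopologicalSpace.induced Subtype.val (quiverVarietyTop D W τ)) (grassToCrit β) := by
  let _ : TopologicalSpace (QuiverVariety D W) := quiverVarietyTop D W τ
  let _ := grassTop (injW D q) τ
  refine continuous_induced_rng.2 (continuous_grass_dom τ _ fun v => ?_)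
  let _ := frameTop (injW D q) v τ
  have h1 : (fun f => (grassToCrit (W := W) β ⟨v, frameImage (injW D q) v f⟩).1) =
      orbit ∘ stableFrameRep β := funext fun f => grassToCrit_frameImage β f
  change @Continuous _ _ _ _ fun f => (grassToCrit (W := W) β ⟨v, frameImage (injW D q) v f⟩).1
  rw [h1]
  exact @Continuous.comp _ _ _ (frameTop (injW D q) v τ) (stableTop τ) _ _ _
    (continuous_mk_orbit τ) (continuous_stableFrameRep β τ)

/-- The critical locus carries the quotient topology of the set of stable critical points, because
the quotient map from the stable representations is open. -/
theorem continuous_critLocus_dom {Z : Type*} [TopologicalSpace Z] (τ : TopKind)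
    (F : critLocus D W → Z)
    (h : ∀ v, @Continuous {x : StableRep D W v // IsCritical x.1} Z
      (TopologicalSpace.induced Subtype.val (stableTop τ)) _
      fun x => F ⟨orbit x.1, orbit_mem_critLocus_iff.2 x.2⟩) :
    @Continuous _ _ (TopologicalSpace.induced Subtype.val (quiverVarietyTop D W τ)) _ F := by
  let _ : ∀ v, TopologicalSpace (QuiverVarietyAt D W v) := fun v =>
    TopologicalSpace.coinduced (Quotient.mk (orbitSetoid D W v)) (stableTop τ)
  refine continuous_def.2 fun O hO => ?_
  have hT : ∀ v : DimVec I, ∃ T : Set (StableRep D W v), @IsOpen _ (stableTop τ) T ∧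
      ∀ (x : StableRep D W v) (hx : IsCritical x.1), x ∈ T ↔
        F ⟨orbit x, orbit_mem_critLocus_iff.2 hx⟩ ∈ O := by
    intro v
    obtain ⟨T, hT, h2⟩ := (@isOpen_induced_iff _ _ (stableTop τ) _ _).1
      (@IsOpen.preimage _ _ (_) _ _ (h v) _ hO)
    exact ⟨T, hT, fun x hx => Set.ext_iff.1 h2 ⟨x, hx⟩⟩
  choose T hT hTO using hT
  refine isOpen_induced_iff.2 ⟨{z : QuiverVariety D W |
    z.2 ∈ Quotient.mk (orbitSetoid D W z.1) '' T z.1},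
    isOpen_sigma_iff.2 fun v => isOpen_image_orbit τ (hT v), ?_⟩
  ext ⟨z, hz⟩
  obtain ⟨v, x, rfl, hx⟩ := hz
  rw [Set.mem_preimage, Set.mem_preimage, ← hTO v x hx]
  constructor
  -- a stable point in the orbit of a critical point is critical, and `F` takes the same value
  · rintro ⟨y, hy, hyx⟩
    have horb : orbit y = orbit x := congrArg (Sigma.mk v) hyx
    have hyc : IsCritical y.1 := by
      rw [← orbit_mem_critLocus_iff, horb]
      exact orbit_mem_critLocus_iff.2 hx
    rw [hTO v x hx]
    simp only [← horb]
    exact (hTO v y hyc).1 hy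
  · exact fun h => ⟨x, h, rfl⟩

theorem continuous_critEquiv (τ : TopKind) :
    @Continuous _ _ (TopologicalSpace.induced Subtype.val (quiverVarietyTop D W τ))
      (grassTop (injW D q) τ) (critEquiv β) := by
  let _ := grassTop (injW D q) τ
  refine continuous_critLocus_dom τ _ fun v => ?_
  have h : (fun x : {x : StableRep D W v // IsCritical x.1} =>
      critEquiv (q := q) β ⟨orbit x.1, orbit_mem_critLocus_iff.2 x.2⟩) =
        (fun f => ⟨v, frameImage (injW D q) v f⟩) ∘ fun x => critGrassFrame β x.1 x.2 :=
    funext fun x => critEquiv_orbit β x.1 x.2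
  rw [h]
  exact @Continuous.comp _ _ _ (_) (frameTop (injW D q) v τ) (_) _ _
    (continuous_mk_frameImage (injW D q) τ v) (continuous_critGrassFrame β τ)

end Continuity

end GradedTriple

end

open GradedTriple in
theorem proposition5p9 {I : Type*} [Fintype I] [DecidableEq I] (D : CartanDatum I)
    {ι : Type*} [Fintype ι] (q : ι → I × ℤ)
    (W : I × ℤ → Type*) [∀ s, AddCommGroup (W s)] [∀ s, Module ℂ (W s)]
    (β : ∀ s, Module.Basis {r : ι // q r = s} ℂ (W s)) :
    (∃ Φ : critLocus D W ≃ Grass (injW D q),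
      (∀ τ : TopKind,
        @IsHomeomorph _ _ (TopologicalSpace.induced Subtype.val (quiverVarietyTop D W τ))
          (grassTop (injW D q) τ) Φ) ∧
      (∀ z, (Φ z).1 = z.1.1) ∧
      (∀ z, ∀ (v : DimVec I) (x : StableRep D W v), orbit x = z.1 →
        IsRestriction D q β x.1 (Φ z).2.U)) ∧
    critLocus D W ⊆ zeroFiber D W := by
  refine ⟨⟨critEquiv β, fun τ => ?_, ?_, ?_⟩, ?_⟩
  · let _ : TopologicalSpace (critLocus D W) :=
      TopologicalSpace.induced Subtype.val (quiverVarietyTop D W τ)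
    let _ := grassTop (injW D q) τ
    exact Homeomorph.isHomeomorph
      { toEquiv := critEquiv β
        continuous_toFun := continuous_critEquiv β τ
        continuous_invFun := continuous_grassToCrit β τ }
  · rintro ⟨_, v, x, rfl, hx⟩
    rw [critEquiv_orbit β x hx]
    rfl
  · rintro ⟨z, hz⟩ v x rfl
    have hx := orbit_mem_critLocus_iff.1 hz
    rw [critEquiv_orbit β x hx]
    have h := isFramedMor_critGrassFrame β x hx
    exact ⟨(critGrassFrame β x hx).1, (critGrassFrame β x hx).2.1, fun _ => rfl, h.al, h.ep, h.frame⟩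
  · rintro _ ⟨v, x, rfl, hx⟩
    exact ⟨v, x, rfl, fun p hp hinv => apply_eq_apply_zero_of_isCritical hx hp hinv⟩
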